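/- Let $(M,g)$ be a complete Riemannian manifold of dimension $n$ (smooth, without boundary, second countable), let $\varphi:M\to\mathbb R$ be smooth, and let $d\mu=e^{-\varphi}\,dV_g$. Let $p>1$, $q>0$, $\delta=q(p-1)-1$, and let $-\infty<a<b\le+\infty$; for $b=+\infty$ the interval $[a,b]$ means $[a,\infty)$. Write $s^q:=|s|^{q-1}s$ for $s\in\mathbb R$. Let $L^r_\varphi(M)=L^r(M,\mu)$, let $W^{1,r}_\varphi(M)$ be the space of $f\in L^r_\varphi(M)$ whose weak gradient exists and lies in $L^r_\varphi$, and let $W^{1,r}_{0;\varphi}(M)$ be the closure of $C_c^\infty(M)$ in it. Let $u$ solve $\partial_t u=\mathcal L_{p,\varphi}u^q:=e^{\varphi}\operatorname{div}\big(e^{-\varphi}|\nabla u^q|^{p-2}\nabla u^q\big)$ on $M\times[a,b]$, with $$u(\cdot,t),\ u_t(\cdot,t)\in W^{1,q+1}_{0;\varphi}(M),\qquad \nabla u^q(\cdot,t)\in L^p_\varphi\qquad\text{for every } t\in[a,b].$$ Here $u_t(\cdot,t)$ is the derivative (one-sided at the endpoints) of the curve $t\mapsto u(\cdot,t)$ in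 $L^{q+1}_\varphi(M)$, and the equation holds in the weak sense at every $t\in[a,b]$: $$\int_M u_t\,\psi\,d\mu=-\int_M|\nabla u^q|^{p-2}\langle\nabla u^q,\nabla\psi\rangle\,d\mu\qquad\text{for all }\psi\in C_c^\infty(M).$$ Below, $\equiv 0$ means equal to zero almost everywhere on $M$. (1) Suppose $u(\cdot,a)\not\equiv0$. If $\delta\ge0$, then $u(\cdot,t)\not\equiv0$ for every $t\in[a,b]$. If $\delta<0$, then $u(\cdot,t)\not\equiv0$ for every $t\in[a,b_0)$, where $$b_0=\min\Big\{a+\frac1{N(a)\,\delta},\,b\Big\},\qquad N(a)=-\frac{\int_M|\nabla u^q(\cdot,a)|^p\,d\mu}{\int_M|u(\cdot,a)|^{q+1}\,d\mu}\le 0,$$ and $1/(N(a)\delta)=+\infty$ if $N(a)=0$. (2) (Backward uniqueness.) If $\delta\ge0$, $b<\infty$ and $u(\cdot,b)\equiv0$, then $u(\cdot,t)\equiv0$ for every $t\in[a,b]$. -/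

import Mathlib

open MeasureTheory Filter Topology Bundle
open scoped Manifold ContDiff ENNReal

noncomputable section

namespace DoublyNonlinear

section Geometry

variable {n : ℕ} {M : Type*} [EMetricSpace M] [ChartedSpace (EuclideanSpace ℝ (Fin n)) M]

/-- The tangent vector `dα⁻¹(w)` at the point `α⁻¹(y)`, where `α` is the preferred chart at `x₀`.
For `w` the `i`-th standard basis vector this is the coordinate vector field `∂ᵢ`. -/
def coordVec (x₀ : M) (w y : EuclideanSpace ℝ (Fin n)) :
    TangentSpace (𝓡 n) ((extChartAt (𝓡 n) x₀).symm y) :=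
  mfderiv (𝓡 n) (𝓡 n) (extChartAt (𝓡 n) x₀).symm y w

variable [RiemannianBundle (fun x : M ↦ TangentSpace (𝓡 n) x)]

/-- The volume density `√(det gᵢⱼ)` in the preferred chart at `x₀`. -/
def volDensity (x₀ : M) (y : EuclideanSpace ℝ (Fin n)) : ℝ :=
  √(Matrix.det (Matrix.of fun i j : Fin n ↦
    inner ℝ (coordVec x₀ (EuclideanSpace.single i 1) y)
      (coordVec x₀ (EuclideanSpace.single j 1) y)))

variable [MeasurableSpace M]

/-- The Riemannian volume of the domain of the preferred chart at `x₀` (zero outside of it):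
`√(det gᵢⱼ) dy` transported from the target of the chart. -/
def chartVolume (x₀ : M) : Measure M :=
  ((volume.restrict (extChartAt (𝓡 n) x₀).target).withDensity
    (fun y ↦ ENNReal.ofReal (volDensity (n := n) x₀ y))).map (extChartAt (𝓡 n) x₀).symm

variable (n M) in
/-- The Riemannian volume measure `dV_g`. The chart volumes agree on the overlaps of the chart
domains, so their least upper bound is the measure which restricts to each of them. -/
def riemannianVolume : Measure M := ⨆ x₀ : M, chartVolume (n := n) x₀

variable (n) in
/-- The weighted volume measure `e^{-φ} dV_g`. -/
def weightedVolume (φ : M → ℝ) : Measure M :=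
  (riemannianVolume n M).withDensity fun x ↦ ENNReal.ofReal (Real.exp (-φ x))

/-- `G` is the gradient of `f` in the weak sense: in each chart, the covariant components
`⟨G, ∂_w⟩` are the weak (distributional) partial derivatives of `f`. -/
def HasWeakGradient (f : M → ℝ) (G : ∀ x : M, TangentSpace (𝓡 n) x) : Prop :=
  ∀ x₀ : M,
    LocallyIntegrableOn (fun y ↦ f ((extChartAt (𝓡 n) x₀).symm y)) (extChartAt (𝓡 n) x₀).target ∧
    ∀ w : EuclideanSpace ℝ (Fin n),
      LocallyIntegrableOn
        (fun y ↦ inner ℝ (G ((extChartAt (𝓡 n) x₀).symm y)) (coordVec x₀ w y))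
        (extChartAt (𝓡 n) x₀).target ∧
      ∀ ψ : EuclideanSpace ℝ (Fin n) → ℝ, ContDiff ℝ ∞ ψ → HasCompactSupport ψ →
        tsupport ψ ⊆ (extChartAt (𝓡 n) x₀).target →
        ∫ y, f ((extChartAt (𝓡 n) x₀).symm y) * fderiv ℝ ψ y w =
          -∫ y, inner ℝ (G ((extChartAt (𝓡 n) x₀).symm y)) (coordVec x₀ w y) * ψ y

variable (n) in
open Classical in
/-- The weak gradient `∇f` (unique almost everywhere); zero if `f` has no weak gradient. -/
def weakGrad (f : M → ℝ) : ∀ x : M, TangentSpace (𝓡 n) x :=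
  if h : ∃ G : ∀ x : M, TangentSpace (𝓡 n) x, HasWeakGradient f G then h.choose else fun _ ↦ 0

variable (n) in
/-- `∇f` exists in the weak sense and belongs to `L^r_φ`. -/
def WeakGradMemLp (φ : M → ℝ) (r : ℝ) (f : M → ℝ) : Prop :=
  (∃ G : ∀ x : M, TangentSpace (𝓡 n) x, HasWeakGradient f G) ∧
    MemLp (fun x ↦ ‖weakGrad n f x‖) (ENNReal.ofReal r) (weightedVolume n φ)

variable (n) in
/-- The weighted Sobolev space `W^{1,r}_φ(M)`. -/
def MemW (φ : M → ℝ) (r : ℝ) (f : M → ℝ) : Prop :=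
  MemLp f (ENNReal.ofReal r) (weightedVolume n φ) ∧ WeakGradMemLp n φ r f

variable (n) in
/-- Smooth functions with compact support. -/
def IsTestFunction (ψ : M → ℝ) : Prop :=
  ContMDiff (𝓡 n) 𝓘(ℝ, ℝ) ∞ ψ ∧ HasCompactSupport ψ

variable (n) in
/-- The space `W^{1,r}_{0;φ}(M)`: the closure of `C_c^∞(M)` in `W^{1,r}_φ(M)`. -/
def MemW₀ (φ : M → ℝ) (r : ℝ) (f : M → ℝ) : Prop :=
  MemW n φ r f ∧ ∃ ψ : ℕ → M → ℝ, (∀ k, IsTestFunction n (ψ k)) ∧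
    Tendsto (fun k ↦ eLpNorm (fun x ↦ f x - ψ k x) (ENNReal.ofReal r) (weightedVolume n φ))
      atTop (𝓝 0) ∧
    Tendsto (fun k ↦ eLpNorm (fun x ↦ ‖weakGrad n f x - weakGrad n (ψ k) x‖)
      (ENNReal.ofReal r) (weightedVolume n φ)) atTop (𝓝 0)

end Geometry

/-- The signed power `s^q = |s|^{q-1} s`. -/
def signedPow (q s : ℝ) : ℝ := |s| ^ (q - 1) * s

/-- The time interval `[a, b]`, which is `[a, ∞)` for `b = ∞`. -/
def timeInterval (a : ℝ) (b : EReal) : Set ℝ := {t | a ≤ t ∧ (t : EReal) ≤ b}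

section Equation

variable (n : ℕ) {M : Type*} [EMetricSpace M] [ChartedSpace (EuclideanSpace ℝ (Fin n)) M]

/-- The differential `dψ` at `x` of a real function. -/
def differential (ψ : M → ℝ) (x : M) : TangentSpace (𝓡 n) x →L[ℝ] ℝ :=
  mfderiv (𝓡 n) 𝓘(ℝ, ℝ) ψ x

variable
  [RiemannianBundle (fun x : M ↦ TangentSpace (𝓡 n) x)] [MeasurableSpace M]

/-- `f = L_{p,φ} v = e^φ div(e^{-φ} |∇v|^{p-2} ∇v)` in the weak sense, that is,
`∫ f ψ e^{-φ} dV_g = -∫ |∇v|^{p-2} ⟨∇v, ∇ψ⟩ e^{-φ} dV_g` for all `ψ ∈ C_c^∞(M)`. Here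
`⟨∇v, ∇ψ⟩` is written as the differential of `ψ` applied to `∇v`. -/
def IsWeightedPLaplacian (φ : M → ℝ) (p : ℝ) (v f : M → ℝ) : Prop :=
  ∀ ψ : M → ℝ, IsTestFunction n ψ →
    ∫ x, f x * ψ x ∂(weightedVolume n φ) =
      -∫ x, ‖weakGrad n v x‖ ^ (p - 2) * differential n ψ x (weakGrad n v x)
        ∂(weightedVolume n φ)

/-- `f` is the derivative at time `t` of the curve `s ↦ u(·, s)` (for `s ∈ J`) in `L^r_φ(M)`. -/
def IsTimeDerivAt (φ : M → ℝ) (r : ℝ) (J : Set ℝ) (u : ℝ → M → ℝ) (t : ℝ) (f : M → ℝ) : Prop :=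
  Tendsto (fun s ↦ eLpNorm (fun x ↦ (u s x - u t x) / (s - t) - f x)
    (ENNReal.ofReal r) (weightedVolume n φ)) (𝓝[J \ {t}] t) (𝓝 0)

/-- `u` solves `∂ₜ u = L_{p,φ} u^q` on `M × J`, and for each `t ∈ J` one has
`u, uₜ ∈ W^{1,q+1}_{0;φ}(M)` and `∇u^q ∈ L^p_φ`. -/
def IsSolution (φ : M → ℝ) (p q : ℝ) (J : Set ℝ) (u : ℝ → M → ℝ) : Prop :=
  ∃ ut : ℝ → M → ℝ, ∀ t ∈ J,
    MemW₀ n φ (q + 1) (u t) ∧ MemW₀ n φ (q + 1) (ut t) ∧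
    WeakGradMemLp n φ p (fun x ↦ signedPow q (u t x)) ∧
    IsTimeDerivAt n φ (q + 1) J u t (ut t) ∧
    IsWeightedPLaplacian n φ p (fun x ↦ signedPow q (u t x)) (ut t)

/-- `I = ∫ |f|^{q+1} e^{-φ} dV_g` of a time slice `f`. -/
def energyI (φ : M → ℝ) (q : ℝ) (f : M → ℝ) : ℝ :=
  ∫ x, |f x| ^ (q + 1) ∂(weightedVolume n φ)

/-- `D = -∫ |∇ f^q|^p e^{-φ} dV_g` of a time slice `f`. -/
def energyD (φ : M → ℝ) (p q : ℝ) (f : M → ℝ) : ℝ :=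
  -∫ x, ‖weakGrad n (fun x ↦ signedPow q (f x)) x‖ ^ p ∂(weightedVolume n φ)

/-- The parabolic frequency `N = D / I` of a time slice `f`. -/
def frequency (φ : M → ℝ) (p q : ℝ) (f : M → ℝ) : ℝ :=
  energyD n φ p q f / energyI n φ q f

end Equation

/-- `b₀ = min {a + 1 / (N δ), b}`, where `1 / (N δ) = ∞` if `N = 0`
(it is used for `N ≤ 0` and `δ < 0`, so that `N δ ≥ 0`). -/
def extinctionBound (a : ℝ) (b : EReal) (N δ : ℝ) : EReal :=
  min ((a : EReal) + (((ENNReal.ofReal (N * δ))⁻¹ : ℝ≥0∞) : EReal)) b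

end DoublyNonlinear

end

/-! Put I = ∫ |u|^(q+1), y = I^(1/(q+1)) and E = ∫ |∇u^q|^p. Testing the equation with u^q gives I'
= -(q+1) E, that is, y' = -E y^(-q). Suppose that the Rayleigh quotient E / y^(pq) does not increase
and let h be its initial value. Then y' ≥ -h y^(1+δ). For δ ≥ 0 the decay is at worst exponential,
so y never reaches zero. For δ < 0 the quantity y^(-δ) decreases at most linearly, which gives the
explicit time b₀. Backward uniqueness is the contrapositive of the case δ ≥ 0, with the evolution
started at an arbitrary time instead of a.

The monotonicity cannot be obtained by differentiating E, because nothing is known about ∇u^q as a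
function of time. It comes from the two-time pairing g(s,t) = ∫ u(s)^q u(t). Hölder's inequality
gives g(s,t) ≤ y(t) y(s)^q, with equality for t = s. Testing the equation at time t with u(s)^q
gives -∂ₜg ≤ E(t)^(1-1/p) E(s)^(1/p). Together with Young's inequality and a maximum point argument
these facts prove `rayleigh_le`; `pos_of_deriv_ge` and `energy_pos` then integrate the differential
inequality. The derivative of I along a curve that is merely differentiable in L^(q+1) is
`CurveDeriv.hasDerivWithinAt_energy`, which rests on convexity.

The analytic difficulty is to justify testing with v = u(s)^q. This function lies in L^((q+1)/q)
with gradient in L^p, but it has no compact support and is not assumed to be a limit of test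
functions. Completeness enters here: by the Hopf–Rinow argument closed balls are compact, so there
are compactly supported cutoffs χ_k with Lipschitz constant 1/(k+1) that tend to 1
(`isCompact_closedEBall`, `exists_cutoff`). The equation is tested with Φ(v) χ_k, where Φ is a
smooth truncation. In a chart this is done by mollifying v and χ_k (`abs_integral_test_le`), and a
partition of unity globalizes it (`exists_abs_integral_test_le`). The cutoff costs at most a
multiple of 1/(k+1) times ∫ |Φ(v)| |A|, where A = |∇u^q|^(p-2) ∇u^q lies in L^(p/(p-1)). Since v
itself need not be in L^p, Φ has to be bounded and to vanish near 0, and the level set {v = 0} needs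
a separate argument; both are in `integral_mul_eq_neg_of_test`. -/

set_option linter.unusedSectionVars false

noncomputable section

namespace DoublyNonlinear

/-! ### The one-dimensional core: monotone Rayleigh quotient and decay of the norm. -/

section Rayleigh

open Set

/-- Weighted Young inequality in the form used to compare the growth of `g s` and of `y`. -/
lemma rayleigh_young {p q E E' y y' m : ℝ} (hp : 1 < p) (hE : 0 ≤ E) (hE' : 0 ≤ E')
    (hy : 0 < y) (hy' : 0 < y') (h : E' ≤ m * y' ^ (p * q)) :
    E ^ (1 - 1 / p) * E' ^ (1 / p) - E * y ^ (-q) * y' ^ q ≤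
      y' ^ q / p * (m * y ^ (p * q - q) - E * y ^ (-q)) := by
  have hp0 : 0 < p := by linarith
  have hY : 0 < y ^ (-q) := Real.rpow_pos_of_pos hy _
  have hY' : 0 < y' ^ q := Real.rpow_pos_of_pos hy' _
  -- X is E' rescaled from norm y' to norm y, using that E is homogeneous like y^(pq). Young's
  -- inequality between E and X then has the factor y'^q y^(-q) common to all terms.
  set X : ℝ := E' * y' ^ (-(p * q)) * y ^ (p * q) with hX
  have hX0 : 0 ≤ X := by positivity
  have hXm : X ≤ m * y ^ (p * q) := by
    have : E' * y' ^ (-(p * q)) ≤ m := by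
      rw [Real.rpow_neg hy'.le, ← div_eq_mul_inv, div_le_iff₀ (Real.rpow_pos_of_pos hy' _)]
      exact h
    exact mul_le_mul_of_nonneg_right this (Real.rpow_nonneg hy.le _)
  have hXp : X ^ (1 / p) = E' ^ (1 / p) * (y' ^ q)⁻¹ * (y ^ (-q))⁻¹ := by
    rw [hX, Real.mul_rpow (by positivity) (by positivity), Real.mul_rpow hE' (by positivity),
      ← Real.rpow_mul hy'.le, ← Real.rpow_mul hy.le, Real.rpow_neg hy.le q, inv_inv,
      ← Real.rpow_neg hy'.le]
    congr 3 <;> field_simp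
  have hE1 : E' ^ (1 / p) = X ^ (1 / p) * y' ^ q * y ^ (-q) := by
    rw [hXp]; field_simp
  have young : E ^ (1 - 1 / p) * X ^ (1 / p) ≤ (1 - 1 / p) * E + 1 / p * X :=
    Real.geom_mean_le_arith_mean2_weighted
      (by rw [sub_nonneg, div_le_one hp0]; exact hp.le) (by positivity) hE hX0 (by ring)
  have hsplit : y ^ (p * q - q) = y ^ (p * q) * y ^ (-q) := by
    rw [← Real.rpow_add hy]; ring_nf
  rw [hE1, hsplit]
  have h1 : E ^ (1 - 1 / p) * X ^ (1 / p) - E ≤ 1 / p * (m * y ^ (p * q) - E) := by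
    have : 1 / p * X ≤ 1 / p * (m * y ^ (p * q)) :=
      mul_le_mul_of_nonneg_left hXm (by positivity)
    linarith
  have := mul_le_mul_of_nonneg_left h1 (mul_pos hY' hY).le
  calc _ = y' ^ q * y ^ (-q) * (E ^ (1 - 1 / p) * X ^ (1 / p) - E) := by ring
    _ ≤ _ := this
    _ = _ := by ring

variable {p q t₁ t₂ : ℝ} {y E : ℝ → ℝ} {g g' : ℝ → ℝ → ℝ}

/-- The Rayleigh quotient `E / y ^ (p q)` does not increase along the flow. -/
theorem rayleigh_le (hp : 1 < p) (ht : t₁ < t₂)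
    (hy : ∀ t ∈ Icc t₁ t₂, 0 < y t) (hE : ∀ t ∈ Icc t₁ t₂, 0 ≤ E t)
    (hy' : ∀ t ∈ Icc t₁ t₂, HasDerivWithinAt y (-(E t * y t ^ (-q))) (Icc t₁ t₂) t)
    (hg' : ∀ s ∈ Icc t₁ t₂, ∀ t ∈ Icc t₁ t₂, HasDerivWithinAt (g s) (g' s t) (Icc t₁ t₂) t)
    (hgs : ∀ s ∈ Icc t₁ t₂, g s s = y s * y s ^ q)
    (hgle : ∀ s ∈ Icc t₁ t₂, ∀ t ∈ Icc t₁ t₂, g s t ≤ y t * y s ^ q)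
    (hgE : ∀ s ∈ Icc t₁ t₂, ∀ t ∈ Icc t₁ t₂,
      -g' s t ≤ E t ^ (1 - 1 / p) * E s ^ (1 / p)) :
    E t₂ * y t₂ ^ (-(p * q)) ≤ E t₁ * y t₁ ^ (-(p * q)) := by
  have hp0 : 0 < p := by linarith
  set m : ℝ := E t₁ * y t₁ ^ (-(p * q)) with hm
  by_contra! hlt
  have hm1 : t₁ ∈ Icc t₁ t₂ := left_mem_Icc.2 ht.le
  have hm2 : t₂ ∈ Icc t₁ t₂ := right_mem_Icc.2 ht.le
  have hyc : ContinuousOn y (Icc t₁ t₂) := fun t h ↦ (hy' t h).continuousWithinAt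
  have hzc : ContinuousOn (fun t ↦ m * y t ^ (p * q - q)) (Icc t₁ t₂) :=
    continuousOn_const.mul (hyc.rpow_const fun t h ↦ Or.inl (hy t h).ne')
  -- Extending the integrand continuously to the whole line makes its primitive differentiable at
  -- the endpoints as well.
  set Z : ℝ → ℝ := IccExtend ht.le ((Icc t₁ t₂).domRestrict fun t ↦ m * y t ^ (p * q - q)) with hZ
  have hZc : Continuous Z := hzc.domRestrict.Icc_extend'
  have hZe : ∀ t ∈ Icc t₁ t₂, Z t = m * y t ^ (p * q - q) := fun t h ↦ by
    rw [hZ, IccExtend_of_mem _ _ h]; rfl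
  -- R' = y^(pq-q) (m - quotient), so the sign of R' compares the quotient with m. If the quotient
  -- exceeds m at t₂, then R is larger than R t₂ just before t₂, hence at its maximum point, where
  -- the quotient turns out to be m; `key` excludes this.
  set R : ℝ → ℝ := fun t ↦ y t + ∫ x in t₁..t, Z x with hR
  have hR' : ∀ t ∈ Icc t₁ t₂, HasDerivWithinAt R
      (m * y t ^ (p * q - q) - E t * y t ^ (-q)) (Icc t₁ t₂) t := fun t h ↦ by
    have h1 := (hy' t h).add
      (hZc.integral_hasStrictDerivAt t₁ t).hasDerivAt.hasDerivWithinAt (s := Icc t₁ t₂)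
    rw [hZe t h] at h1
    exact h1.congr_deriv (by ring)
  have hRc : ContinuousOn R (Icc t₁ t₂) := fun t h ↦ (hR' t h).continuousWithinAt
  have hfac : ∀ t ∈ Icc t₁ t₂, m * y t ^ (p * q - q) - E t * y t ^ (-q) =
      y t ^ (p * q - q) * (m - E t * y t ^ (-(p * q))) := fun t h ↦ by
    have : y t ^ (-q) = y t ^ (p * q - q) * y t ^ (-(p * q)) := by
      rw [← Real.rpow_add (hy t h)]; ring_nf
    rw [this]; ring
  -- `R` stays above its value at each point where the quotient is at most `m`
  have key : ∀ s ∈ Icc t₁ t₂, E s * y s ^ (-(p * q)) ≤ m → R s ≤ R t₂ := fun s hs hsm ↦ by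
    have hEs : E s ≤ m * y s ^ (p * q) := by
      rwa [Real.rpow_neg (hy s hs).le, ← div_eq_mul_inv,
        div_le_iff₀ (Real.rpow_pos_of_pos (hy s hs) _)] at hsm
    have hsub : Icc s t₂ ⊆ Icc t₁ t₂ := Icc_subset_Icc_left hs.1
    set c : ℝ := y s ^ q with hc
    have hc0 : 0 < c := Real.rpow_pos_of_pos (hy s hs) _
    have hd : ∀ t ∈ Icc t₁ t₂, HasDerivWithinAt (fun t ↦ y t * c - g s t - c / p * R t)
        (-(E t * y t ^ (-q)) * c - g' s t - c / p * (m * y t ^ (p * q - q) - E t * y t ^ (-q)))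
        (Icc t₁ t₂) t := fun t h ↦
      (((hy' t h).mul_const c).sub (hg' s hs t h)).sub ((hR' t h).const_mul (c / p))
    -- By `rayleigh_young` the deficit y c - g s grows at most at the rate (c/p) R'. It vanishes at
    -- s and is nonnegative at t₂, by Hölder and its equality case, so R cannot be smaller at t₂
    -- than at s.
    have hanti : AntitoneOn (fun t ↦ y t * c - g s t - c / p * R t) (Icc s t₂) := by
      apply antitoneOn_of_hasDerivWithinAt_nonpos (convex_Icc s t₂)
        (fun t h ↦ ((hd t (hsub h)).mono hsub).continuousWithinAt)
        (fun t h ↦ (hd t (hsub (interior_subset h))).mono (interior_subset.trans hsub))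
      intro t h
      have hmem := hsub (interior_subset h)
      have h1 := rayleigh_young (q := q) hp (hE t hmem) (hE s hs) (hy t hmem) (hy s hs) hEs
      have h2 := hgE s hs t hmem
      rw [← hc] at h1
      linarith
    have h1 := hanti (left_mem_Icc.2 hs.2) (right_mem_Icc.2 hs.2) hs.2
    simp only [hgs s hs] at h1
    have h2 := hgle s hs t₂ hm2
    have h3 : c / p * R s ≤ c / p * R t₂ := by rw [← hc] at h1 h2; linarith
    exact le_of_mul_le_mul_left h3 (by positivity)
  obtain ⟨c, hc, hmax⟩ := isCompact_Icc.exists_isMaxOn ⟨t₁, hm1⟩ hRc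
  have hneg : m * y t₂ ^ (p * q - q) - E t₂ * y t₂ ^ (-q) < 0 := by
    rw [hfac t₂ hm2]
    exact mul_neg_of_pos_of_neg (Real.rpow_pos_of_pos (hy t₂ hm2) _) (by linarith)
  have hRlt : R t₂ < R c := by
    have h1 := hasDerivWithinAt_iff_tendsto_slope.1 (hR' t₂ hm2)
    have h2 : ∀ᶠ s in 𝓝[Icc t₁ t₂ \ {t₂}] t₂, slope R t₂ s < 0 := h1.eventually_lt_const hneg
    have hne : (𝓝[Icc t₁ t₂ \ {t₂}] t₂).NeBot := by
      rw [show Icc t₁ t₂ \ {t₂} = Ico t₁ t₂ from Icc_sdiff_right]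
      exact right_nhdsWithin_Ico_neBot ht
    obtain ⟨s, hs, hs'⟩ := (h2.and self_mem_nhdsWithin).exists
    have hst : s < t₂ := lt_of_le_of_ne hs'.1.2 hs'.2
    rw [slope_def_field, div_neg_iff] at hs
    have : R t₂ < R s := by
      rcases hs with h | h
      · linarith [h.1]
      · linarith [h.2]
    exact this.trans_le (hmax hs'.1)
  -- At the maximum point c the quotient is m: at c = t₁ by the choice of m, in the interior because
  -- R' vanishes there.
  refine absurd (key c hc ?_) (not_le.2 hRlt)
  rcases eq_or_lt_of_le hc.1 with h | h
  · rw [← h]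
  have hct : c < t₂ := lt_of_le_of_ne hc.2 fun h ↦ by simp [h] at hRlt
  have hnhds : Icc t₁ t₂ ∈ 𝓝 c := Icc_mem_nhds h hct
  have h0 := (hmax.isLocalMax hnhds).hasDerivAt_eq_zero ((hR' c hc).hasDerivAt hnhds)
  rw [hfac c hc] at h0
  rcases mul_eq_zero.1 h0 with h1 | h1
  · exact absurd h1 (Real.rpow_pos_of_pos (hy c hc) _).ne'
  · linarith

/-- Lower bound up to time `T` for a solution of `y' ≥ -h y ^ (p q - q)`. -/
theorem pos_of_deriv_ge {h a T : ℝ} {d : ℝ → ℝ} (hh : 0 ≤ h) (haT : a < T)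
    (hyc : ContinuousOn y (Icc a T)) (hy : ∀ t ∈ Ico a T, 0 < y t)
    (hyT : 0 ≤ y T)
    (hd : ∀ t ∈ Ico a T, HasDerivWithinAt y (d t) (Icc a T) t)
    (hd0 : ∀ t ∈ Ico a T, d t ≤ 0)
    (hdh : ∀ t ∈ Ico a T, -(h * y t ^ (p * q - q)) ≤ d t)
    (hδ : q * (p - 1) - 1 < 0 →
      0 < y a ^ (-(q * (p - 1) - 1)) + (q * (p - 1) - 1) * h * (T - a)) :
    0 < y T := by
  have hint : interior (Icc a T) ⊆ Ico a T := by
    rw [interior_Icc]; exact Ioo_subset_Ico_self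
  have ha : a ∈ Ico a T := left_mem_Ico.2 haT
  have hai : a ∈ Icc a T := left_mem_Icc.2 haT.le
  have hTi : T ∈ Icc a T := right_mem_Icc.2 haT.le
  set δ := q * (p - 1) - 1 with hδd
  have hex : p * q - q = 1 + δ := by rw [hδd]; ring
  -- For δ ≥ 0 the function y decreases, so y^δ ≤ y(a)^δ and the inequality becomes y' ≥ -κ y,
  -- handled by an integrating factor. For δ < 0 the power y^(-δ) is the variable in which y' = -h
  -- y^(1+δ) has constant slope δ h.
  rcases le_or_gt 0 δ with h0 | h0
  · have hanti : AntitoneOn y (Icc a T) :=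
      antitoneOn_of_hasDerivWithinAt_nonpos (convex_Icc a T) hyc
        (fun t ht ↦ (hd t (hint ht)).mono interior_subset) fun t ht ↦ hd0 t (hint ht)
    set κ := h * y a ^ δ with hκ
    have hmono : MonotoneOn (fun t ↦ Real.exp (κ * t) * y t) (Icc a T) := by
      apply monotoneOn_of_hasDerivWithinAt_nonneg (convex_Icc a T)
        (f' := fun t ↦ Real.exp (κ * t) * κ * y t + Real.exp (κ * t) * d t)
      · exact (Continuous.continuousOn (by fun_prop)).mul hyc
      · intro t ht
        have h1 : HasDerivAt (fun t ↦ Real.exp (κ * t)) (Real.exp (κ * t) * κ) t := by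
          simpa using ((hasDerivAt_id t).const_mul κ).exp
        exact h1.hasDerivWithinAt.mul ((hd t (hint ht)).mono interior_subset)
      · intro t ht
        have hpos := hy t (hint ht)
        have h2 : y t ^ δ ≤ y a ^ δ := Real.rpow_le_rpow hpos.le
          (hanti hai (interior_subset ht) (interior_subset ht).1) h0
        have h3 : h * y t ^ (p * q - q) ≤ κ * y t := by
          rw [hex, Real.rpow_add hpos, Real.rpow_one, hκ]
          have := mul_le_mul_of_nonneg_left h2 (mul_nonneg hh hpos.le)
          linarith
        have h4 : 0 ≤ κ * y t + d t := by linarith [hdh t (hint ht)]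
        have := mul_nonneg (Real.exp_pos (κ * t)).le h4
        linarith
    have h1 := hmono hai hTi haT.le
    have h2 : 0 < Real.exp (κ * a) * y a := mul_pos (Real.exp_pos _) (hy a ha)
    exact pos_of_mul_pos_right (h2.trans_le h1) (Real.exp_pos _).le
  · have hmono : MonotoneOn (fun t ↦ y t ^ (-δ) - δ * h * t) (Icc a T) := by
      apply monotoneOn_of_hasDerivWithinAt_nonneg (convex_Icc a T)
        (f' := fun t ↦ d t * (-δ) * y t ^ (-δ - 1) - δ * h)
      · exact (hyc.rpow_const fun _ _ ↦ Or.inr (by linarith)).sub (by fun_prop)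
      · intro t ht
        have h1 := ((hd t (hint ht)).mono interior_subset).rpow_const (p := -δ)
          (Or.inl (hy t (hint ht)).ne')
        have h2 : HasDerivAt (fun t ↦ δ * h * t) (δ * h) t := by
          simpa using (hasDerivAt_id t).const_mul (δ * h)
        exact h1.sub h2.hasDerivWithinAt
      · intro t ht
        have hpos := hy t (hint ht)
        have h1 := hdh t (hint ht)
        have h2 : y t ^ (p * q - q) * y t ^ (-δ - 1) = 1 := by
          rw [hex, ← Real.rpow_add hpos, show 1 + δ + (-δ - 1) = 0 by ring, Real.rpow_zero]
        have h3 : -h ≤ d t * y t ^ (-δ - 1) := by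
          have := mul_le_mul_of_nonneg_right h1 (Real.rpow_nonneg hpos.le (-δ - 1))
          rw [neg_mul, mul_assoc, h2, mul_one] at this
          exact this
        have h4 := mul_le_mul_of_nonneg_left h3 (neg_nonneg.2 h0.le)
        linarith
    have h1 := hmono hai hTi haT.le
    simp only at h1
    have h2 := hδ h0
    have h3 : 0 < y T ^ (-δ) := by nlinarith
    rcases hyT.eq_or_lt with h4 | h4
    · rw [← h4, Real.zero_rpow (by linarith)] at h3
      exact absurd h3 (lt_irrefl _)
    · exact h4

/-- The quantity `I` with `I' = -(q + 1) E` stays positive, at least up to the explicit extinction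
bound when `q (p - 1) < 1`. -/
theorem energy_pos {a T : ℝ} {I : ℝ → ℝ} (hp : 1 < p) (hq : 0 < q) (haT : a ≤ T)
    (hI : ∀ t ∈ Icc a T, 0 ≤ I t) (hIa : 0 < I a) (hE : ∀ t ∈ Icc a T, 0 ≤ E t)
    (hI' : ∀ t ∈ Icc a T, HasDerivWithinAt I (-((q + 1) * E t)) (Icc a T) t)
    (hg' : ∀ s ∈ Icc a T, ∀ t ∈ Icc a T, HasDerivWithinAt (g s) (g' s t) (Icc a T) t)
    (hgs : ∀ s ∈ Icc a T, g s s = I s)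
    (hgle : ∀ s ∈ Icc a T, ∀ t ∈ Icc a T, g s t ≤ I t ^ (1 / (q + 1)) * I s ^ (q / (q + 1)))
    (hgE : ∀ s ∈ Icc a T, ∀ t ∈ Icc a T,
      -g' s t ≤ E t ^ (1 - 1 / p) * E s ^ (1 / p))
    (hδ : q * (p - 1) - 1 < 0 → 0 < 1 + (q * (p - 1) - 1) * (E a / I a) * (T - a)) :
    0 < I T := by
  have hq1 : 0 < q + 1 := by linarith
  have hIc : ContinuousOn I (Icc a T) := fun t h ↦ (hI' t h).continuousWithinAt
  set y : ℝ → ℝ := fun t ↦ I t ^ (1 / (q + 1)) with hy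
  by_contra! hIT
  set S : Set ℝ := Icc a T ∩ I ⁻¹' {0} with hS
  have hTi : T ∈ Icc a T := right_mem_Icc.2 haT
  have hTS : T ∈ S := ⟨hTi, le_antisymm hIT (hI T hTi)⟩
  have hScl : IsClosed S := hIc.preimage_isClosed_of_isClosed isClosed_Icc isClosed_singleton
  have hSb : BddBelow S := ⟨a, fun t ht ↦ ht.1.1⟩
  -- τ is the first zero of I. Before τ the norm y is positive and differentiable; at τ itself only
  -- its continuity is used.
  set τ := sInf S with hτ
  have hτS : τ ∈ S := hScl.csInf_mem ⟨T, hTS⟩ hSb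
  have hτT : τ ≤ T := csInf_le hSb hTS
  have haτ : a < τ := lt_of_le_of_ne hτS.1.1 fun h ↦ by
    have : I τ = 0 := hτS.2
    rw [← h] at this
    linarith
  have hsub : Icc a τ ⊆ Icc a T := Icc_subset_Icc_right hτT
  have hIpos : ∀ t ∈ Ico a τ, 0 < I t := fun t ht ↦ by
    have hm := hsub (Ico_subset_Icc_self ht)
    refine lt_of_le_of_ne (hI t hm) fun h ↦ ?_
    exact absurd (csInf_le hSb (show t ∈ S from ⟨hm, h.symm⟩)) (not_le.2 ht.2)
  have hypos : ∀ t ∈ Ico a τ, 0 < y t := fun t ht ↦ Real.rpow_pos_of_pos (hIpos t ht) _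
  have hyq : ∀ t ∈ Icc a T, ∀ c : ℝ, y t ^ c = I t ^ (c / (q + 1)) := fun t ht c ↦ by
    rw [hy, ← Real.rpow_mul (hI t ht)]; ring_nf
  have hyd : ∀ t ∈ Ico a τ, HasDerivWithinAt y (-(E t * y t ^ (-q))) (Icc a T) t := fun t ht ↦ by
    have hm := hsub (Ico_subset_Icc_self ht)
    refine ((hI' t hm).rpow_const (p := 1 / (q + 1)) (Or.inl (hIpos t ht).ne')).congr_deriv ?_
    rw [hyq t hm, show (1 : ℝ) / (q + 1) - 1 = -q / (q + 1) by field_simp; ring]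
    field_simp
  have ha : a ∈ Ico a τ := left_mem_Ico.2 haτ
  set h := E a * y a ^ (-(p * q)) with hh
  have hray : ∀ t ∈ Ico a τ, E t * y t ^ (-(p * q)) ≤ h := fun t ht ↦ by
    rcases ht.1.eq_or_lt with h1 | h1
    · rw [← h1]
    have hst : Icc a t ⊆ Ico a τ := fun x hx ↦ ⟨hx.1, hx.2.trans_lt ht.2⟩
    have hsT : Icc a t ⊆ Icc a T := Icc_subset_Icc_right (ht.2.le.trans hτT)
    refine rayleigh_le (g := g) (g' := g') hp h1 (fun x hx ↦ hypos x (hst hx))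
      (fun x hx ↦ hE x (hsT hx)) (fun x hx ↦ (hyd x (hst hx)).mono hsT)
      (fun s hs x hx ↦ (hg' s (hsT hs) x (hsT hx)).mono hsT) (fun s hs ↦ ?_)
      (fun s hs x hx ↦ ?_) fun s hs x hx ↦ hgE s (hsT hs) x (hsT hx)
    · rw [hgs s (hsT hs), hyq s (hsT hs), hy, ← Real.rpow_add (hIpos s (hst hs)),
        show 1 / (q + 1) + q / (q + 1) = 1 by field_simp; ring, Real.rpow_one]
    · rw [hyq s (hsT hs)]
      exact hgle s (hsT hs) x (hsT hx)
  have haT' : a ∈ Icc a T := left_mem_Icc.2 haT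
  have h0 : 0 < y τ := by
    refine pos_of_deriv_ge (p := p) (q := q) (h := h) (d := fun t ↦ -(E t * y t ^ (-q)))
      (mul_nonneg (hE a haT') (Real.rpow_nonneg (hypos a ha).le _)) haτ ?_ hypos
      (Real.rpow_nonneg (hI τ hτS.1) _) (fun t ht ↦ (hyd t ht).mono hsub) ?_ ?_ ?_
    · exact (hIc.mono hsub).rpow_const fun _ _ ↦ Or.inr (by positivity)
    · intro t ht
      have := mul_nonneg (hE t (hsub (Ico_subset_Icc_self ht)))
        (Real.rpow_nonneg (hypos t ht).le (-q))
      linarith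
    · intro t ht
      have h1 := mul_le_mul_of_nonneg_right (hray t ht)
        (Real.rpow_nonneg (hypos t ht).le (p * q - q))
      rw [mul_assoc, ← Real.rpow_add (hypos t ht), show -(p * q) + (p * q - q) = -q by ring] at h1
      linarith
    · intro h1
      have h2 := hδ h1
      -- This uses y^(q+1) = I and pq = (q+1) + δ. The factor y(a)^(-δ) cancels from the smallness
      -- condition, which becomes a condition on the frequency E / I alone.
      have h3 : h = E a / I a * y a ^ (-(q * (p - 1) - 1)) := by
        have : y a ^ (-(p * q)) = (I a)⁻¹ * y a ^ (-(q * (p - 1) - 1)) := by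
          rw [hyq a haT', hyq a haT', ← Real.rpow_neg_one, ← Real.rpow_add hIa]
          congr 1
          field_simp
          ring
        rw [hh, this]; ring
      have h4 : 0 < y a ^ (-(q * (p - 1) - 1)) := Real.rpow_pos_of_pos (hypos a ha) _
      rw [h3]
      have h5 : 0 ≤ E a / I a := div_nonneg (hE a haT') hIa.le
      -- Since δ < 0, the condition at T implies the one at the earlier time τ.
      have h6 : (q * (p - 1) - 1) * (E a / I a) * (T - a) ≤
          (q * (p - 1) - 1) * (E a / I a) * (τ - a) :=
        mul_le_mul_of_nonpos_left (by linarith) (mul_nonpos_of_nonpos_of_nonneg h1.le h5)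
      have h7 : 0 < 1 + (q * (p - 1) - 1) * (E a / I a) * (τ - a) := by linarith
      have := mul_pos h4 h7
      linarith
  have h1 : I τ = 0 := hτS.2
  simp only [hy, h1] at h0
  rw [Real.zero_rpow (by positivity)] at h0
  exact lt_irrefl _ h0

end Rayleigh

/-! ### Inequalities for the signed power. -/

section SignedPow

lemma abs_signedPow {q : ℝ} (hq : 0 < q) (s : ℝ) : |signedPow q s| = |s| ^ q := by
  rcases eq_or_ne s 0 with rfl | hs
  · simp [signedPow, Real.zero_rpow hq.ne']
  · rw [signedPow, abs_mul, abs_of_nonneg (Real.rpow_nonneg (abs_nonneg s) _),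
      ← Real.rpow_add_one (abs_pos.2 hs).ne', sub_add_cancel]

lemma signedPow_mul_self {q : ℝ} (hq : 0 < q) (s : ℝ) : signedPow q s * s = |s| ^ (q + 1) := by
  rcases eq_or_ne s 0 with rfl | hs
  · simp [signedPow, Real.zero_rpow (by linarith : q + 1 ≠ 0)]
  · have h : |s| ^ (q + 1) = |s| ^ (q - 1) * |s| ^ (2 : ℝ) := by
      rw [← Real.rpow_add (abs_pos.2 hs)]; ring_nf
    rw [h, Real.rpow_two, sq_abs, signedPow]; ring

lemma signedPow_mul (q s t : ℝ) : signedPow q (s * t) = signedPow q s * signedPow q t := by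
  rw [signedPow, abs_mul, Real.mul_rpow (abs_nonneg _) (abs_nonneg _)]
  simp only [signedPow]; ring

lemma measurable_signedPow (q : ℝ) : Measurable (signedPow q) := by
  unfold signedPow; fun_prop

lemma holderConjugate_signedPow {q : ℝ} (hq : 0 < q) :
    ((q + 1) / q).HolderConjugate (q + 1) := by
  rw [Real.holderConjugate_iff]
  refine ⟨by rw [lt_div_iff₀ hq]; linarith, by field_simp⟩

lemma abs_signedPow_rpow {q : ℝ} (hq : 0 < q) (s : ℝ) :
    |signedPow q s| ^ ((q + 1) / q) = |s| ^ (q + 1) := by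
  rw [abs_signedPow hq, ← Real.rpow_mul (abs_nonneg s), mul_div_cancel₀ _ hq.ne']

/-- Convexity of `|s| ^ (q + 1)`. -/
lemma rpow_add_signedPow_mul_sub_le {q : ℝ} (hq : 0 < q) (a b : ℝ) :
    |a| ^ (q + 1) + (q + 1) * (signedPow q a * (b - a)) ≤ |b| ^ (q + 1) := by
  -- Young's inequality with exponents (q+1)/q and q+1, whose equality case is b = a: it is the
  -- tangent line inequality at a.
  have h := Real.young_inequality (signedPow q a) b (holderConjugate_signedPow hq)
  rw [abs_signedPow_rpow hq] at h
  have h1 : 0 < q + 1 := by linarith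
  have h2 := mul_le_mul_of_nonneg_left h h1.le
  have h3 : (q + 1) * (|a| ^ (q + 1) / ((q + 1) / q) + |b| ^ (q + 1) / (q + 1)) =
      q * |a| ^ (q + 1) + |b| ^ (q + 1) := by field_simp
  rw [h3] at h2
  rw [mul_sub, signedPow_mul_self hq]
  linarith

/-- If |b - a| < η |a|, homogeneity reduces the claim to continuity at 1; otherwise |a| and |b| are
both controlled by |b - a|. The argument treats q < 1 and q > 1 alike. -/
lemma abs_signedPow_sub_le {q : ℝ} (hq : 0 < q) {ε : ℝ} (hε : 0 < ε) :
    ∃ C > 0, ∀ a b : ℝ, |signedPow q b - signedPow q a| ≤ ε * |a| ^ q + C * |b - a| ^ q := by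
  have hc : ContinuousAt (signedPow q) 1 := by
    unfold signedPow
    exact ((continuous_abs.continuousAt).rpow_const (Or.inl (by simp))).mul continuousAt_id
  obtain ⟨η, hη, hηb⟩ := Metric.continuousAt_iff.1 hc ε hε
  refine ⟨(1 / η + 1) ^ q + (1 / η) ^ q, by positivity, fun a b ↦ ?_⟩
  have h1 : signedPow q 1 = 1 := by simp [signedPow]
  rcases lt_or_ge |b - a| (η * |a|) with h | h
  · have ha : a ≠ 0 := by
      rintro rfl
      simp at h
      exact absurd h (not_lt.2 (abs_nonneg _))
    have h2 : dist (b / a) 1 < η := by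
      rw [Real.dist_eq, div_sub_one ha, abs_div, div_lt_iff₀ (abs_pos.2 ha)]
      exact h
    have h3 := (hηb h2).le
    rw [h1, Real.dist_eq] at h3
    have h4 : signedPow q b - signedPow q a = signedPow q a * (signedPow q (b / a) - 1) := by
      rw [mul_sub, ← signedPow_mul, mul_div_cancel₀ _ ha, mul_one]
    rw [h4, abs_mul, abs_signedPow hq]
    have h5 := mul_le_mul_of_nonneg_left h3 (Real.rpow_nonneg (abs_nonneg a) q)
    have : 0 ≤ ((1 / η + 1) ^ q + (1 / η) ^ q) * |b - a| ^ q := by positivity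
    linarith
  · have ha : |a| ≤ 1 / η * |b - a| := by
      rw [one_div, inv_mul_eq_div, le_div_iff₀ hη]; linarith
    have hb : |b| ≤ (1 / η + 1) * |b - a| := by
      have : |b| ≤ |a| + |b - a| := by
        have := abs_add_le a (b - a)
        rwa [add_sub_cancel] at this
      linarith
    have ha' := Real.rpow_le_rpow (abs_nonneg _) ha hq.le
    have hb' := Real.rpow_le_rpow (abs_nonneg _) hb hq.le
    rw [Real.mul_rpow (by positivity) (abs_nonneg _)] at ha' hb'
    have h2 := abs_sub (signedPow q b) (signedPow q a)
    rw [abs_signedPow hq, abs_signedPow hq] at h2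
    have : 0 ≤ ε * |a| ^ q := by positivity
    linarith

end SignedPow

/-! ### Differentiable curves in L^(q+1) and the derivative of the energy. -/

section Lebesgue

variable {α : Type*} [MeasurableSpace α] {μ : Measure α}

/-- Split f g - f₀ g₀ = (f - f₀) g + f₀ (g - g₀) and apply Hölder to each term. -/
lemma tendsto_integral_mul {ι : Type*} {l : Filter ι} {P R : ℝ≥0∞} [P.HolderTriple R 1]
    {f : ι → α → ℝ} {g : ι → α → ℝ} {f₀ g₀ : α → ℝ}
    (hf : ∀ᶠ i in l, MemLp (f i) P μ) (hg : ∀ᶠ i in l, MemLp (g i) R μ)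
    (hf₀ : MemLp f₀ P μ) (hg₀ : MemLp g₀ R μ) (hR : 1 ≤ R)
    (hfl : Tendsto (fun i ↦ eLpNorm (f i - f₀) P μ) l (𝓝 0))
    (hgl : Tendsto (fun i ↦ eLpNorm (g i - g₀) R μ) l (𝓝 0)) :
    Tendsto (fun i ↦ ∫ x, f i x * g i x ∂μ) l (𝓝 (∫ x, f₀ x * g₀ x ∂μ)) := by
  refine tendsto_integral_of_L1' (fun x ↦ f₀ x * g₀ x) (hf₀.1.mul hg₀.1)
    (F := fun i x ↦ f i x * g i x) ?_ ?_
  · filter_upwards [hf, hg] with i h1 h2 using h1.integrable_mul h2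
  have hbound : ∀ᶠ i in l, eLpNorm ((fun x ↦ f i x * g i x) - fun x ↦ f₀ x * g₀ x) 1 μ ≤
      eLpNorm (f i - f₀) P μ * (eLpNorm (g i - g₀) R μ + eLpNorm g₀ R μ) +
        eLpNorm f₀ P μ * eLpNorm (g i - g₀) R μ := by
    filter_upwards [hf, hg] with i h1 h2
    have hd : ((fun x ↦ f i x * g i x) - fun x ↦ f₀ x * g₀ x) =
        (f i - f₀) • g i + f₀ • (g i - g₀) := by
      ext x; simp only [Pi.sub_apply, Pi.add_apply, smul_eq_mul, Pi.mul_apply]; ring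
    rw [hd]
    have hm1 := h1.1.sub hf₀.1
    have hm2 := h2.1.sub hg₀.1
    refine (eLpNorm_add_le (hm1.smul h2.1) (hf₀.1.smul hm2) le_rfl).trans ?_
    refine add_le_add ((eLpNorm_smul_le_mul_eLpNorm (p := P) (q := R) h2.1 hm1).trans ?_)
      (eLpNorm_smul_le_mul_eLpNorm (p := P) (q := R) hm2 hf₀.1)
    gcongr
    calc eLpNorm (g i) R μ = eLpNorm ((g i - g₀) + g₀) R μ := by rw [sub_add_cancel]
      _ ≤ _ := eLpNorm_add_le hm2 hg₀.1 hR
  refine tendsto_of_tendsto_of_tendsto_of_le_of_le' tendsto_const_nhds ?_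
    (Eventually.of_forall fun _ ↦ zero_le) hbound
  have h1 : Tendsto (fun i ↦ eLpNorm (g i - g₀) R μ + eLpNorm g₀ R μ) l
      (𝓝 (0 + eLpNorm g₀ R μ)) := hgl.add tendsto_const_nhds
  have h2 := ENNReal.Tendsto.mul hfl (Or.inr (by simpa using hg₀.2.ne)) h1 (Or.inr (by simp))
  have h3 := ENNReal.Tendsto.const_mul hgl (Or.inr hf₀.2.ne) (a := eLpNorm f₀ P μ)
  simpa using h2.add h3

variable {q : ℝ}

lemma one_le_ofReal_add_one (hq : 0 < q) : 1 ≤ ENNReal.ofReal (q + 1) := by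
  rw [ENNReal.one_le_ofReal]; linarith

lemma one_le_ofReal_conj (hq : 0 < q) : 1 ≤ ENNReal.ofReal ((q + 1) / q) := by
  rw [ENNReal.one_le_ofReal, le_div_iff₀ hq]; linarith

lemma holderTriple_conj (hq : 0 < q) :
    (ENNReal.ofReal ((q + 1) / q)).HolderTriple (ENNReal.ofReal (q + 1)) 1 :=
  (holderConjugate_signedPow hq).ennrealOfReal

lemma ofReal_conj_mul (hq : 0 < q) :
    ENNReal.ofReal ((q + 1) / q) * ENNReal.ofReal q = ENNReal.ofReal (q + 1) := by
  rw [← ENNReal.ofReal_mul (by positivity), div_mul_cancel₀ _ hq.ne']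

lemma memLp_abs_rpow (hq : 0 < q) {f : α → ℝ} (hf : MemLp f (ENNReal.ofReal (q + 1)) μ) :
    MemLp (fun x ↦ |f x| ^ q) (ENNReal.ofReal ((q + 1) / q)) μ := by
  refine ⟨(hf.1.norm.aemeasurable.pow_const q).aestronglyMeasurable, ?_⟩
  have := eLpNorm_norm_rpow (p := ENNReal.ofReal ((q + 1) / q)) (μ := μ) f hq
  simp only [Real.norm_eq_abs] at this
  rw [this, ofReal_conj_mul hq]
  exact ENNReal.rpow_lt_top_of_nonneg hq.le hf.2.ne

lemma memLp_signedPow (hq : 0 < q) {f : α → ℝ} (hf : MemLp f (ENNReal.ofReal (q + 1)) μ) :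
    MemLp (fun x ↦ signedPow q (f x)) (ENNReal.ofReal ((q + 1) / q)) μ := by
  refine (memLp_abs_rpow hq hf).mono
    ((measurable_signedPow q).comp_aemeasurable hf.1.aemeasurable).aestronglyMeasurable ?_
  filter_upwards with x
  rw [Real.norm_eq_abs, abs_signedPow hq]
  exact le_abs_self _

lemma integrable_abs_rpow (hq : 0 < q) {f : α → ℝ} (hf : MemLp f (ENNReal.ofReal (q + 1)) μ) :
    Integrable (fun x ↦ |f x| ^ (q + 1)) μ := by
  have := hf.integrable_norm_rpow (by simp; linarith) ENNReal.ofReal_ne_top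
  rwa [ENNReal.toReal_ofReal (by linarith)] at this

lemma integral_mul_signedPow_le (hq : 0 < q) {f h : α → ℝ}
    (hf : MemLp f (ENNReal.ofReal (q + 1)) μ) (hh : MemLp h (ENNReal.ofReal (q + 1)) μ) :
    ∫ x, signedPow q (h x) * f x ∂μ ≤
      (∫ x, |f x| ^ (q + 1) ∂μ) ^ (1 / (q + 1)) * (∫ x, |h x| ^ (q + 1) ∂μ) ^ (q / (q + 1)) := by
  have hm := memLp_signedPow hq hh
  have h1 := integral_mul_norm_le_Lp_mul_Lq (holderConjugate_signedPow hq) hm hf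
  simp only [Real.norm_eq_abs, abs_signedPow_rpow hq] at h1
  rw [one_div_div] at h1
  refine (le_trans ?_ h1).trans_eq (mul_comm _ _)
  have := holderTriple_conj hq
  refine integral_mono (hm.integrable_mul hf) (hm.norm.integrable_mul hf.norm) fun x ↦ ?_
  simp only [← abs_mul]
  exact le_abs_self _

/-- By `abs_signedPow_sub_le` the norm in question is at most ε ‖f₀‖^q + C ‖f - f₀‖^q with C
depending on ε. Fix ε first and then let f approach f₀. -/
lemma tendsto_eLpNorm_signedPow (hq : 0 < q) {ι : Type*} {l : Filter ι} {f : ι → α → ℝ}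
    {f₀ : α → ℝ} (hf : ∀ᶠ i in l, MemLp (f i) (ENNReal.ofReal (q + 1)) μ)
    (hf₀ : MemLp f₀ (ENNReal.ofReal (q + 1)) μ)
    (hl : Tendsto (fun i ↦ eLpNorm (f i - f₀) (ENNReal.ofReal (q + 1)) μ) l (𝓝 0)) :
    Tendsto (fun i ↦ eLpNorm ((fun x ↦ signedPow q (f i x)) - fun x ↦ signedPow q (f₀ x))
      (ENNReal.ofReal ((q + 1) / q)) μ) l (𝓝 0) := by
  set r := ENNReal.ofReal ((q + 1) / q) with hr
  have hN : ∀ g : α → ℝ, eLpNorm (fun x ↦ |g x| ^ q) r μ =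
      eLpNorm g (ENNReal.ofReal (q + 1)) μ ^ q := fun g ↦ by
    have := eLpNorm_norm_rpow (p := r) (μ := μ) g hq
    simp only [Real.norm_eq_abs] at this
    rw [this, hr, ofReal_conj_mul hq]
  set A := eLpNorm f₀ (ENNReal.ofReal (q + 1)) μ ^ q with hA
  have hAt : A ≠ ⊤ := (ENNReal.rpow_lt_top_of_nonneg hq.le hf₀.2.ne).ne
  have key : ∀ ε : ℝ, 0 < ε → ∃ C : ℝ, ∀ᶠ i in l,
      eLpNorm ((fun x ↦ signedPow q (f i x)) - fun x ↦ signedPow q (f₀ x)) r μ ≤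
        ENNReal.ofReal ε * A + ENNReal.ofReal C *
          eLpNorm (f i - f₀) (ENNReal.ofReal (q + 1)) μ ^ q := fun ε hε ↦ by
    obtain ⟨C, hC, hCb⟩ := abs_signedPow_sub_le hq hε
    refine ⟨C, ?_⟩
    filter_upwards [hf] with i hi
    have hm := memLp_abs_rpow hq hf₀
    have hm' := memLp_abs_rpow hq (hi.sub hf₀)
    calc _ ≤ eLpNorm ((ε • fun x ↦ |f₀ x| ^ q) + C • fun x ↦ |(f i - f₀) x| ^ q) r μ := by
          refine eLpNorm_mono fun x ↦ ?_
          simp only [Pi.sub_apply, Pi.add_apply, Pi.smul_apply, smul_eq_mul, Real.norm_eq_abs]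
          exact (hCb (f₀ x) (f i x)).trans (le_abs_self _)
      _ ≤ _ := eLpNorm_add_le (hm.1.const_smul ε) (hm'.1.const_smul C) (one_le_ofReal_conj hq)
      _ = _ := by
          rw [eLpNorm_const_smul, eLpNorm_const_smul, hN, hN, Real.enorm_eq_ofReal hε.le,
            Real.enorm_eq_ofReal hC.le]
  rw [ENNReal.tendsto_nhds_zero]
  intro e he
  obtain ⟨ε, hε, hεe⟩ : ∃ ε : ℝ, 0 < ε ∧ ENNReal.ofReal ε * A < e := by
    have h1 : Tendsto (fun ε : ℝ ↦ ENNReal.ofReal ε * A) (𝓝[>] 0) (𝓝 0) := by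
      have : Tendsto (fun ε : ℝ ↦ ENNReal.ofReal ε) (𝓝[>] 0) (𝓝 0) := by
        simpa using (ENNReal.tendsto_ofReal (tendsto_id (α := ℝ) (x := 𝓝 0))).mono_left
          nhdsWithin_le_nhds
      simpa using ENNReal.Tendsto.mul_const this (Or.inr hAt)
    obtain ⟨ε, h2, h3⟩ := ((h1.eventually_lt_const he).and self_mem_nhdsWithin).exists
    exact ⟨ε, h3, h2⟩
  obtain ⟨C, hC⟩ := key ε hε
  have hlim : Tendsto (fun i ↦ ENNReal.ofReal ε * A + ENNReal.ofReal C *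
          eLpNorm (f i - f₀) (ENNReal.ofReal (q + 1)) μ ^ q) l (𝓝 (ENNReal.ofReal ε * A)) := by
    have h1 : Tendsto (fun i ↦ eLpNorm (f i - f₀) (ENNReal.ofReal (q + 1)) μ ^ q) l (𝓝 0) := by
      have := (ENNReal.continuous_rpow_const (y := q)).tendsto 0
      rw [ENNReal.zero_rpow_of_pos hq] at this
      exact this.comp hl
    have h2 := ENNReal.Tendsto.const_mul h1 (Or.inr (ENNReal.ofReal_ne_top (r := C)))
    simpa using h2.const_add (ENNReal.ofReal ε * A)
  filter_upwards [hC, hlim.eventually_lt_const hεe] with i h1 h2 using h1.trans h2.le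

variable {J : Set ℝ} {u : ℝ → α → ℝ} {t : ℝ} {w : α → ℝ}

/-- `w` is the derivative at `t` of the curve `u` in `L^r`. -/
def CurveDeriv (μ : Measure α) (r : ℝ) (J : Set ℝ) (u : ℝ → α → ℝ) (t : ℝ) (w : α → ℝ) : Prop :=
  Tendsto (fun s ↦ eLpNorm (fun x ↦ (u s x - u t x) / (s - t) - w x)
    (ENNReal.ofReal r) μ) (𝓝[J \ {t}] t) (𝓝 0)

/-- Differentiability implies continuity: the increment is s - t times a quantity bounded in norm.
-/
lemma CurveDeriv.tendsto_self (hq : 0 < q) (hu : ∀ s ∈ J, MemLp (u s) (ENNReal.ofReal (q + 1)) μ)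
    (ht : t ∈ J) (hw : MemLp w (ENNReal.ofReal (q + 1)) μ) (h : CurveDeriv μ (q + 1) J u t w) :
    Tendsto (fun s ↦ eLpNorm (u s - u t) (ENNReal.ofReal (q + 1)) μ) (𝓝[J \ {t}] t) (𝓝 0) := by
  have hb : ∀ᶠ s in 𝓝[J \ {t}] t, eLpNorm (u s - u t) (ENNReal.ofReal (q + 1)) μ ≤
      ENNReal.ofReal |s - t| * (eLpNorm (fun x ↦ (u s x - u t x) / (s - t) - w x)
        (ENNReal.ofReal (q + 1)) μ + eLpNorm w (ENNReal.ofReal (q + 1)) μ) := by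
    filter_upwards [self_mem_nhdsWithin] with s hs
    have hst : s - t ≠ 0 := sub_ne_zero.2 hs.2
    have hm : AEStronglyMeasurable (fun x ↦ (u s x - u t x) / (s - t) - w x) μ := by
      have := (((hu s hs.1).sub (hu t ht)).const_mul (s - t)⁻¹).1.sub hw.1
      refine this.congr (Eventually.of_forall fun x ↦ ?_)
      simp only [Pi.sub_apply]; ring
    have : u s - u t = (s - t) • ((fun x ↦ (u s x - u t x) / (s - t) - w x) + w) := by
      ext x
      simp only [Pi.sub_apply, Pi.smul_apply, Pi.add_apply, smul_eq_mul]
      field_simp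
      ring
    rw [this, eLpNorm_const_smul, Real.enorm_eq_ofReal_abs]
    gcongr
    exact eLpNorm_add_le hm hw.1 (one_le_ofReal_add_one hq)
  refine tendsto_of_tendsto_of_tendsto_of_le_of_le' tendsto_const_nhds ?_
    (Eventually.of_forall fun _ ↦ zero_le) hb
  have h1 : Tendsto (fun s : ℝ ↦ ENNReal.ofReal |s - t|) (𝓝[J \ {t}] t) (𝓝 0) := by
    have : Tendsto (fun s : ℝ ↦ |s - t|) (𝓝 t) (𝓝 |t - t|) := by
      exact (Continuous.tendsto (by fun_prop) t)
    simpa using (ENNReal.tendsto_ofReal this).mono_left (nhdsWithin_le_nhds (s := J \ {t}))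
  have h2 := h.add (tendsto_const_nhds (x := eLpNorm w (ENNReal.ofReal (q + 1)) μ))
  simpa using ENNReal.Tendsto.mul h1 (Or.inr (by simpa using hw.2.ne)) h2 (Or.inr (by simp))

/-- The weight v is allowed to move with s, because one of the two bounds for the increment of the
energy pairs it with u(s)^q rather than with u(t)^q. -/
lemma CurveDeriv.tendsto_integral (hq : 0 < q)
    (hu : ∀ s ∈ J, MemLp (u s) (ENNReal.ofReal (q + 1)) μ)
    (ht : t ∈ J) (hw : MemLp w (ENNReal.ofReal (q + 1)) μ) (h : CurveDeriv μ (q + 1) J u t w)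
    {v : ℝ → α → ℝ} {v₀ : α → ℝ}
    (hv : ∀ᶠ s in 𝓝[J \ {t}] t, MemLp (v s) (ENNReal.ofReal ((q + 1) / q)) μ)
    (hv₀ : MemLp v₀ (ENNReal.ofReal ((q + 1) / q)) μ)
    (hvl : Tendsto (fun s ↦ eLpNorm (v s - v₀) (ENNReal.ofReal ((q + 1) / q)) μ)
      (𝓝[J \ {t}] t) (𝓝 0)) :
    Tendsto (fun s ↦ (∫ x, v s x * (u s x - u t x) ∂μ) / (s - t)) (𝓝[J \ {t}] t)
      (𝓝 (∫ x, v₀ x * w x ∂μ)) := by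
  have := holderTriple_conj hq
  have h1 := tendsto_integral_mul (g := fun s x ↦ (u s x - u t x) / (s - t))
    (R := ENNReal.ofReal (q + 1)) hv ?_ hv₀ hw (one_le_ofReal_add_one hq) hvl h
  · refine h1.congr fun s ↦ ?_
    rw [← integral_div]
    exact integral_congr_ae (Eventually.of_forall fun x ↦ by simp only; ring)
  · filter_upwards [self_mem_nhdsWithin] with s hs
    have := ((hu s hs.1).sub (hu t ht)).const_mul (s - t)⁻¹
    refine this.ae_eq (Eventually.of_forall fun x ↦ ?_)
    simp only [Pi.sub_apply]; ring

lemma CurveDeriv.hasDerivWithinAt_integral (hq : 0 < q)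
    (hu : ∀ s ∈ J, MemLp (u s) (ENNReal.ofReal (q + 1)) μ)
    (ht : t ∈ J) (hw : MemLp w (ENNReal.ofReal (q + 1)) μ) (h : CurveDeriv μ (q + 1) J u t w)
    {v : α → ℝ} (hv : MemLp v (ENNReal.ofReal ((q + 1) / q)) μ) :
    HasDerivWithinAt (fun s ↦ ∫ x, v x * u s x ∂μ) (∫ x, v x * w x ∂μ) J t := by
  rw [hasDerivWithinAt_iff_tendsto_slope]
  have h1 := h.tendsto_integral hq hu ht hw (v := fun _ ↦ v) (Eventually.of_forall fun _ ↦ hv) hv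
    (by simpa using tendsto_const_nhds)
  refine h1.congr' ?_
  filter_upwards [self_mem_nhdsWithin] with s hs
  have := holderTriple_conj hq
  rw [slope_def_field]
  simp only [mul_sub]
  rw [integral_sub]
  exacts [hv.integrable_mul (hu s hs.1), hv.integrable_mul (hu t ht)]

/-- The derivative of `∫ |u|^{q+1}` along a differentiable curve in `L^{q+1}`. -/
lemma CurveDeriv.hasDerivWithinAt_energy (hq : 0 < q)
    (hu : ∀ s ∈ J, MemLp (u s) (ENNReal.ofReal (q + 1)) μ)
    (ht : t ∈ J) (hw : MemLp w (ENNReal.ofReal (q + 1)) μ) (h : CurveDeriv μ (q + 1) J u t w) :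
    HasDerivWithinAt (fun s ↦ ∫ x, |u s x| ^ (q + 1) ∂μ)
      ((q + 1) * ∫ x, signedPow q (u t x) * w x ∂μ) J t := by
  have := holderTriple_conj hq
  -- Convexity, used at both ends, squeezes the increment of the energy between (q+1) ∫ u(t)^q (u(s)
  -- - u(t)) and (q+1) ∫ u(s)^q (u(s) - u(t)). After division by s - t the order depends on the sign
  -- of s - t, hence the minimum and maximum below; both have the same limit.
  have hlow : ∀ s ∈ J, ∀ s' ∈ J, (q + 1) * ∫ x, signedPow q (u s x) * (u s' x - u s x) ∂μ ≤
      (∫ x, |u s' x| ^ (q + 1) ∂μ) - ∫ x, |u s x| ^ (q + 1) ∂μ := fun s hs s' hs' ↦ by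
    rw [← integral_sub (integrable_abs_rpow hq (hu s' hs')) (integrable_abs_rpow hq (hu s hs)),
      ← integral_const_mul]
    refine integral_mono
      (((memLp_signedPow hq (hu s hs)).integrable_mul ((hu s' hs').sub (hu s hs))).const_mul _)
      ((integrable_abs_rpow hq (hu s' hs')).sub (integrable_abs_rpow hq (hu s hs))) fun x ↦ ?_
    have := rpow_add_signedPow_mul_sub_le hq (u s x) (u s' x)
    simp only
    linarith
  rw [hasDerivWithinAt_iff_tendsto_slope]
  have hev : ∀ᶠ s in 𝓝[J \ {t}] t, MemLp (u s) (ENNReal.ofReal (q + 1)) μ := by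
    filter_upwards [self_mem_nhdsWithin] with s hs using hu s hs.1
  have h1 := (h.tendsto_integral hq hu ht hw (v := fun _ x ↦ signedPow q (u t x))
    (Eventually.of_forall fun _ ↦ memLp_signedPow hq (hu t ht)) (memLp_signedPow hq (hu t ht))
    (by simpa using tendsto_const_nhds)).const_mul (q + 1)
  have h2 := (h.tendsto_integral hq hu ht hw (v := fun s x ↦ signedPow q (u s x))
    (hev.mono fun s hs ↦ memLp_signedPow hq hs) (memLp_signedPow hq (hu t ht))
    (tendsto_eLpNorm_signedPow hq hev (hu t ht) (h.tendsto_self hq hu ht hw))).const_mul (q + 1)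
  have h3 := h1.min h2
  have h4 := h1.max h2
  rw [min_self] at h3
  rw [max_self] at h4
  refine tendsto_of_tendsto_of_tendsto_of_le_of_le' h3 h4 ?_ ?_
  all_goals
    filter_upwards [self_mem_nhdsWithin] with s hs
    have hst : s - t ≠ 0 := sub_ne_zero.2 hs.2
    have e1 := hlow t ht s hs.1
    have e2 := hlow s hs.1 t ht
    have e3 : ∫ x, signedPow q (u s x) * (u t x - u s x) ∂μ =
        -∫ x, signedPow q (u s x) * (u s x - u t x) ∂μ := by
      rw [← integral_neg]
      exact integral_congr_ae (Eventually.of_forall fun x ↦ by simp only; ring)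
    rw [e3] at e2
    rw [slope_def_field, ← mul_div_assoc, ← mul_div_assoc]
    rcases hst.lt_or_gt with hlt | hgt
  · rw [min_le_iff]; right
    exact div_le_div_of_nonpos_of_le hlt.le (by linarith)
  · rw [min_le_iff]; left
    exact div_le_div_of_nonneg_right e1 hgt.le
  · rw [le_max_iff]; left
    exact div_le_div_of_nonpos_of_le hlt.le (by linarith)
  · rw [le_max_iff]; right
    exact div_le_div_of_nonneg_right (by linarith) hgt.le

end Lebesgue

/-! ### Mollification of scalar and vector valued functions. -/

section Mollifier

open scoped Convolution

variable {E : Type*} [NormedAddCommGroup E] [InnerProductSpace ℝ E] [FiniteDimensional ℝ E]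
  [MeasurableSpace E] [BorelSpace E] {μ : Measure E} [μ.IsAddHaarMeasure]
  {F : Type*} [NormedAddCommGroup F] [NormedSpace ℝ F] [CompleteSpace F]

/-- Translations preserve the measure and depend continuously on z in the compact-open topology, and
composition with such maps is continuous on L^P for finite P. -/
lemma tendsto_eLpNorm_translate {P : ℝ≥0∞} (hP : 1 ≤ P) (hP' : P ≠ ⊤) {g : E → F}
    (hg : MemLp g P μ) :
    Tendsto (fun z ↦ eLpNorm (fun y ↦ g (y - z) - g y) P μ) (𝓝 0) (𝓝 0) := by
  have : Fact (1 ≤ P) := ⟨hP⟩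
  set T : C(E, C(E, E)) := (ContinuousMap.mk (fun x : E × E ↦ x.2 - x.1) (by fun_prop)).curry
  have hT : ∀ z y, T z y = y - z := fun z y ↦ rfl
  have hm : ∀ z, MeasurePreserving (T z) μ μ := fun z ↦ measurePreserving_sub_right μ z
  have h1 := Tendsto.compMeasurePreservingLp (μ := μ) (ν := μ) (l := 𝓝 (0 : E))
    (tendsto_const_nhds (x := hg.toLp g)) (T.continuous.tendsto 0) hm (hm 0) hP'
  simp only [Lp.toLp_compMeasurePreserving] at h1
  rw [Lp.tendsto_Lp_iff_tendsto_eLpNorm'] at h1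
  refine h1.congr fun z ↦ eLpNorm_congr_ae ?_
  filter_upwards [(hg.comp_measurePreserving (hm z)).coeFn_toLp,
    (hg.comp_measurePreserving (hm 0)).coeFn_toLp] with y h2 h3
  simp only [Pi.sub_apply, h2, h3, Function.comp_apply, hT, sub_zero]

/-- A sequence of bump functions shrinking to the origin. -/
def bumpSeq (E : Type*) [NormedAddCommGroup E] (k : ℕ) : ContDiffBump (0 : E) where
  rIn := 1 / ((k : ℝ) + 1)
  rOut := 2 / ((k : ℝ) + 1)
  rIn_pos := by positivity
  rIn_lt_rOut := by gcongr; norm_num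

lemma tendsto_rOut_bumpSeq : Tendsto (fun k ↦ (bumpSeq E k).rOut) atTop (𝓝 0) := by
  have h := (tendsto_one_div_add_atTop_nhds_zero_nat (𝕜 := ℝ)).const_mul 2
  simp only [mul_zero, mul_one_div] at h
  exact h

variable (μ) in
/-- Mollification at scale `2 / (k + 1)`. -/
def mollify (k : ℕ) (g : E → F) : E → F :=
  (bumpSeq E k).normed μ ⋆[ContinuousLinearMap.lsmul ℝ ℝ, μ] g

variable (μ) in
lemma mollify_eq (k : ℕ) (g : E → F) (y : E) :
    mollify μ k g y = ∫ z, (bumpSeq E k).normed μ z • g (y - z) ∂μ := rfl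

lemma integrable_bump_smul (k : ℕ) {g : E → F} (hg : LocallyIntegrable g μ) (y : E) :
    Integrable (fun z ↦ (bumpSeq E k).normed μ z • g (y - z)) μ :=
  (bumpSeq E k).hasCompactSupport_normed.convolutionExists_left
    (ContinuousLinearMap.lsmul ℝ ℝ) (bumpSeq E k).continuous_normed hg y

lemma contDiff_mollify (k : ℕ) {g : E → F} (hg : LocallyIntegrable g μ) :
    ContDiff ℝ ∞ (mollify μ k g) :=
  (bumpSeq E k).hasCompactSupport_normed.contDiff_convolution_left _
    (bumpSeq E k).contDiff_normed hg

lemma mollify_sub_eq (k : ℕ) {g : E → F} (hg : LocallyIntegrable g μ) (y : E) :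
    mollify μ k g y - g y = ∫ z, (bumpSeq E k).normed μ z • (g (y - z) - g y) ∂μ := by
  simp only [smul_sub]
  rw [integral_sub (integrable_bump_smul k hg y)
    (((bumpSeq E k).integrable_normed).smul_const _), integral_smul_const,
    (bumpSeq E k).integral_normed, one_smul, mollify_eq]

variable (μ) in
/-- The probability measure with the mollifier as its density. -/
def bumpMeasure (k : ℕ) : Measure E :=
  μ.withDensity fun z ↦ ENNReal.ofReal ((bumpSeq E k).normed μ z)

lemma measurable_bump (k : ℕ) :
    Measurable fun z ↦ ENNReal.ofReal ((bumpSeq E k).normed μ z) :=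
  ((bumpSeq E k).continuous_normed.measurable).ennreal_ofReal

instance (k : ℕ) : IsProbabilityMeasure (bumpMeasure (E := E) μ k) := by
  constructor
  rw [bumpMeasure, withDensity_apply _ MeasurableSet.univ, Measure.restrict_univ,
    ← ofReal_integral_eq_lintegral_ofReal (bumpSeq E k).integrable_normed
      (Eventually.of_forall fun z ↦ (bumpSeq E k).nonneg_normed z),
    (bumpSeq E k).integral_normed, ENNReal.ofReal_one]

/-- Jensen's inequality, in the form that L^p norms increase with p on a probability space. -/
lemma lintegral_bumpMeasure_rpow_le (k : ℕ) {p : ℝ} (hp : 1 ≤ p) {h : E → F}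
    (hh : StronglyMeasurable h) :
    (∫⁻ z, ‖h z‖ₑ ∂(bumpMeasure μ k)) ^ p ≤ ∫⁻ z, ‖h z‖ₑ ^ p ∂(bumpMeasure μ k) := by
  have hp0 : 0 < p := by linarith
  have h1 := eLpNorm'_le_eLpNorm'_of_exponent_le one_pos hp (bumpMeasure μ k)
    hh.aestronglyMeasurable
  simp only [eLpNorm', ENNReal.rpow_one, div_one] at h1
  rw [one_div] at h1
  have h2 := ENNReal.rpow_le_rpow h1 hp0.le
  rwa [ENNReal.rpow_inv_rpow hp0.ne'] at h2

/-- The mollification error is an average over z of the translation errors g(· - z) - g. Jensen in z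
followed by Tonelli moves the norm inside the average. -/
lemma eLpNorm_mollify_sub_le {P : ℝ≥0∞} (hP : 1 ≤ P) (hP' : P ≠ ⊤) {g : E → F}
    (hg : MemLp g P μ) (k : ℕ) {c : ℝ≥0∞}
    (hc : ∀ z ∈ Metric.ball (0 : E) (bumpSeq E k).rOut,
      eLpNorm (fun y ↦ g (y - z) - g y) P μ ≤ c) :
    eLpNorm (mollify μ k g - g) P μ ≤ c := by
  -- A strongly measurable representative makes g(y - z) - g(y) jointly measurable, as Tonelli
  -- requires; the mollification does not see the null set.
  wlog hgm : StronglyMeasurable g generalizing g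
  · have hae := hg.1.ae_eq_mk
    have hmk : MemLp (hg.1.mk g) P μ := hg.ae_eq hae
    have hqm : ∀ z : E, (fun y ↦ g (y - z)) =ᵐ[μ] fun y ↦ hg.1.mk g (y - z) := fun z ↦
      (measurePreserving_sub_right μ z).quasiMeasurePreserving.ae_eq_comp hae
    have hmoll : mollify μ k g = mollify μ k (hg.1.mk g) := by
      ext y
      rw [mollify_eq, mollify_eq]
      refine integral_congr_ae ?_
      have := (Measure.measurePreserving_sub_left μ y).quasiMeasurePreserving.ae_eq_comp hae
      filter_upwards [this] with z hz
      simp only [Function.comp_apply] at hz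
      rw [hz]
    have h1 := this hmk (fun z hz ↦ ?_) hg.1.stronglyMeasurable_mk
    · rw [hmoll]
      exact (eLpNorm_congr_ae ((ae_eq_refl _).sub hae)).trans_le h1
    · refine (eLpNorm_congr_ae ?_).trans_le (hc z hz)
      exact ((hqm z).sub hae).symm
  have hP0 : P ≠ 0 := (one_pos.trans_le hP).ne'
  set p := P.toReal with hp
  have hp1 : 1 ≤ p := by
    rw [hp, ← ENNReal.toReal_one]; exact ENNReal.toReal_mono hP' hP
  have hp0 : 0 < p := by linarith
  have hloc : LocallyIntegrable g μ := hg.locallyIntegrable hP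
  have hjoint : StronglyMeasurable fun x : E × E ↦ g (x.1 - x.2) - g x.1 :=
    (hgm.comp_measurable (measurable_fst.sub measurable_snd)).sub
      (hgm.comp_measurable measurable_fst)
  rw [eLpNorm_eq_lintegral_rpow_enorm_toReal hP0 hP', ← hp]
  have hpt : ∀ y, ‖(mollify μ k g - g) y‖ₑ ^ p ≤
      ∫⁻ z, ‖g (y - z) - g y‖ₑ ^ p ∂(bumpMeasure μ k) := fun y ↦ by
    refine le_trans (ENNReal.rpow_le_rpow ?_ hp0.le) (lintegral_bumpMeasure_rpow_le k hp1
      (hjoint.comp_measurable measurable_prodMk_left))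
    rw [Pi.sub_apply, mollify_sub_eq k hloc]
    refine (enorm_integral_le_lintegral_enorm _).trans_eq ?_
    rw [bumpMeasure, lintegral_withDensity_eq_lintegral_mul _ (measurable_bump k)
      (g := fun z ↦ ‖g (y - z) - g y‖ₑ)
      (hjoint.comp_measurable (measurable_prodMk_left (x := y))).enorm]
    refine lintegral_congr fun z ↦ ?_
    rw [enorm_smul, Real.enorm_eq_ofReal ((bumpSeq E k).nonneg_normed z)]
    rfl
  have hae : ∀ᵐ z ∂(bumpMeasure μ k), z ∈ Metric.ball (0 : E) (bumpSeq E k).rOut := by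
    rw [bumpMeasure, ae_withDensity_iff (measurable_bump k)]
    refine Eventually.of_forall fun z hz ↦ ?_
    rw [← (bumpSeq E k).support_normed_eq (μ := μ), Function.mem_support]
    intro h0
    simp [h0] at hz
  calc (∫⁻ y, ‖(mollify μ k g - g) y‖ₑ ^ p ∂μ) ^ (1 / p)
      ≤ (∫⁻ y, ∫⁻ z, ‖g (y - z) - g y‖ₑ ^ p ∂(bumpMeasure μ k) ∂μ) ^ (1 / p) :=
        ENNReal.rpow_le_rpow (lintegral_mono hpt) (by positivity)
    _ = (∫⁻ z, ∫⁻ y, ‖g (y - z) - g y‖ₑ ^ p ∂μ ∂(bumpMeasure μ k)) ^ (1 / p) := by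
        rw [lintegral_lintegral_swap]
        exact (hjoint.enorm.pow_const p).aemeasurable
    _ ≤ (∫⁻ _, c ^ p ∂(bumpMeasure μ k)) ^ (1 / p) := by
        refine ENNReal.rpow_le_rpow (lintegral_mono_ae ?_) (by positivity)
        filter_upwards [hae] with z hz
        have h1 := ENNReal.rpow_le_rpow (hc z hz) hp0.le
        rw [eLpNorm_eq_lintegral_rpow_enorm_toReal hP0 hP', ← hp, one_div,
          ENNReal.rpow_inv_rpow hp0.ne'] at h1
        exact h1
    _ = c := by
        rw [lintegral_const, measure_univ, mul_one, one_div, ENNReal.rpow_rpow_inv hp0.ne']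

/-- Mollifications converge in `L^P`. -/
theorem tendsto_eLpNorm_mollify {P : ℝ≥0∞} (hP : 1 ≤ P) (hP' : P ≠ ⊤) {g : E → F}
    (hg : MemLp g P μ) :
    Tendsto (fun k ↦ eLpNorm (mollify μ k g - g) P μ) atTop (𝓝 0) := by
  rw [ENNReal.tendsto_nhds_zero]
  intro c hc
  obtain ⟨r, hr, hrc⟩ := Metric.eventually_nhds_iff_ball.1
    (ENNReal.tendsto_nhds_zero.1 (tendsto_eLpNorm_translate hP hP' hg) c hc)
  filter_upwards [(tendsto_rOut_bumpSeq (E := E)).eventually_lt_const hr] with k hk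
  exact eLpNorm_mollify_sub_le hP hP' hg k fun z hz ↦
    hrc z (Metric.ball_subset_ball hk.le hz)

/-- Convergence at Lebesgue points. The constant K = 2 bounds the ratio of the outer to the inner
radius of the bumps. -/
lemma ae_tendsto_mollify {g : E → F} (hg : LocallyIntegrable g μ) :
    ∀ᵐ y ∂μ, Tendsto (fun k ↦ mollify μ k g y) atTop (𝓝 (g y)) :=
  ContDiffBump.ae_convolution_tendsto_right_of_locallyIntegrable (K := 2) tendsto_rOut_bumpSeq
    (Eventually.of_forall fun k ↦ by simp only [bumpSeq]; rw [mul_one_div]) hg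

lemma tendsto_mollify_of_continuousAt {g : E → F} (hg : LocallyIntegrable g μ) {y : E}
    (hy : ContinuousAt g y) : Tendsto (fun k ↦ mollify μ k g y) atTop (𝓝 (g y)) := by
  refine ContDiffBump.convolution_tendsto_right (g := fun _ ↦ g) tendsto_rOut_bumpSeq
    (Eventually.of_forall fun _ ↦ hg.aestronglyMeasurable) ?_ tendsto_const_nhds
  exact hy.tendsto.comp tendsto_snd

/-- The derivative of the mollification is the mollification of the weak derivative. -/
lemma fderiv_mollify_eq {v : E → ℝ} {D : E → E →L[ℝ] ℝ} (hv : LocallyIntegrable v μ)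
    (hD : LocallyIntegrable D μ) {y : E} {k : ℕ}
    (h : ∀ ψ : E → ℝ, ContDiff ℝ ∞ ψ →
      tsupport ψ ⊆ Metric.closedBall y (bumpSeq E k).rOut →
      ∀ w, ∫ z, v z * fderiv ℝ ψ z w ∂μ = -∫ z, D z w * ψ z ∂μ) :
    fderiv ℝ (mollify μ k v) y = mollify μ k D y := by
  set ρ := (bumpSeq E k).normed μ with hρ
  have hρc : HasCompactSupport ρ := (bumpSeq E k).hasCompactSupport_normed
  have hρd : ContDiff ℝ ∞ ρ := (bumpSeq E k).contDiff_normed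
  have hρd1 : ContDiff ℝ 1 ρ := (bumpSeq E k).contDiff_normed (n := 1)
  have h1 := (hρc.hasFDerivAt_convolution_left (ContinuousLinearMap.lsmul ℝ ℝ) hρd1 hv y).fderiv
  have hρ' : Continuous (fderiv ℝ ρ) := hρd1.continuous_fderiv one_ne_zero
  ext w
  -- The weak derivative is tested with the reflected bump ρ(y - ·); the sign from the reflection
  -- cancels the sign from the integration by parts.
  have hψd : ContDiff ℝ ∞ fun z ↦ ρ (y - z) := hρd.comp (contDiff_const.sub contDiff_id)
  have hψs : tsupport (fun z ↦ ρ (y - z)) ⊆ Metric.closedBall y (bumpSeq E k).rOut := by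
    refine closure_minimal (fun z hz ↦ ?_) Metric.isClosed_closedBall
    have : y - z ∈ Function.support ρ := hz
    rw [hρ, (bumpSeq E k).support_normed_eq, mem_ball_zero_iff] at this
    rw [Metric.mem_closedBall, dist_comm, dist_eq_norm]
    exact this.le
  have h2 := h _ hψd hψs w
  have h3 : ∀ z, fderiv ℝ (fun z ↦ ρ (y - z)) z w = -(fderiv ℝ ρ (y - z) w) := fun z ↦ by
    have e := ((hρd1.differentiable one_ne_zero (y - z)).hasFDerivAt.comp z
      ((hasFDerivAt_id z).const_sub y)).fderiv
    exact (DFunLike.congr_fun e w).trans (by simp)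
  simp only [h3, mul_neg] at h2
  rw [integral_neg, neg_inj] at h2
  have hL : fderiv ℝ (mollify μ k v) y w = ∫ z, v z * fderiv ℝ ρ (y - z) w ∂μ := by
    change fderiv ℝ (ρ ⋆[ContinuousLinearMap.lsmul ℝ ℝ, μ] v) y w = _
    rw [h1, convolution_eq_swap, ContinuousLinearMap.integral_apply]
    · refine integral_congr_ae (Eventually.of_forall fun z ↦ ?_)
      simp [ContinuousLinearMap.precompL_apply, mul_comm]
    · have := (hρc.fderiv ℝ).convolutionExists_left
        (ContinuousLinearMap.precompL E (ContinuousLinearMap.lsmul ℝ ℝ)) hρ' hv y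
      rw [convolutionExistsAt_iff_integrable_swap] at this
      exact this
  have hR : mollify μ k D y w = ∫ z, D z w * ρ (y - z) ∂μ := by
    change (ρ ⋆[ContinuousLinearMap.lsmul ℝ ℝ, μ] D) y w = _
    rw [convolution_eq_swap, ContinuousLinearMap.integral_apply]
    · refine integral_congr_ae (Eventually.of_forall fun z ↦ ?_)
      simp [mul_comm]
    · have := hρc.convolutionExists_left (ContinuousLinearMap.lsmul ℝ ℝ) hρd.continuous hD y
      rw [convolutionExistsAt_iff_integrable_swap] at this
      exact this
  rw [hL, hR, h2]

/-- A modulus of continuity of `χ` near `y`, positively homogeneous, bounds the derivative of the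
mollification at `y`. -/
lemma abs_fderiv_mollify_le {χ : E → ℝ} (hχ : LocallyIntegrable χ μ) {y : E} {k : ℕ} {ε : ℝ}
    (hε : (bumpSeq E k).rOut < ε) {N : E → ℝ} (hN : ∀ c : ℝ, 0 < c → ∀ w, N (c • w) = c * N w)
    (h : ∀ x₁ ∈ Metric.ball y ε, ∀ x₂ ∈ Metric.ball y ε, |χ x₁ - χ x₂| ≤ N (x₁ - x₂)) (w : E) :
    |fderiv ℝ (mollify μ k χ) y w| ≤ N w := by
  set ρ := (bumpSeq E k).normed μ with hρ
  -- The mollification at y + t w and at y averages χ over points that differ exactly by t w. The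
  -- one-sided difference quotient is therefore at most N w, and since the mollification is smooth
  -- this bounds its derivative.
  have hev : ∀ᶠ t : ℝ in 𝓝[>] 0,
      |t⁻¹ * (mollify μ k χ (y + t • w) - mollify μ k χ y)| ≤ N w := by
    have h1 : Tendsto (fun t : ℝ ↦ ‖t • w‖) (𝓝[>] 0) (𝓝 0) := by
      have : Tendsto (fun t : ℝ ↦ ‖t • w‖) (𝓝 0) (𝓝 ‖(0 : ℝ) • w‖) :=
        Continuous.tendsto (by fun_prop) 0
      simpa using this.mono_left nhdsWithin_le_nhds
    filter_upwards [h1.eventually_lt_const (sub_pos.2 hε), self_mem_nhdsWithin] with t ht ht0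
    have ht0' : (0 : ℝ) < t := ht0
    have hi1 := integrable_bump_smul k hχ (y + t • w)
    have hi2 := integrable_bump_smul k hχ y
    have hb : |mollify μ k χ (y + t • w) - mollify μ k χ y| ≤ t * N w := by
      rw [mollify_eq, mollify_eq, ← integral_sub hi1 hi2, ← Real.norm_eq_abs]
      calc _ ≤ ∫ z, ρ z * (t * N w) ∂μ := by
            refine norm_integral_le_of_norm_le ((bumpSeq E k).integrable_normed.mul_const _)
              (Eventually.of_forall fun z ↦ ?_)
            rw [← smul_sub, norm_smul, Real.norm_of_nonneg ((bumpSeq E k).nonneg_normed z)]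
            by_cases hz : z ∈ Function.support ρ
            · refine mul_le_mul_of_nonneg_left ?_ ((bumpSeq E k).nonneg_normed z)
              rw [hρ, (bumpSeq E k).support_normed_eq, mem_ball_zero_iff] at hz
              rw [← hN t ht0' w, Real.norm_eq_abs]
              have hx1 : y + t • w - z ∈ Metric.ball y ε := by
                rw [mem_ball_iff_norm, show y + t • w - z - y = t • w - z by abel]
                exact (norm_sub_le _ _).trans_lt (by linarith)
              have hx2 : y - z ∈ Metric.ball y ε := by
                rw [mem_ball_iff_norm, show y - z - y = -z by abel, norm_neg]
                linarith
              have := h _ hx1 _ hx2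
              rwa [show y + t • w - z - (y - z) = t • w by abel] at this
            · have : (bumpSeq E k).normed μ z = 0 := Function.notMem_support.1 hz
              rw [hρ, this]; simp
        _ = t * N w := by
            rw [integral_mul_const, hρ, (bumpSeq E k).integral_normed, one_mul]
    rw [abs_mul, abs_of_pos (inv_pos.2 ht0'), inv_mul_le_iff₀ ht0']
    exact hb
  have hd : HasDerivAt (fun t : ℝ ↦ mollify μ k χ (y + t • w))
      (fderiv ℝ (mollify μ k χ) y w) 0 := by
    have h1 : HasFDerivAt (mollify μ k χ) (fderiv ℝ (mollify μ k χ) y) (y + (0 : ℝ) • w) := by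
      rw [zero_smul, add_zero]
      exact ((contDiff_mollify k hχ).differentiable (by simp) y).hasFDerivAt
    have h2 : HasDerivAt (fun t : ℝ ↦ y + t • w) w 0 := by
      simpa using ((hasDerivAt_id (0 : ℝ)).smul_const w).const_add y
    exact h1.comp_hasDerivAt 0 h2
  have ht := hd.tendsto_slope_zero_right
  refine le_of_tendsto ht.abs ?_
  filter_upwards [hev] with t h3
  simpa using h3

end Mollifier

/-! ### Testing an equation in divergence form in Euclidean space. -/

section LocalInequality

variable {E : Type*} [NormedAddCommGroup E] [InnerProductSpace ℝ E] [FiniteDimensional ℝ E]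
  [MeasurableSpace E] [BorelSpace E] {μ : Measure E} [μ.IsAddHaarMeasure]

/-- Truncation of a function to a set. -/
def truncate {F : Type*} [NormedAddCommGroup F] (L : Set E) (g : E → F) : E → F := L.indicator g

lemma truncate_of_mem {F : Type*} [NormedAddCommGroup F] {L : Set E} (g : E → F) {y : E}
    (hy : y ∈ L) : truncate L g y = g y := Set.indicator_of_mem hy g

lemma memLp_truncate {F : Type*} [NormedAddCommGroup F] {L : Set E}
    (hL : MeasurableSet L) {g : E → F} {P : ℝ≥0∞} (hg : MemLp g P (μ.restrict L)) :
    MemLp (truncate L g) P μ :=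
  (memLp_indicator_iff_restrict hL).2 hg

set_option maxHeartbeats 400000 in
/-- The effect of testing an equation `f = div a` with the compactly supported function
`η Φ(v) χ`, where `v` has a weak derivative `D` and `χ` is locally Lipschitz. -/
theorem abs_integral_test_le {T K : Set E} (hT : IsOpen T) (hK : IsCompact K) (hKT : K ⊆ T)
    {P P' : ℝ≥0∞} [P.HolderTriple P' 1] (hP : 1 ≤ P) (hPt : P ≠ ⊤)
    {f : E → ℝ} (hf : IntegrableOn f K μ) {a : E → E} (ha : MemLp a P' (μ.restrict K))
    (ha1 : IntegrableOn a K μ)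
    {v : E → ℝ} (hv : LocallyIntegrableOn v T μ) {D : E → E →L[ℝ] ℝ}
    (hD : ∀ L, IsCompact L → L ⊆ T → MemLp D P (μ.restrict L))
    (hvD : ∀ ψ : E → ℝ, ContDiff ℝ ∞ ψ → HasCompactSupport ψ → tsupport ψ ⊆ T → ∀ w,
      ∫ y, v y * fderiv ℝ ψ y w ∂μ = -∫ y, D y w * ψ y ∂μ)
    (hfa : ∀ ψ : E → ℝ, ContDiff ℝ ∞ ψ → tsupport ψ ⊆ K →
      ∫ y in K, f y * ψ y ∂μ = -∫ y in K, fderiv ℝ ψ y (a y) ∂μ)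
    {η : E → ℝ} (hη : ContDiff ℝ ∞ η) (hηK : tsupport η ⊆ K)
    {Φ : ℝ → ℝ} (hΦ : ContDiff ℝ ∞ Φ) {B : ℝ} (hB : ∀ s, |Φ s| ≤ B) (hB' : ∀ s, |deriv Φ s| ≤ B)
    {χ : E → ℝ} (hχ : ContinuousOn χ T) {N : E → E → ℝ}
    (hN : ∀ y ∈ K, ∀ c : ℝ, 0 < c → ∀ w, N y (c • w) = c * N y w) {ε : ℝ} (hε : 0 < ε)
    (hNχ : ∀ y ∈ K, ∀ x₁ ∈ Metric.ball y ε, ∀ x₂ ∈ Metric.ball y ε,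
      |χ x₁ - χ x₂| ≤ N y (x₁ - x₂))
    (hNa : IntegrableOn (fun y ↦ N y (a y)) K μ) :
    |(∫ y in K, f y * (η y * Φ (v y) * χ y) ∂μ) +
        ((∫ y in K, Φ (v y) * χ y * fderiv ℝ η y (a y) ∂μ) +
          ∫ y in K, η y * χ y * deriv Φ (v y) * D y (a y) ∂μ)| ≤
      ∫ y in K, |η y| * |Φ (v y)| * N y (a y) ∂μ := by
  -- All functions are cut off to a compact neighbourhood L of K inside T. This makes them globally
  -- locally integrable, and below scale δ the mollifications at points of K do not see the cutoff.
  obtain ⟨δ, hδ, hδT⟩ := hK.exists_cthickening_subset_open hT hKT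
  set L := Metric.cthickening δ K with hL
  have hLc : IsCompact L := hK.cthickening
  have hLm : MeasurableSet L := hLc.measurableSet
  have hKm : MeasurableSet K := hK.measurableSet
  have hKL : K ⊆ L := Metric.self_subset_cthickening K
  have hball : ∀ y ∈ K, Metric.closedBall y δ ⊆ L := fun y hy ↦
    Metric.closedBall_subset_cthickening hy δ
  set v' := L.indicator v with hv'
  set D' := truncate L D with hD'
  set χ' := L.indicator χ with hχ'
  have hv'i : LocallyIntegrable v' μ :=
    ((integrable_indicator_iff hLm).2
      (hv.integrableOn_compact_subset hδT hLc)).locallyIntegrable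
  have hD'L : MemLp D' P μ := memLp_truncate hLm (hD L hLc hδT)
  have hD'i : LocallyIntegrable D' μ := hD'L.locallyIntegrable hP
  have hχ'i : LocallyIntegrable χ' μ :=
    ((integrable_indicator_iff hLm).2
      ((hχ.mono hδT).integrableOn_compact hLc)).locallyIntegrable
  obtain ⟨Cχ, hCχ⟩ := hLc.exists_bound_of_continuousOn (hχ.mono hδT)
  obtain ⟨Cη, hCη⟩ := hK.exists_bound_of_continuousOn hη.continuous.continuousOn
  have hη'c : Continuous (fderiv ℝ η) := hη.continuous_fderiv (by simp)
  obtain ⟨Cη', hCη'⟩ := hK.exists_bound_of_continuousOn hη'c.continuousOn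
  have hΦ'c : Continuous (deriv Φ) := hΦ.continuous_deriv (by simp)
  have hB0 : 0 ≤ B := (abs_nonneg _).trans (hB 0)
  set vk := fun k ↦ mollify μ k v' with hvk
  set χk := fun k ↦ mollify μ k χ' with hχk
  have hvkd : ∀ k, ContDiff ℝ ∞ (vk k) := fun k ↦ contDiff_mollify k hv'i
  have hχkd : ∀ k, ContDiff ℝ ∞ (χk k) := fun k ↦ contDiff_mollify k hχ'i
  -- eventual bounds
  have hsmall : ∀ᶠ k in atTop, (bumpSeq E k).rOut < min δ ε :=
    (tendsto_rOut_bumpSeq (E := E)).eventually_lt_const (lt_min hδ hε)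
  -- The mollification differs from χ by at most 2 Cχ at points of K, and χ is bounded by Cχ there.
  -- Only the uniformity in k matters.
  have hχb : ∀ᶠ k in atTop, ∀ y ∈ K, |χk k y| ≤ 3 * Cχ := by
    filter_upwards [hsmall] with k hk y hy
    have hb : ∀ x ∈ L, |χ' x| ≤ Cχ := fun x hx ↦ by
      rw [hχ', Set.indicator_of_mem hx]; exact hCχ x hx
    have h1 : dist (χk k y) (χ' y) ≤ 2 * Cχ := by
      refine (bumpSeq E k).dist_normed_convolution_le hχ'i.aestronglyMeasurable fun x hx ↦ ?_
      have hx' : x ∈ L := hball y hy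
        (Metric.ball_subset_closedBall (Metric.ball_subset_ball (hk.le.trans (min_le_left _ _)) hx))
      rw [Real.dist_eq]
      have := abs_sub (χ' x) (χ' y)
      linarith [hb x hx', hb y (hKL hy)]
    rw [Real.dist_eq] at h1
    have h2 := abs_sub_abs_le_abs_sub (χk k y) (χ' y)
    linarith [hb y (hKL hy)]
  have hfdv : ∀ᶠ k in atTop, ∀ y ∈ K, fderiv ℝ (vk k) y = mollify μ k D' y := by
    filter_upwards [hsmall] with k hk y hy
    refine fderiv_mollify_eq hv'i hD'i fun ψ hψ hψs w ↦ ?_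
    have hsL : tsupport ψ ⊆ L := hψs.trans
      ((Metric.closedBall_subset_closedBall (hk.le.trans (min_le_left _ _))).trans (hball y hy))
    have h1 := hvD ψ hψ (HasCompactSupport.intro (K := Metric.closedBall y (bumpSeq E k).rOut)
      (isCompact_closedBall _ _) fun x hx ↦ image_eq_zero_of_notMem_tsupport fun h ↦ hx (hψs h))
      (hsL.trans hδT) w
    convert! h1 using 2
    · ext z
      by_cases hz : z ∈ L
      · rw [hv', Set.indicator_of_mem hz]
      · have : fderiv ℝ ψ z = 0 := by
          by_contra h
          exact hz (hsL (support_fderiv_subset ℝ h))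
        simp [this]
    · refine integral_congr_ae (Eventually.of_forall fun z ↦ ?_)
      by_cases hz : z ∈ L
      · simp only [hD', truncate_of_mem D hz]
      · have : ψ z = 0 := image_eq_zero_of_notMem_tsupport fun h ↦ hz (hsL h)
        simp [this]
  -- No limit of the derivatives of χ_k is taken. Only this bound survives, which is why the
  -- conclusion is an inequality.
  have hfdχ : ∀ᶠ k in atTop, ∀ y ∈ K, ∀ w, |fderiv ℝ (χk k) y w| ≤ N y w := by
    filter_upwards [hsmall] with k hk y hy w
    refine abs_fderiv_mollify_le hχ'i hk (hN y hy) (fun x₁ h₁ x₂ h₂ ↦ ?_) w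
    have hs : Metric.ball y (min δ ε) ⊆ L :=
      Metric.ball_subset_closedBall.trans ((Metric.closedBall_subset_closedBall
        (min_le_left _ _)).trans (hball y hy))
    rw [hχ', Set.indicator_of_mem (hs h₁), Set.indicator_of_mem (hs h₂)]
    exact hNχ y hy x₁ (Metric.ball_subset_ball (min_le_right _ _) h₁) x₂
      (Metric.ball_subset_ball (min_le_right _ _) h₂)
  -- pointwise limits
  have hvt : ∀ᵐ y ∂(μ.restrict K), Tendsto (fun k ↦ vk k y) atTop (𝓝 (v y)) := by
    rw [ae_restrict_iff' hKm]
    filter_upwards [ae_tendsto_mollify hv'i] with y hy hyK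
    rw [hv', Set.indicator_of_mem (hKL hyK)] at hy
    exact hy
  have hχt : ∀ y ∈ K, Tendsto (fun k ↦ χk k y) atTop (𝓝 (χ y)) := fun y hy ↦ by
    have hn : L ∈ 𝓝 y := mem_of_superset (Metric.closedBall_mem_nhds y hδ) (hball y hy)
    have hc : ContinuousAt χ' y :=
      ((hχ y (hKT hy)).continuousAt (hT.mem_nhds (hKT hy))).congr (by
        filter_upwards [hn] with x hx
        rw [hχ', Set.indicator_of_mem hx])
    have := tendsto_mollify_of_continuousAt hχ'i hc
    rwa [hχ', Set.indicator_of_mem (hKL hy)] at this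
  have hDt : Tendsto (fun k ↦ eLpNorm (mollify μ k D' - D') P (μ.restrict K)) atTop (𝓝 0) :=
    tendsto_of_tendsto_of_tendsto_of_le_of_le tendsto_const_nhds
      (tendsto_eLpNorm_mollify hP hPt hD'L) (fun _ ↦ zero_le)
      fun k ↦ eLpNorm_mono_measure _ Measure.restrict_le_self
  have hmem : ∀ᵐ y ∂(μ.restrict K), y ∈ K := ae_restrict_mem hKm
  have ham := ha1.aestronglyMeasurable
  have hvm : AEStronglyMeasurable v (μ.restrict K) :=
    (hv.integrableOn_compact_subset hKT hK).aestronglyMeasurable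
  have hDm : AEStronglyMeasurable D (μ.restrict K) := (hD K hK hKT).1
  have hDaK : Integrable (fun y ↦ ‖D y‖ * ‖a y‖) (μ.restrict K) :=
    (hD K hK hKT).norm.integrable_mul ha.norm
  have happ : ∀ {G : E → E →L[ℝ] ℝ}, AEStronglyMeasurable G (μ.restrict K) →
      AEStronglyMeasurable (fun y ↦ G y (a y)) (μ.restrict K) := fun hG ↦
    (ContinuousLinearMap.apply ℝ ℝ).flip.aestronglyMeasurable_comp₂ hG ham
  -- the three terms of the tested equation
  set A₁ := fun k ↦ ∫ y in K, f y * (η y * Φ (vk k y) * χk k y) ∂μ with hA₁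
  set A₂ := fun k ↦ ∫ y in K, Φ (vk k y) * χk k y * fderiv ℝ η y (a y) ∂μ with hA₂
  set A₃ := fun k ↦ ∫ y in K, η y * χk k y * deriv Φ (vk k y) * D y (a y) ∂μ with hA₃
  set A₄ := fun k ↦ ∫ y in K, η y * χk k y * deriv Φ (vk k y) *
    (mollify μ k D' y - D y) (a y) ∂μ with hA₄
  set R := fun k ↦ ∫ y in K, |η y| * |Φ (vk k y)| * N y (a y) ∂μ with hR
  have hCη0 : ∀ y ∈ K, |η y| ≤ Cη := hCη
  have h1 : Tendsto A₁ atTop (𝓝 (∫ y in K, f y * (η y * Φ (v y) * χ y) ∂μ)) := by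
    refine tendsto_integral_filter_of_dominated_convergence
      (fun y ↦ |f y| * (Cη * B * (3 * Cχ))) ?_ ?_ (hf.abs.mul_const _) ?_
    · exact Eventually.of_forall fun k ↦ hf.aestronglyMeasurable.mul
        ((hη.continuous.mul (hΦ.continuous.comp (hvkd k).continuous)).mul
          (hχkd k).continuous).aestronglyMeasurable
    · filter_upwards [hχb] with k hk
      filter_upwards [hmem] with y hy
      rw [norm_mul, norm_mul, norm_mul]
      simp only [Real.norm_eq_abs]
      gcongr
      · exact mul_nonneg ((abs_nonneg _).trans (hCη0 y hy)) hB0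
      · exact (abs_nonneg _).trans (hCη0 y hy)
      · exact hCη0 y hy
      · exact hB _
      · exact hk y hy
    · filter_upwards [hvt, hmem] with y hy hyK
      exact (((hΦ.continuous.tendsto _).comp hy).const_mul _ |>.mul (hχt y hyK)).const_mul _
  have h2 : Tendsto A₂ atTop (𝓝 (∫ y in K, Φ (v y) * χ y * fderiv ℝ η y (a y) ∂μ)) := by
    refine tendsto_integral_filter_of_dominated_convergence
      (fun y ↦ B * (3 * Cχ) * (Cη' * ‖a y‖)) ?_ ?_ ((ha1.norm.const_mul _).const_mul _) ?_
    · exact Eventually.of_forall fun k ↦ (((hΦ.continuous.comp (hvkd k).continuous)).mul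
          (hχkd k).continuous).aestronglyMeasurable.mul (happ hη'c.aestronglyMeasurable)
    · filter_upwards [hχb] with k hk
      filter_upwards [hmem] with y hy
      rw [norm_mul, norm_mul]
      have e1 : ‖fderiv ℝ η y (a y)‖ ≤ Cη' * ‖a y‖ :=
        (ContinuousLinearMap.le_opNorm _ _).trans (by gcongr; exact hCη' y hy)
      have e2 := hk y hy
      gcongr
      · exact mul_nonneg hB0 ((abs_nonneg _).trans e2)
      · exact hB _
      · exact e2
    · filter_upwards [hvt, hmem] with y hy hyK
      exact (((hΦ.continuous.tendsto _).comp hy).mul (hχt y hyK)).mul_const _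
  have hbd3 : ∀ᶠ k in atTop, ∀ y ∈ K,
      |η y * χk k y * deriv Φ (vk k y)| ≤ Cη * (3 * Cχ) * B := by
    filter_upwards [hχb] with k hk y hy
    rw [abs_mul, abs_mul]
    have e2 := hk y hy
    have e3 := hCη0 y hy
    have e4 := (abs_nonneg _).trans e2
    have e5 := (abs_nonneg _).trans e3
    gcongr
    exact hB' _
  have hcoef : ∀ k, Continuous fun y ↦ η y * χk k y * deriv Φ (vk k y) := fun k ↦
    (hη.continuous.mul (hχkd k).continuous).mul (hΦ'c.comp (hvkd k).continuous)
  have h3 : Tendsto A₃ atTop (𝓝 (∫ y in K, η y * χ y * deriv Φ (v y) * D y (a y) ∂μ)) := by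
    refine tendsto_integral_filter_of_dominated_convergence
      (fun y ↦ Cη * (3 * Cχ) * B * (‖D y‖ * ‖a y‖)) ?_ ?_ (hDaK.const_mul _) ?_
    · exact Eventually.of_forall fun k ↦ (hcoef k).aestronglyMeasurable.mul (happ hDm)
    · filter_upwards [hbd3] with k hk
      filter_upwards [hmem] with y hy
      rw [norm_mul]
      have e2 := hk y hy
      exact mul_le_mul e2 (ContinuousLinearMap.le_opNorm _ _) (norm_nonneg _)
        ((abs_nonneg _).trans e2)
    · filter_upwards [hvt, hmem] with y hy hyK
      exact (((hχt y hyK).const_mul _).mul ((hΦ'c.tendsto _).comp hy)).mul_const _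
  have hMD : ∀ k, AEStronglyMeasurable (fun y ↦ mollify μ k D' y - D y) (μ.restrict K) := fun k ↦
    (contDiff_mollify k hD'i).continuous.aestronglyMeasurable.sub hDm
  have hDK : (fun y ↦ D' y) =ᵐ[μ.restrict K] D := by
    filter_upwards [hmem] with y hy
    exact truncate_of_mem D (hKL hy)
  -- The error of replacing the mollified D by D: convergence in L^P, paired with a in L^P' and with
  -- bounded coefficients.
  have h4 : Tendsto A₄ atTop (𝓝 0) := by
    have hprod : Tendsto (fun k ↦ eLpNorm (mollify μ k D' - D') P (μ.restrict K) *
        eLpNorm a P' (μ.restrict K)) atTop (𝓝 0) := by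
      simpa using ENNReal.Tendsto.mul_const hDt (Or.inr ha.2.ne)
    have hnorm : ∀ᶠ k in atTop, ‖A₄ k‖ₑ ≤ ENNReal.ofReal (Cη * (3 * Cχ) * B) *
        (eLpNorm (mollify μ k D' - D') P (μ.restrict K) * eLpNorm a P' (μ.restrict K)) := by
      filter_upwards [hbd3] with k hk
      calc ‖A₄ k‖ₑ ≤ ∫⁻ y in K, ‖η y * χk k y * deriv Φ (vk k y) *
              (mollify μ k D' y - D y) (a y)‖ₑ ∂μ := enorm_integral_le_lintegral_enorm _
        _ ≤ ∫⁻ y in K, ENNReal.ofReal (Cη * (3 * Cχ) * B) *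
              ‖‖mollify μ k D' y - D y‖ * ‖a y‖‖ₑ ∂μ := by
            refine lintegral_mono_ae ?_
            filter_upwards [hmem] with y hy
            rw [enorm_mul]
            refine mul_le_mul' ?_ ?_
            · rw [Real.enorm_eq_ofReal_abs]
              exact ENNReal.ofReal_le_ofReal (hk y hy)
            · refine enorm_le_iff_norm_le.2 ?_
              rw [norm_mul, norm_norm, norm_norm]
              exact ContinuousLinearMap.le_opNorm _ _
        _ = ENNReal.ofReal (Cη * (3 * Cχ) * B) *
            eLpNorm ((fun y ↦ ‖mollify μ k D' y - D y‖) • fun y ↦ ‖a y‖) 1 (μ.restrict K) := by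
            rw [lintegral_const_mul' _ _ ENNReal.ofReal_ne_top, eLpNorm_one_eq_lintegral_enorm]
            rfl
        _ ≤ _ := by
            gcongr
            refine (eLpNorm_smul_le_mul_eLpNorm (p := P) (q := P') ham.norm (hMD k).norm).trans ?_
            rw [eLpNorm_norm, eLpNorm_norm]
            gcongr
            refine (eLpNorm_congr_ae ?_).le
            filter_upwards [hDK] with y hy
            simp only [Pi.sub_apply, hy]
    have h0 : Tendsto (fun k ↦ ‖A₄ k‖ₑ) atTop (𝓝 0) := by
      refine tendsto_of_tendsto_of_tendsto_of_le_of_le' tendsto_const_nhds ?_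
        (Eventually.of_forall fun _ ↦ zero_le) hnorm
      simpa using ENNReal.Tendsto.const_mul hprod
        (Or.inr (ENNReal.ofReal_ne_top (r := Cη * (3 * Cχ) * B)))
    exact tendsto_zero_iff_enorm_tendsto_zero.2 h0
  have h5 : Tendsto R atTop (𝓝 (∫ y in K, |η y| * |Φ (v y)| * N y (a y) ∂μ)) := by
    refine tendsto_integral_filter_of_dominated_convergence
      (fun y ↦ Cη * B * |N y (a y)|) ?_ ?_ (hNa.abs.const_mul _) ?_
    · exact Eventually.of_forall fun k ↦ (hη.continuous.abs.mul
        (hΦ.continuous.comp (hvkd k).continuous).abs).aestronglyMeasurable.mul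
          hNa.aestronglyMeasurable
    · refine Eventually.of_forall fun k ↦ ?_
      filter_upwards [hmem] with y hy
      rw [norm_mul, norm_mul]
      simp only [Real.norm_eq_abs, abs_abs]
      have e3 := hCη0 y hy
      have e5 := (abs_nonneg _).trans e3
      gcongr
      exact hB _
    · filter_upwards [hvt] with y hy
      exact (((hΦ.continuous.tendsto _).comp hy).abs.const_mul _).mul_const _
  -- For fixed k the function η Φ(v_k) χ_k is an admissible smooth test function. The product rule
  -- yields the terms A₂, A₃, A₄ and one more containing the derivative of χ_k, which is estimated
  -- by R.
  have hmain : ∀ᶠ k in atTop, |A₁ k + (A₂ k + (A₃ k + A₄ k))| ≤ R k := by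
    filter_upwards [hχb, hfdv, hfdχ, hbd3] with k hk hfv hfχ hk3
    set ψ : E → ℝ := fun y ↦ η y * Φ (vk k y) * χk k y with hψ
    have hΦv : ContDiff ℝ ∞ fun y ↦ Φ (vk k y) := hΦ.comp (hvkd k)
    have hψd : ContDiff ℝ ∞ ψ := (hη.mul hΦv).mul (hχkd k)
    have hψK : tsupport ψ ⊆ K := by
      refine (closure_mono ?_).trans hηK
      intro y hy h0
      exact hy (by simp only [hψ, h0, zero_mul])
    have heq := hfa ψ hψd hψK
    have hder : ∀ y ∈ K, fderiv ℝ ψ y (a y) = Φ (vk k y) * χk k y * fderiv ℝ η y (a y) +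
        (η y * χk k y * deriv Φ (vk k y) * D y (a y) +
        η y * χk k y * deriv Φ (vk k y) * (mollify μ k D' y - D y) (a y)) +
        η y * Φ (vk k y) * fderiv ℝ (χk k) y (a y) := fun y hy ↦ by
      have d1 := (hη.differentiable (by simp) y).hasFDerivAt
      have d2 := ((hvkd k).differentiable (by simp) y).hasFDerivAt
      have d3 := ((hχkd k).differentiable (by simp) y).hasFDerivAt
      have d4 := (hΦ.differentiable (by simp) (vk k y)).hasDerivAt
      have d5 := (d1.mul (d4.comp_hasFDerivAt y d2)).mul d3
      have d6 := d5.fderiv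
      rw [show fderiv ℝ ψ y = _ from d6]
      simp only [add_apply, smul_apply, smul_eq_mul,
        Function.comp_apply, hfv y hy, sub_apply, Pi.mul_apply]
      ring
    have i2 : Integrable (fun y ↦ Φ (vk k y) * χk k y * fderiv ℝ η y (a y)) (μ.restrict K) := by
      refine (ha1.norm.const_mul (B * (3 * Cχ) * Cη')).mono'
        ((hΦv.continuous.mul (hχkd k).continuous).aestronglyMeasurable.mul
          (happ hη'c.aestronglyMeasurable)) ?_
      filter_upwards [hmem] with y hy
      rw [norm_mul, norm_mul]
      have e1 : ‖fderiv ℝ η y (a y)‖ ≤ Cη' * ‖a y‖ :=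
        (ContinuousLinearMap.le_opNorm _ _).trans (by gcongr; exact hCη' y hy)
      have e2 := hk y hy
      rw [mul_assoc (B * (3 * Cχ))]
      gcongr
      · exact mul_nonneg hB0 ((abs_nonneg _).trans e2)
      · exact hB _
      · exact e2
    have i3 : ∀ {G : E → E →L[ℝ] ℝ}, AEStronglyMeasurable G (μ.restrict K) →
        Integrable (fun y ↦ ‖G y‖ * ‖a y‖) (μ.restrict K) →
        Integrable (fun y ↦ η y * χk k y * deriv Φ (vk k y) * G y (a y)) (μ.restrict K) := by
      intro G hG hGi
      refine (hGi.const_mul (Cη * (3 * Cχ) * B)).mono'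
        ((hcoef k).aestronglyMeasurable.mul (happ hG)) ?_
      filter_upwards [hmem] with y hy
      rw [norm_mul]
      have e2 := hk3 y hy
      exact mul_le_mul e2 (ContinuousLinearMap.le_opNorm _ _) (norm_nonneg _)
        ((abs_nonneg _).trans e2)
    have i4 : Integrable (fun y ↦ ‖mollify μ k D' y - D y‖ * ‖a y‖) (μ.restrict K) := by
      have hc : Continuous (mollify μ k D') := (contDiff_mollify k hD'i).continuous
      obtain ⟨C, hC⟩ := hK.exists_bound_of_continuousOn hc.continuousOn
      refine ((ha1.norm.const_mul C).add hDaK).mono' ((hMD k).norm.mul ham.norm) ?_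
      filter_upwards [hmem] with y hy
      rw [Real.norm_of_nonneg (by positivity), Pi.add_apply, ← add_mul]
      gcongr
      exact (norm_sub_le _ _).trans (by gcongr; exact hC y hy)
    have hχ'c : Continuous (fderiv ℝ (χk k)) := (hχkd k).continuous_fderiv (by simp)
    have hb5 : ∀ᵐ y ∂(μ.restrict K), ‖η y * Φ (vk k y) * fderiv ℝ (χk k) y (a y)‖ ≤
        |η y| * |Φ (vk k y)| * N y (a y) := by
      filter_upwards [hmem] with y hy
      rw [norm_mul, norm_mul]
      simp only [Real.norm_eq_abs]
      gcongr
      exact hfχ y hy (a y)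
    have i5R : Integrable (fun y ↦ |η y| * |Φ (vk k y)| * N y (a y)) (μ.restrict K) := by
      refine (hNa.abs.const_mul (Cη * B)).mono' ((hη.continuous.abs.mul
        hΦv.continuous.abs).aestronglyMeasurable.mul hNa.aestronglyMeasurable) ?_
      filter_upwards [hmem] with y hy
      rw [norm_mul, norm_mul]
      simp only [Real.norm_eq_abs, abs_abs]
      have e3 := hCη0 y hy
      have e5 := (abs_nonneg _).trans e3
      gcongr
      exact hB _
    have i5 : Integrable (fun y ↦ η y * Φ (vk k y) * fderiv ℝ (χk k) y (a y))
        (μ.restrict K) :=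
      i5R.mono' ((hη.continuous.mul hΦv.continuous).aestronglyMeasurable.mul
        (happ hχ'c.aestronglyMeasurable)) hb5
    have hsplit : ∫ y in K, fderiv ℝ ψ y (a y) ∂μ = A₂ k + (A₃ k + A₄ k) +
        ∫ y in K, η y * Φ (vk k y) * fderiv ℝ (χk k) y (a y) ∂μ := by
      rw [setIntegral_congr_fun hKm hder]
      have j3 := i3 hDm hDaK
      have j4 := i3 (hMD k) i4
      refine (integral_add (i2.add (j3.add j4)) i5).trans ?_
      congr 1
      refine (integral_add i2 (j3.add j4)).trans ?_
      congr 1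
      exact integral_add j3 j4
    have hA : A₁ k + (A₂ k + (A₃ k + A₄ k)) =
        -∫ y in K, η y * Φ (vk k y) * fderiv ℝ (χk k) y (a y) ∂μ := by
      have : A₁ k = -∫ y in K, fderiv ℝ ψ y (a y) ∂μ := heq
      rw [this, hsplit]; ring
    rw [hA, abs_neg, ← Real.norm_eq_abs]
    exact norm_integral_le_of_norm_le i5R hb5
  have hlim := (h1.add (h2.add (h3.add h4))).abs
  rw [add_zero] at hlim
  exact le_of_tendsto_of_tendsto hlim h5 hmain

end LocalInequality

/-! ### Coordinate vector fields. -/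

section Coordinates

variable {n : ℕ} {M : Type*} [EMetricSpace M] [ChartedSpace (EuclideanSpace ℝ (Fin n)) M]

lemma coordVec_add (x₀ : M) (w w' y : EuclideanSpace ℝ (Fin n)) :
    coordVec x₀ (w + w') y = coordVec x₀ w y + coordVec x₀ w' y :=
  map_add (mfderiv (𝓡 n) (𝓡 n) (extChartAt (𝓡 n) x₀).symm y) w w'

lemma coordVec_smul (x₀ : M) (c : ℝ) (w y : EuclideanSpace ℝ (Fin n)) :
    coordVec x₀ (c • w) y = c • coordVec x₀ w y :=
  map_smul (mfderiv (𝓡 n) (𝓡 n) (extChartAt (𝓡 n) x₀).symm y) c w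

variable [IsManifold (𝓡 n) ∞ M]

/-- The components of a tangent vector at `α⁻¹(y)` in the chart `α` at `x₀`. -/
def chartComponents (x₀ : M) (y : EuclideanSpace ℝ (Fin n))
    (X : TangentSpace (𝓡 n) ((extChartAt (𝓡 n) x₀).symm y)) : EuclideanSpace ℝ (Fin n) :=
  mfderiv (𝓡 n) (𝓡 n) (extChartAt (𝓡 n) x₀) ((extChartAt (𝓡 n) x₀).symm y) X

lemma isOpen_target (x₀ : M) : IsOpen (extChartAt (𝓡 n) x₀).target := isOpen_extChartAt_target x₀

lemma mfderiv_symm_eq (x₀ : M) (y : EuclideanSpace ℝ (Fin n)) :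
    mfderiv (𝓡 n) (𝓡 n) (extChartAt (𝓡 n) x₀).symm y =
      mfderivWithin (𝓡 n) (𝓡 n) (extChartAt (𝓡 n) x₀).symm (Set.range (𝓡 n)) y := by
  rw [(𝓡 n).range_eq_univ, mfderivWithin_univ]

lemma coordVec_chartComponents {x₀ : M} {y : EuclideanSpace ℝ (Fin n)}
    (hy : y ∈ (extChartAt (𝓡 n) x₀).target)
    (X : TangentSpace (𝓡 n) ((extChartAt (𝓡 n) x₀).symm y)) :
    coordVec x₀ (chartComponents x₀ y X) y = X := by
  have : IsManifold (𝓡 n) 1 M := .of_le (n := ∞) (by simp)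
  have h := mfderivWithin_extChartAt_symm_comp_mfderiv_extChartAt (I := 𝓡 n) hy
  rw [← mfderiv_symm_eq] at h
  exact DFunLike.congr_fun h X

lemma chartComponents_coordVec {x₀ : M} {y : EuclideanSpace ℝ (Fin n)}
    (hy : y ∈ (extChartAt (𝓡 n) x₀).target) (w : EuclideanSpace ℝ (Fin n)) :
    chartComponents x₀ y (coordVec x₀ w y) = w := by
  have : IsManifold (𝓡 n) 1 M := .of_le (n := ∞) (by simp)
  have h := mfderiv_extChartAt_comp_mfderivWithin_extChartAt_symm (I := 𝓡 n) hy
  rw [← mfderiv_symm_eq] at h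
  exact DFunLike.congr_fun h w

lemma coordVec_eq_zero {x₀ : M} {y : EuclideanSpace ℝ (Fin n)}
    (hy : y ∈ (extChartAt (𝓡 n) x₀).target) {w : EuclideanSpace ℝ (Fin n)}
    (h : coordVec x₀ w y = 0) : w = 0 := by
  rw [← chartComponents_coordVec hy w, h]
  exact map_zero (mfderiv (𝓡 n) (𝓡 n) (extChartAt (𝓡 n) x₀) ((extChartAt (𝓡 n) x₀).symm y))

/-- The coordinate fields are constant in the trivialization of the tangent bundle at x₀, so the map
is the inverse of that trivialization composed with the inverse chart. -/
lemma continuousOn_coordVec (x₀ : M) :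
    ContinuousOn (fun z : EuclideanSpace ℝ (Fin n) × EuclideanSpace ℝ (Fin n) ↦
      (TotalSpace.mk' (EuclideanSpace ℝ (Fin n)) ((extChartAt (𝓡 n) x₀).symm z.1)
        (coordVec x₀ z.2 z.1) : TotalSpace (EuclideanSpace ℝ (Fin n))
          (TangentSpace (𝓡 n) : M → Type _)))
      ((extChartAt (𝓡 n) x₀).target ×ˢ Set.univ) := by
  have : IsManifold (𝓡 n) 1 M := .of_le (n := ∞) (by simp)
  set t := trivializationAt (EuclideanSpace ℝ (Fin n)) (TangentSpace (𝓡 n) : M → Type _) x₀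
  have hsymm := (continuousOn_extChartAt_symm (I := 𝓡 n) x₀)
  have hmem : ∀ y ∈ (extChartAt (𝓡 n) x₀).target,
      (extChartAt (𝓡 n) x₀).symm y ∈ (chartAt (EuclideanSpace ℝ (Fin n)) x₀).source := fun y hy ↦ by
    rw [← extChartAt_source (𝓡 n)]
    exact (extChartAt (𝓡 n) x₀).map_target hy
  have hbase : t.baseSet = (chartAt (EuclideanSpace ℝ (Fin n)) x₀).source :=
    TangentBundle.trivializationAt_baseSet x₀
  have h1 : ContinuousOn (fun z : EuclideanSpace ℝ (Fin n) × EuclideanSpace ℝ (Fin n) ↦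
      t.toOpenPartialHomeomorph.symm ((extChartAt (𝓡 n) x₀).symm z.1, z.2))
      ((extChartAt (𝓡 n) x₀).target ×ˢ Set.univ) := by
    refine t.toOpenPartialHomeomorph.continuousOn_symm.comp
      ((hsymm.comp continuousOn_fst fun z hz ↦ hz.1).prodMk continuousOn_snd) ?_
    intro z hz
    rw [t.target_eq]
    exact ⟨by rw [hbase]; exact hmem _ hz.1, trivial⟩
  refine h1.congr fun z hz ↦ ?_
  have hb : (extChartAt (𝓡 n) x₀).symm z.1 ∈ t.baseSet := by rw [hbase]; exact hmem _ hz.1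
  change _ = t.toOpenPartialHomeomorph.symm ((extChartAt (𝓡 n) x₀).symm z.1, z.2)
  rw [← t.mk_symm hb]
  change (⟨_, _⟩ : TotalSpace _ _) = ⟨_, _⟩
  congr 1
  have h2 := TangentBundle.symmL_trivializationAt (𝕜 := ℝ) (I := 𝓡 n) (hmem _ hz.1)
  rw [← t.symmL_apply (R := ℝ) hb]
  have h3 := DFunLike.congr_fun h2 z.2
  refine Eq.trans ?_ h3.symm
  rw [(extChartAt (𝓡 n) x₀).right_inv hz.1, ← mfderiv_symm_eq]
  rfl

end Coordinates

/-! ### Comparison of the Riemannian metric with the Euclidean one in a chart. -/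

section Metric

variable {n : ℕ} {M : Type*} [EMetricSpace M] [ChartedSpace (EuclideanSpace ℝ (Fin n)) M]
  [IsManifold (𝓡 n) ∞ M] [RiemannianBundle (fun x : M ↦ TangentSpace (𝓡 n) x)]
  [IsContMDiffRiemannianBundle (𝓡 n) ∞ (EuclideanSpace ℝ (Fin n))
      (fun x : M ↦ TangentSpace (𝓡 n) x)]

variable (n M) in
lemma isContinuousRiemannianBundle_tangent :
    IsContinuousRiemannianBundle (EuclideanSpace ℝ (Fin n))
      (fun x : M ↦ TangentSpace (𝓡 n) x) := by
  obtain ⟨g, hg, hg'⟩ := IsContMDiffRiemannianBundle.exists_contMDiff (IB := 𝓡 n) (n := ∞)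
    (F := EuclideanSpace ℝ (Fin n)) (E := fun x : M ↦ TangentSpace (𝓡 n) x)
  exact ⟨g, hg.continuous, hg'⟩

lemma coordVec_zero (x₀ : M) (y : EuclideanSpace ℝ (Fin n)) : coordVec x₀ 0 y = 0 :=
  map_zero (mfderiv (𝓡 n) (𝓡 n) (extChartAt (𝓡 n) x₀).symm y)

lemma continuousOn_inner_coordVec₂ (x₀ : M) (w' : EuclideanSpace ℝ (Fin n)) :
    ContinuousOn (fun z : EuclideanSpace ℝ (Fin n) × EuclideanSpace ℝ (Fin n) ↦
      (inner ℝ (coordVec x₀ z.2 z.1) (coordVec x₀ w' z.1) : ℝ))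
      ((extChartAt (𝓡 n) x₀).target ×ˢ Set.univ) := by
  have := isContinuousRiemannianBundle_tangent n M
  refine (continuousOn_coordVec x₀).inner_bundle ?_
  exact (continuousOn_coordVec x₀).comp
    (f := fun z : EuclideanSpace ℝ (Fin n) × EuclideanSpace ℝ (Fin n) ↦ (z.1, w'))
    (by fun_prop) fun z hz ↦ ⟨hz.1, trivial⟩

lemma continuousOn_inner_coordVec (x₀ : M) (w w' : EuclideanSpace ℝ (Fin n)) :
    ContinuousOn (fun y ↦ (inner ℝ (coordVec x₀ w y) (coordVec x₀ w' y) : ℝ))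
      (extChartAt (𝓡 n) x₀).target :=
  (continuousOn_inner_coordVec₂ x₀ w').comp
    (f := fun y : EuclideanSpace ℝ (Fin n) ↦ (y, w)) (by fun_prop) fun y hy ↦ ⟨hy, trivial⟩

lemma continuousOn_norm_coordVec (x₀ : M) :
    ContinuousOn (fun z : EuclideanSpace ℝ (Fin n) × EuclideanSpace ℝ (Fin n) ↦
      ‖coordVec x₀ z.2 z.1‖) ((extChartAt (𝓡 n) x₀).target ×ˢ Set.univ) := by
  have := isContinuousRiemannianBundle_tangent n M
  have h0 := continuousOn_coordVec (n := n) x₀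
  have h := h0.inner_bundle h0
  refine h.sqrt.congr fun z _ ↦ ?_
  simp only [real_inner_self_eq_norm_sq]
  rw [Real.sqrt_sq (norm_nonneg _)]

/-- By homogeneity in w it suffices to bound the norm from below on the product of K with the unit
sphere, where it is continuous and positive on a compact set. -/
lemma exists_le_norm_coordVec {x₀ : M} {K : Set (EuclideanSpace ℝ (Fin n))} (hK : IsCompact K)
    (hKT : K ⊆ (extChartAt (𝓡 n) x₀).target) :
    ∃ c > 0, ∀ y ∈ K, ∀ w, c * ‖w‖ ≤ ‖coordVec x₀ w y‖ := by
  have hc : IsCompact (K ×ˢ Metric.sphere (0 : EuclideanSpace ℝ (Fin n)) 1) :=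
    hK.prod (isCompact_sphere 0 1)
  have hcont := (continuousOn_norm_coordVec x₀).mono
    (Set.prod_mono hKT (Set.subset_univ (Metric.sphere (0 : EuclideanSpace ℝ (Fin n)) 1)))
  obtain ⟨c, hc0, hcb⟩ := hc.exists_forall_le' hcont (a := 0) fun z hz ↦ by
    rw [norm_pos_iff]
    intro h0
    have := coordVec_eq_zero (hKT hz.1) h0
    have h1 := hz.2
    rw [this] at h1
    simp at h1
  refine ⟨c, hc0, fun y hy w ↦ ?_⟩
  rcases eq_or_ne w 0 with rfl | hw
  · rw [norm_zero, mul_zero]; exact norm_nonneg _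
  have hw0 : 0 < ‖w‖ := norm_pos_iff.2 hw
  have h1 := hcb (y, ‖w‖⁻¹ • w) ⟨hy, by simp [norm_smul, hw]⟩
  simp only [coordVec_smul, norm_smul, norm_inv, norm_norm] at h1
  rwa [inv_mul_eq_div, le_div_iff₀ hw0] at h1

lemma exists_norm_coordVec_le {x₀ : M} {K : Set (EuclideanSpace ℝ (Fin n))} (hK : IsCompact K)
    (hKT : K ⊆ (extChartAt (𝓡 n) x₀).target) :
    ∃ C > 0, ∀ y ∈ K, ∀ w, ‖coordVec x₀ w y‖ ≤ C * ‖w‖ := by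
  have hc : IsCompact (K ×ˢ Metric.sphere (0 : EuclideanSpace ℝ (Fin n)) 1) :=
    hK.prod (isCompact_sphere 0 1)
  have hcont := (continuousOn_norm_coordVec x₀).mono
    (Set.prod_mono hKT (Set.subset_univ (Metric.sphere (0 : EuclideanSpace ℝ (Fin n)) 1)))
  obtain ⟨C, hC⟩ := hc.exists_bound_of_continuousOn hcont
  refine ⟨|C| + 1, by positivity, fun y hy w ↦ ?_⟩
  rcases eq_or_ne w 0 with rfl | hw
  · rw [coordVec_zero]
    exact norm_zero.le.trans (by positivity)
  have hw0 : 0 < ‖w‖ := norm_pos_iff.2 hw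
  have h1 := hC (y, ‖w‖⁻¹ • w) ⟨hy, by simp [norm_smul, hw]⟩
  simp only [coordVec_smul, norm_smul, norm_inv, norm_norm, norm_mul] at h1
  rw [inv_mul_eq_div, div_le_iff₀ hw0] at h1
  refine h1.trans ?_
  gcongr
  linarith [le_abs_self C]

/-- Near a compact subset of the chart, the metric changes by at most a factor two. -/
lemma exists_norm_coordVec_le_two_mul {x₀ : M} {K : Set (EuclideanSpace ℝ (Fin n))}
    (hK : IsCompact K) (hKT : K ⊆ (extChartAt (𝓡 n) x₀).target) :
    ∃ ε > 0, ∀ y ∈ K, ∀ x ∈ Metric.ball y ε, x ∈ (extChartAt (𝓡 n) x₀).target ∧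
      ∀ w, ‖coordVec x₀ w x‖ ≤ 2 * ‖coordVec x₀ w y‖ := by
  obtain ⟨δ, hδ, hδT⟩ := hK.exists_cthickening_subset_open (isOpen_target x₀) hKT
  obtain ⟨c, hc0, hc⟩ := exists_le_norm_coordVec hK hKT
  have hcomp : IsCompact (Metric.cthickening δ K ×ˢ
      Metric.sphere (0 : EuclideanSpace ℝ (Fin n)) 1) :=
    (hK.cthickening (r := δ)).prod (isCompact_sphere 0 1)
  have hcont := (continuousOn_norm_coordVec x₀).mono
    (Set.prod_mono hδT (Set.subset_univ (Metric.sphere (0 : EuclideanSpace ℝ (Fin n)) 1)))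
  -- The tolerance in the uniform continuity is the lower bound c of the norm over K. An error of c
  -- |w| is then at most the norm of w at y, whence the factor two.
  have huc := Metric.uniformContinuousOn_iff.1 (hcomp.uniformContinuousOn_of_continuous hcont) c hc0
  obtain ⟨ε, hε, hεb⟩ := huc
  refine ⟨min δ ε, lt_min hδ hε, fun y hy x hx ↦ ?_⟩
  have hxy : dist x y < min δ ε := hx
  have hxδ : x ∈ Metric.cthickening δ K :=
    Metric.mem_cthickening_of_dist_le x y δ K hy (hxy.le.trans (min_le_left _ _))
  refine ⟨hδT hxδ, fun w ↦ ?_⟩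
  rcases eq_or_ne w 0 with rfl | hw
  · rw [coordVec_zero]
    exact norm_zero.le.trans (by positivity)
  have hw0 : 0 < ‖w‖ := norm_pos_iff.2 hw
  have hs : ‖w‖⁻¹ • w ∈ Metric.sphere (0 : EuclideanSpace ℝ (Fin n)) 1 := by simp [norm_smul, hw]
  have h1 := hεb (x, ‖w‖⁻¹ • w) ⟨hxδ, hs⟩ (y, ‖w‖⁻¹ • w)
    ⟨Metric.self_subset_cthickening K hy, hs⟩ (by
      rw [Prod.dist_eq]
      simp only [dist_self]
      exact max_lt (hxy.trans_le (min_le_right _ _)) hε)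
  simp only [coordVec_smul, norm_smul, norm_inv, norm_norm] at h1
  rw [Real.dist_eq, ← mul_sub, abs_mul, abs_of_pos (inv_pos.2 hw0), inv_mul_lt_iff₀ hw0] at h1
  have h2 := (abs_lt.1 h1).2
  have h3 := hc y hy w
  linarith

variable [IsRiemannianManifold (𝓡 n) M]

/-- The distance of two points of a chart is at most the length of the coordinate segment. -/
lemma edist_symm_le {x₀ : M} {s : Set (EuclideanSpace ℝ (Fin n))} (hs : Convex ℝ s)
    (hsT : s ⊆ (extChartAt (𝓡 n) x₀).target) {x₁ x₂ : EuclideanSpace ℝ (Fin n)} (h₁ : x₁ ∈ s)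
    (h₂ : x₂ ∈ s) {C : ℝ} (hC : ∀ x ∈ s, ‖coordVec x₀ (x₁ - x₂) x‖ ≤ C) :
    edist ((extChartAt (𝓡 n) x₀).symm x₁) ((extChartAt (𝓡 n) x₀).symm x₂) ≤ ENNReal.ofReal C := by
  have : IsManifold (𝓡 n) 1 M := .of_le (n := ∞) (by simp)
  set γ : ℝ → EuclideanSpace ℝ (Fin n) := fun t ↦ x₂ + t • (x₁ - x₂) with hγ
  have hmaps : ∀ t ∈ Set.Icc (0 : ℝ) 1, γ t ∈ s := fun t ht ↦ by
    have := hs h₂ h₁ (sub_nonneg.2 ht.2) ht.1 (sub_add_cancel 1 t)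
    have h : γ t = (1 - t) • x₂ + t • x₁ := by
      change x₂ + t • (x₁ - x₂) = _
      module
    rwa [h]
  have hγd : ContDiff ℝ 1 γ := by rw [hγ]; fun_prop
  rw [edist_comm, IsRiemannianManifold.out (I := 𝓡 n)]
  have hsm : ContMDiffOn 𝓘(ℝ, ℝ) (𝓡 n) 1 ((extChartAt (𝓡 n) x₀).symm ∘ γ) (Set.Icc 0 1) :=
    (contMDiffOn_extChartAt_symm x₀).comp hγd.contMDiff.contMDiffOn fun t ht ↦ hsT (hmaps t ht)
  have h1 := Manifold.riemannianEDist_le_pathELength hsm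
    (x := (extChartAt (𝓡 n) x₀).symm x₂) (y := (extChartAt (𝓡 n) x₀).symm x₁)
    (by simp [hγ]) (by simp [hγ]) zero_le_one
  refine h1.trans ?_
  rw [Manifold.pathELength_eq_lintegral_mfderiv_Icc]
  have h2 : ∀ t ∈ Set.Icc (0 : ℝ) 1,
      ‖mfderiv 𝓘(ℝ, ℝ) (𝓡 n) ((extChartAt (𝓡 n) x₀).symm ∘ γ) t (1 : ℝ)‖ₑ ≤
        ENNReal.ofReal C := by
    intro t ht
    have hyT := hsT (hmaps t ht)
    have hd1 : MDifferentiableAt (𝓡 n) (𝓡 n) (extChartAt (𝓡 n) x₀).symm (γ t) :=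
      ((contMDiffOn_extChartAt_symm (n := 1) x₀).contMDiffAt
        ((isOpen_target x₀).mem_nhds hyT)).mdifferentiableAt one_ne_zero
    have hd2 : MDifferentiableAt 𝓘(ℝ, ℝ) (𝓡 n) γ t :=
      (hγd.contMDiff t).mdifferentiableAt one_ne_zero
    have hd3 : HasDerivAt γ (x₁ - x₂) t := by
      have := ((hasDerivAt_id t).smul_const (x₁ - x₂)).const_add x₂
      simpa [hγ] using this
    have hd4 : mfderiv 𝓘(ℝ, ℝ) (𝓡 n) γ t (1 : ℝ) = x₁ - x₂ := by
      rw [mfderiv_eq_fderiv]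
      exact (DFunLike.congr_fun hd3.hasFDerivAt.fderiv (1 : ℝ)).trans (by simp)
    rw [mfderiv_comp t hd1 hd2]
    have hd5 : (mfderiv (𝓡 n) (𝓡 n) (extChartAt (𝓡 n) x₀).symm (γ t)
        (mfderiv 𝓘(ℝ, ℝ) (𝓡 n) γ t (1 : ℝ))) = coordVec x₀ (x₁ - x₂) (γ t) := by
      rw [hd4]; rfl
    refine Eq.trans_le (b := ‖coordVec x₀ (x₁ - x₂) (γ t)‖ₑ) ?_ ?_
    · rw [← hd5]; rfl
    · rw [← ofReal_norm]
      exact ENNReal.ofReal_le_ofReal (hC _ (hmaps t ht))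
  calc _ ≤ ∫⁻ _ in Set.Icc (0 : ℝ) 1, ENNReal.ofReal C :=
        setLIntegral_mono' measurableSet_Icc h2
    _ = ENNReal.ofReal C := by simp

end Metric

/-! ### The Riemannian volume in a chart. -/

section ChartVolume

variable {n : ℕ} {M : Type*} [EMetricSpace M] [ChartedSpace (EuclideanSpace ℝ (Fin n)) M]
  [IsManifold (𝓡 n) ∞ M] [RiemannianBundle (fun x : M ↦ TangentSpace (𝓡 n) x)]

/-- The metric tensor at `x` as a function of two vectors of the model space. -/
def metricAt (x : M) (v w : EuclideanSpace ℝ (Fin n)) : ℝ :=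
  inner ℝ (show TangentSpace (𝓡 n) x from v) (show TangentSpace (𝓡 n) x from w)

/-- The metric tensor in the chart at `x₀`. -/
def metricForm (x₀ : M) (y : EuclideanSpace ℝ (Fin n)) :
    LinearMap.BilinForm ℝ (EuclideanSpace ℝ (Fin n)) :=
  LinearMap.mk₂ ℝ (fun v w ↦ inner ℝ (coordVec x₀ v y) (coordVec x₀ w y))
    (fun v v' w ↦ by rw [coordVec_add, inner_add_left])
    (fun c v w ↦ by rw [coordVec_smul, real_inner_smul_left]; rfl)
    (fun v w w' ↦ by rw [coordVec_add, inner_add_right])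
    (fun c v w ↦ by rw [coordVec_smul, real_inner_smul_right]; rfl)

lemma volDensity_eq (x₀ : M) (y : EuclideanSpace ℝ (Fin n)) :
    volDensity x₀ y = √(Matrix.det (LinearMap.BilinForm.toMatrix
      (EuclideanSpace.basisFun (Fin n) ℝ).toBasis (metricForm x₀ y))) := by
  unfold volDensity
  congr 2

/-- The transition map between the charts at `x₁` and `x₀`. -/
def transition (x₁ x₀ : M) : EuclideanSpace ℝ (Fin n) → EuclideanSpace ℝ (Fin n) :=
  extChartAt (𝓡 n) x₀ ∘ (extChartAt (𝓡 n) x₁).symm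

lemma mdifferentiableAt_symm {x₀ : M} {y : EuclideanSpace ℝ (Fin n)}
    (hy : y ∈ (extChartAt (𝓡 n) x₀).target) :
    MDifferentiableAt (𝓡 n) (𝓡 n) (extChartAt (𝓡 n) x₀).symm y :=
  ((contMDiffOn_extChartAt_symm (n := ∞) x₀).contMDiffAt
    ((isOpen_target x₀).mem_nhds hy)).mdifferentiableAt (by simp)

lemma differentiableAt_transition {x₁ x₀ : M} {y : EuclideanSpace ℝ (Fin n)}
    (hy : y ∈ (extChartAt (𝓡 n) x₁).target)
    (hy' : (extChartAt (𝓡 n) x₁).symm y ∈ (extChartAt (𝓡 n) x₀).source) :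
    DifferentiableAt ℝ (transition x₁ x₀) y := by
  rw [← mdifferentiableAt_iff_differentiableAt]
  refine MDifferentiableAt.comp (I' := 𝓡 n) y ?_ (mdifferentiableAt_symm hy)
  rw [extChartAt_source] at hy'
  exact (contMDiffAt_extChartAt' (n := ∞) hy').mdifferentiableAt (by simp)

/-- The chain rule. The equality is stated in the model space because the base points of the two
vectors agree only propositionally. -/
lemma coordVec_transition {x₁ x₀ : M} {y : EuclideanSpace ℝ (Fin n)}
    (hy : y ∈ (extChartAt (𝓡 n) x₁).target)
    (hy' : (extChartAt (𝓡 n) x₁).symm y ∈ (extChartAt (𝓡 n) x₀).source)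
    (w : EuclideanSpace ℝ (Fin n)) :
    (coordVec x₁ w y : EuclideanSpace ℝ (Fin n)) =
      coordVec x₀ (fderiv ℝ (transition x₁ x₀) y w) (transition x₁ x₀ y) := by
  have hT : transition x₁ x₀ y ∈ (extChartAt (𝓡 n) x₀).target :=
    (extChartAt (𝓡 n) x₀).map_source hy'
  have hev : (extChartAt (𝓡 n) x₁).symm =ᶠ[𝓝 y]
      (extChartAt (𝓡 n) x₀).symm ∘ transition x₁ x₀ := by
    have hc : ContinuousAt (extChartAt (𝓡 n) x₁).symm y := continuousAt_extChartAt_symm'' hy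
    filter_upwards [hc.preimage_mem_nhds
      ((isOpen_extChartAt_source (I := 𝓡 n) x₀).mem_nhds hy')] with z hz
    exact ((extChartAt (𝓡 n) x₀).left_inv hz).symm
  have h1 := mfderiv_comp (I := 𝓡 n) (I' := 𝓡 n) (I'' := 𝓡 n) y (mdifferentiableAt_symm hT)
    (mdifferentiableAt_iff_differentiableAt.2 (differentiableAt_transition hy hy'))
  rw [mfderiv_eq_fderiv] at h1
  have h2 : HasMFDerivAt (𝓡 n) (𝓡 n) (extChartAt (𝓡 n) x₁).symm y _ :=
    (mdifferentiableAt_symm hy).hasMFDerivAt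
  have h3 := ((mdifferentiableAt_symm hT).hasMFDerivAt.comp (I := 𝓡 n) y
    (differentiableAt_transition hy hy').hasFDerivAt.hasMFDerivAt).congr_of_eventuallyEq hev
  exact DFunLike.congr_fun (hasMFDerivAt_unique h2 h3) w

lemma metricForm_transition {x₁ x₀ : M} {y : EuclideanSpace ℝ (Fin n)}
    (hy : y ∈ (extChartAt (𝓡 n) x₁).target)
    (hy' : (extChartAt (𝓡 n) x₁).symm y ∈ (extChartAt (𝓡 n) x₀).source) :
    metricForm x₁ y = (metricForm x₀ (transition x₁ x₀ y)).comp
      (fderiv ℝ (transition x₁ x₀) y).toLinearMap (fderiv ℝ (transition x₁ x₀) y).toLinearMap := by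
  refine LinearMap.ext₂ fun v w ↦ ?_
  -- With the base point as an explicit argument of `metricAt`, the vectors can be rewritten first
  -- and the base points identified afterwards.
  change metricAt ((extChartAt (𝓡 n) x₁).symm y) (coordVec x₁ v y) (coordVec x₁ w y) =
    metricAt ((extChartAt (𝓡 n) x₀).symm (transition x₁ x₀ y))
      (coordVec x₀ (fderiv ℝ (transition x₁ x₀) y v) (transition x₁ x₀ y))
      (coordVec x₀ (fderiv ℝ (transition x₁ x₀) y w) (transition x₁ x₀ y))
  rw [← coordVec_transition hy hy', ← coordVec_transition hy hy']
  congr 1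
  exact ((extChartAt (𝓡 n) x₀).left_inv hy').symm

/-- The Gram matrix transforms as JᵀGJ with J the Jacobian of the transition map, so the root of its
determinant acquires the factor |det J|. -/
lemma volDensity_transition {x₁ x₀ : M} {y : EuclideanSpace ℝ (Fin n)}
    (hy : y ∈ (extChartAt (𝓡 n) x₁).target)
    (hy' : (extChartAt (𝓡 n) x₁).symm y ∈ (extChartAt (𝓡 n) x₀).source) :
    volDensity x₁ y =
      |(fderiv ℝ (transition x₁ x₀) y).det| * volDensity x₀ (transition x₁ x₀ y) := by
  rw [volDensity_eq, volDensity_eq, metricForm_transition hy hy',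
    LinearMap.BilinForm.toMatrix_comp (EuclideanSpace.basisFun (Fin n) ℝ).toBasis,
    Matrix.det_mul, Matrix.det_mul, Matrix.det_transpose, LinearMap.det_toMatrix,
    ContinuousLinearMap.det, ← Real.sqrt_sq_eq_abs, ← Real.sqrt_mul (sq_nonneg _)]
  congr 1
  ring

lemma volDensity_pos {x₀ : M} {y : EuclideanSpace ℝ (Fin n)}
    (hy : y ∈ (extChartAt (𝓡 n) x₀).target) : 0 < volDensity x₀ y := by
  have h : (Matrix.of fun i j : Fin n ↦ inner ℝ (coordVec x₀ (EuclideanSpace.single i 1) y)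
      (coordVec x₀ (EuclideanSpace.single j 1) y)) =
      Matrix.gram ℝ (fun i ↦ coordVec x₀ (EuclideanSpace.single i 1) y) := rfl
  refine Real.sqrt_pos.2 (lt_of_le_of_ne ?_ (Ne.symm ?_))
  · rw [h]
    exact (Matrix.posSemidef_gram ℝ _).det_nonneg
  · rw [h, Matrix.det_gram_ne_zero_iff_linearIndependent]
    have h1 := (EuclideanSpace.basisFun (Fin n) ℝ).toBasis.linearIndependent
    have h2 := h1.map' (mfderiv (𝓡 n) (𝓡 n) (extChartAt (𝓡 n) x₀).symm y).toLinearMap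
      (LinearMap.ker_eq_bot'.2 fun w hw ↦ coordVec_eq_zero hy hw)
    have e : (fun i ↦ coordVec x₀ (EuclideanSpace.single i 1) y) =
        fun i ↦ coordVec x₀ ((EuclideanSpace.basisFun (Fin n) ℝ).toBasis i) y := by
      funext i
      rw [OrthonormalBasis.coe_toBasis, EuclideanSpace.basisFun_apply]
    rw [e]
    exact h2

variable [IsContMDiffRiemannianBundle (𝓡 n) ∞ (EuclideanSpace ℝ (Fin n))
      (fun x : M ↦ TangentSpace (𝓡 n) x)]

lemma continuousOn_volDensity (x₀ : M) :
    ContinuousOn (volDensity (n := n) x₀) (extChartAt (𝓡 n) x₀).target := by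
  refine ContinuousOn.sqrt ?_
  rw [continuousOn_iff_continuous_domRestrict]
  refine Continuous.matrix_det (continuous_matrix fun i j ↦ ?_)
  exact continuousOn_iff_continuous_domRestrict.1 (continuousOn_inner_coordVec x₀ _ _)

variable [MeasurableSpace M] [BorelSpace M]

lemma aemeasurable_volDensity (x₀ : M) :
    AEMeasurable (fun y ↦ ENNReal.ofReal (volDensity (n := n) x₀ y))
      (volume.restrict (extChartAt (𝓡 n) x₀).target) :=
  ((continuousOn_volDensity x₀).aemeasurable (isOpen_target x₀).measurableSet).ennreal_ofReal

lemma measurableSet_target (x₀ : M) : MeasurableSet (extChartAt (𝓡 n) x₀).target :=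
  (isOpen_target x₀).measurableSet

lemma measurableSet_source (x₀ : M) : MeasurableSet (extChartAt (𝓡 n) x₀).source :=
  (isOpen_extChartAt_source x₀).measurableSet

lemma aemeasurable_symm (x₀ : M) : AEMeasurable (extChartAt (𝓡 n) x₀).symm
      (volume.restrict (extChartAt (𝓡 n) x₀).target) :=
  (continuousOn_extChartAt_symm (I := 𝓡 n) x₀).aemeasurable (measurableSet_target x₀)

lemma measurableSet_target_inter_preimage (x₀ : M) {A : Set M} (hA : MeasurableSet A) :
    MeasurableSet ((extChartAt (𝓡 n) x₀).target ∩ (extChartAt (𝓡 n) x₀).symm ⁻¹' A) := by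
  have h := (continuousOn_extChartAt_symm (I := 𝓡 n) x₀).domRestrict.measurable hA
  have h2 := (MeasurableEmbedding.subtype_coe (measurableSet_target x₀)).measurableSet_image.2 h
  convert h2 using 1
  ext y
  simp [and_comm]

lemma chartVolume_apply (x₀ : M) {A : Set M} (hA : MeasurableSet A) :
    chartVolume (n := n) x₀ A = ∫⁻ y in (extChartAt (𝓡 n) x₀).target ∩
      (extChartAt (𝓡 n) x₀).symm ⁻¹' A, ENNReal.ofReal (volDensity x₀ y) := by
  have hT := measurableSet_target (n := n) x₀
  have hm := measurableSet_target_inter_preimage (n := n) x₀ hA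
  have hac := withDensity_absolutelyContinuous
    (volume.restrict (extChartAt (𝓡 n) x₀).target)
    (fun y ↦ ENNReal.ofReal (volDensity (n := n) x₀ y))
  rw [chartVolume, Measure.map_apply_of_aemeasurable ((aemeasurable_symm x₀).mono_ac hac) hA,
    ← restrict_withDensity hT, Measure.restrict_apply₀', Set.inter_comm, withDensity_apply _ hm]
  exact hT.nullMeasurableSet

/-- The change of variables formula along the transition map: its Jacobian factor is the one by
which the densities differ. -/
lemma chartVolume_eq_of_subset (x₁ x₀ : M) {A : Set M} (hA : MeasurableSet A)
    (h₁ : A ⊆ (extChartAt (𝓡 n) x₁).source) (h₀ : A ⊆ (extChartAt (𝓡 n) x₀).source) :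
    chartVolume (n := n) x₁ A = chartVolume (n := n) x₀ A := by
  rw [chartVolume_apply x₁ hA, chartVolume_apply x₀ hA]
  set B₁ := (extChartAt (𝓡 n) x₁).target ∩ (extChartAt (𝓡 n) x₁).symm ⁻¹' A
  have hB : (extChartAt (𝓡 n) x₀).target ∩ (extChartAt (𝓡 n) x₀).symm ⁻¹' A =
      transition x₁ x₀ '' B₁ := by
    ext y
    constructor
    · rintro ⟨hy, hyA⟩
      refine ⟨extChartAt (𝓡 n) x₁ ((extChartAt (𝓡 n) x₀).symm y),
        ⟨(extChartAt (𝓡 n) x₁).map_source (h₁ hyA), ?_⟩, ?_⟩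
      · rw [Set.mem_preimage, (extChartAt (𝓡 n) x₁).left_inv (h₁ hyA)]
        exact hyA
      · rw [transition, Function.comp_apply, (extChartAt (𝓡 n) x₁).left_inv (h₁ hyA),
          (extChartAt (𝓡 n) x₀).right_inv hy]
    · rintro ⟨z, ⟨hz, hzA⟩, rfl⟩
      refine ⟨(extChartAt (𝓡 n) x₀).map_source (h₀ hzA), ?_⟩
      rw [Set.mem_preimage, transition, Function.comp_apply,
        (extChartAt (𝓡 n) x₀).left_inv (h₀ hzA)]
      exact hzA
  have hinj : Set.InjOn (transition x₁ x₀) B₁ := fun y hy z hz hyz ↦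
    (extChartAt (𝓡 n) x₁).symm.injOn hy.1 hz.1
      ((extChartAt (𝓡 n) x₀).injOn (h₀ hy.2) (h₀ hz.2) hyz)
  rw [hB, lintegral_image_eq_lintegral_abs_det_fderiv_mul volume
    (measurableSet_target_inter_preimage x₁ hA)
    (fun y hy ↦ (differentiableAt_transition hy.1 (h₀ hy.2)).hasFDerivAt.hasFDerivWithinAt) hinj]
  refine setLIntegral_congr_fun (measurableSet_target_inter_preimage x₁ hA) fun y hy ↦ ?_
  rw [volDensity_transition hy.1 (h₀ hy.2), ENNReal.ofReal_mul (abs_nonneg _)]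

lemma chartVolume_compl_source (x₀ : M) :
    chartVolume (n := n) x₀ (extChartAt (𝓡 n) x₀).sourceᶜ = 0 := by
  rw [chartVolume_apply x₀ (measurableSet_source x₀).compl]
  have : (extChartAt (𝓡 n) x₀).target ∩
      (extChartAt (𝓡 n) x₀).symm ⁻¹' (extChartAt (𝓡 n) x₀).sourceᶜ = ∅ := by
    ext y
    simp only [Set.mem_inter_iff, Set.mem_preimage, Set.mem_compl_iff, Set.mem_empty_iff_false,
      iff_false, not_and, not_not]
    exact fun hy ↦ (extChartAt (𝓡 n) x₀).map_target hy
  rw [this, Measure.restrict_empty, lintegral_zero_measure]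

lemma chartVolume_restrict_source (x₀ : M) :
    (chartVolume (n := n) x₀).restrict (extChartAt (𝓡 n) x₀).source = chartVolume (n := n) x₀ :=
  Measure.restrict_eq_self_of_ae_mem (chartVolume_compl_source (n := n) x₀)

/-- The Riemannian volume restricts to the chart volume on each chart domain. -/
lemma riemannianVolume_restrict_source (x₀ : M) :
    (riemannianVolume n M).restrict (extChartAt (𝓡 n) x₀).source = chartVolume (n := n) x₀ := by
  have hS := measurableSet_source (n := n) x₀
  refine le_antisymm ?_ ?_
  · have h : riemannianVolume n M ≤ chartVolume (n := n) x₀ +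
        (riemannianVolume n M).restrict (extChartAt (𝓡 n) x₀).sourceᶜ := by
      refine iSup_le fun x₁ ↦ ?_
      have hle : chartVolume (n := n) x₁ ≤ riemannianVolume n M :=
        le_iSup (fun x : M ↦ chartVolume (n := n) x) x₁
      rw [← Measure.restrict_add_restrict_compl (μ := chartVolume (n := n) x₁) hS]
      refine add_le_add ?_ (Measure.restrict_mono le_rfl hle)
      refine Measure.le_iff.2 fun A hA ↦ ?_
      rw [Measure.restrict_apply hA, ← chartVolume_restrict_source (n := n) x₁,
        Measure.restrict_apply (hA.inter hS),
        chartVolume_eq_of_subset x₁ x₀ ((hA.inter hS).inter (measurableSet_source x₁))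
          Set.inter_subset_right (Set.inter_subset_left.trans Set.inter_subset_right)]
      exact measure_mono (Set.inter_subset_left.trans Set.inter_subset_left)
    refine (Measure.restrict_mono le_rfl h).trans ?_
    rw [Measure.restrict_add, Measure.restrict_restrict hS, Set.inter_compl_self,
      Measure.restrict_empty, add_zero, chartVolume_restrict_source]
  · rw [← chartVolume_restrict_source (n := n) x₀]
    have hle : chartVolume (n := n) x₀ ≤ riemannianVolume n M :=
      le_iSup (fun x : M ↦ chartVolume (n := n) x) x₀
    exact Measure.restrict_mono le_rfl hle

end ChartVolume

/-! ### The weighted volume in coordinates. -/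

section WeightedVolume

variable {n : ℕ} {M : Type*} [EMetricSpace M] [ChartedSpace (EuclideanSpace ℝ (Fin n)) M]
  [IsManifold (𝓡 n) ∞ M] [RiemannianBundle (fun x : M ↦ TangentSpace (𝓡 n) x)]
  [IsContMDiffRiemannianBundle (𝓡 n) ∞ (EuclideanSpace ℝ (Fin n))
      (fun x : M ↦ TangentSpace (𝓡 n) x)]

/-- The density of the weighted volume in the chart at `x₀`. -/
def weightDensity (φ : M → ℝ) (x₀ : M) (y : EuclideanSpace ℝ (Fin n)) : ℝ :=
  volDensity x₀ y * Real.exp (-φ ((extChartAt (𝓡 n) x₀).symm y))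

lemma weightDensity_pos (φ : M → ℝ) {x₀ : M} {y : EuclideanSpace ℝ (Fin n)}
    (hy : y ∈ (extChartAt (𝓡 n) x₀).target) : 0 < weightDensity φ x₀ y :=
  mul_pos (volDensity_pos hy) (Real.exp_pos _)

lemma continuousOn_weightDensity {φ : M → ℝ} (hφ : Continuous φ) (x₀ : M) :
    ContinuousOn (weightDensity (n := n) φ x₀) (extChartAt (𝓡 n) x₀).target :=
  (continuousOn_volDensity x₀).mul
    (Real.continuous_exp.comp_continuousOn
      (hφ.comp_continuousOn (continuousOn_extChartAt_symm (I := 𝓡 n) x₀)).neg)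

/-- The weighted volume in the coordinates of the chart at `x₀`. -/
def coordMeasure (φ : M → ℝ) (x₀ : M) : Measure (EuclideanSpace ℝ (Fin n)) :=
  (volume.restrict (extChartAt (𝓡 n) x₀).target).withDensity
    fun y ↦ ENNReal.ofReal (weightDensity φ x₀ y)

lemma coordMeasure_absolutelyContinuous (φ : M → ℝ) (x₀ : M) :
    coordMeasure (n := n) φ x₀ ≪ volume.restrict (extChartAt (𝓡 n) x₀).target :=
  withDensity_absolutelyContinuous _ _

variable [MeasurableSpace M] [BorelSpace M]

lemma aemeasurable_weightDensity {φ : M → ℝ} (hφ : Continuous φ) (x₀ : M) :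
    AEMeasurable (weightDensity (n := n) φ x₀)
      (volume.restrict (extChartAt (𝓡 n) x₀).target) :=
  (continuousOn_weightDensity hφ x₀).aemeasurable (measurableSet_target x₀)

lemma absolutelyContinuous_coordMeasure {φ : M → ℝ} (hφ : Continuous φ) (x₀ : M) :
    volume.restrict (extChartAt (𝓡 n) x₀).target ≪ coordMeasure (n := n) φ x₀ := by
  refine withDensity_absolutelyContinuous' (aemeasurable_weightDensity hφ x₀).ennreal_ofReal ?_
  filter_upwards [ae_restrict_mem (measurableSet_target x₀)] with y hy
  exact (ENNReal.ofReal_pos.2 (weightDensity_pos φ hy)).ne'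

lemma map_withDensity {α β : Type*} [MeasurableSpace α] [MeasurableSpace β] {ν : Measure α}
    {f : α → β} (hf : AEMeasurable f ν) {w : β → ℝ≥0∞} (hw : Measurable w) :
    (ν.map f).withDensity w = (ν.withDensity (w ∘ f)).map f := by
  ext A hA
  rw [withDensity_apply _ hA, Measure.map_apply_of_aemeasurable
    (hf.mono_ac (withDensity_absolutelyContinuous _ _)) hA,
    Measure.restrict_map_of_aemeasurable hf hA, lintegral_map' hw.aemeasurable hf.restrict,
    withDensity_apply₀ _ (hf.nullMeasurableSet_preimage hA)]
  rfl

lemma weightedVolume_restrict_source {φ : M → ℝ} (hφ : Continuous φ) (x₀ : M) :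
    (weightedVolume n φ).restrict (extChartAt (𝓡 n) x₀).source =
      (coordMeasure φ x₀).map (extChartAt (𝓡 n) x₀).symm := by
  have hw : Measurable fun x : M ↦ ENNReal.ofReal (Real.exp (-φ x)) := by
    have := hφ.measurable
    fun_prop
  rw [weightedVolume, restrict_withDensity (measurableSet_source x₀),
    riemannianVolume_restrict_source, chartVolume,
    map_withDensity ((aemeasurable_symm x₀).mono_ac (withDensity_absolutelyContinuous _ _)) hw,
    ← withDensity_mul₀ (aemeasurable_volDensity x₀)
      (hw.comp_aemeasurable (aemeasurable_symm x₀)), coordMeasure]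
  congr 2
  funext y
  rw [weightDensity, ENNReal.ofReal_mul (p := volDensity x₀ y) (Real.sqrt_nonneg _)]
  rfl

lemma aemeasurable_symm_coordMeasure (φ : M → ℝ) (x₀ : M) :
    AEMeasurable (extChartAt (𝓡 n) x₀).symm (coordMeasure (n := n) φ x₀) :=
  (aemeasurable_symm x₀).mono_ac (coordMeasure_absolutelyContinuous φ x₀)

/-- The chart and its inverse are measurable on their domains, and the weighted volume in
coordinates has the null sets of Lebesgue measure because its density is positive. -/
lemma aestronglyMeasurable_restrict_source_iff {φ : M → ℝ} (hφ : Continuous φ) (x₀ : M)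
    {F : M → ℝ} :
    AEStronglyMeasurable F ((weightedVolume n φ).restrict (extChartAt (𝓡 n) x₀).source) ↔
      AEStronglyMeasurable (F ∘ (extChartAt (𝓡 n) x₀).symm)
        (volume.restrict (extChartAt (𝓡 n) x₀).target) := by
  have hs := aemeasurable_symm_coordMeasure (n := n) φ x₀
  have hch : AEMeasurable (extChartAt (𝓡 n) x₀)
      ((weightedVolume n φ).restrict (extChartAt (𝓡 n) x₀).source) :=
    (continuousOn_extChartAt (I := 𝓡 n) x₀).aemeasurable (measurableSet_source x₀)
  constructor
  · intro h
    rw [weightedVolume_restrict_source hφ] at h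
    exact (h.comp_aemeasurable hs).mono_ac (absolutelyContinuous_coordMeasure hφ x₀)
  · intro h
    have h1 := h.mono_ac (coordMeasure_absolutelyContinuous φ x₀)
    have hid : (coordMeasure (n := n) φ x₀).map
        (extChartAt (𝓡 n) x₀ ∘ (extChartAt (𝓡 n) x₀).symm) = coordMeasure (n := n) φ x₀ := by
      have : extChartAt (𝓡 n) x₀ ∘ (extChartAt (𝓡 n) x₀).symm =ᵐ[coordMeasure (n := n) φ x₀] id :=
        (coordMeasure_absolutelyContinuous φ x₀).ae_le
          ((ae_restrict_mem (measurableSet_target x₀)).mono fun y hy ↦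
            (extChartAt (𝓡 n) x₀).right_inv hy)
      rw [Measure.map_congr this, Measure.map_id]
    rw [← hid, ← AEMeasurable.map_map_of_aemeasurable
      (by rw [← weightedVolume_restrict_source hφ]; exact hch) hs,
      ← weightedVolume_restrict_source hφ] at h1
    refine (h1.comp_aemeasurable hch).congr ?_
    filter_upwards [ae_restrict_mem (measurableSet_source x₀)] with x hx
    simp only [Function.comp_apply, (extChartAt (𝓡 n) x₀).left_inv hx]

lemma aestronglyMeasurable_of_chart [SecondCountableTopology M] {φ : M → ℝ} (hφ : Continuous φ)
    {F : M → ℝ} (h : ∀ x₀ : M, AEStronglyMeasurable (F ∘ (extChartAt (𝓡 n) x₀).symm)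
        (volume.restrict (extChartAt (𝓡 n) x₀).target)) :
    AEStronglyMeasurable F (weightedVolume n φ) := by
  obtain ⟨s, hs, hcov⟩ := TopologicalSpace.countable_cover_nhds
    (fun x : M ↦ extChartAt_source_mem_nhds (I := 𝓡 n) x)
  have := hs.to_subtype
  rw [Set.biUnion_eq_iUnion] at hcov
  rw [← Measure.restrict_univ (μ := weightedVolume n φ), ← hcov]
  exact aestronglyMeasurable_iUnion_iff.2 fun x ↦
    (aestronglyMeasurable_restrict_source_iff hφ x.1).2 (h x.1)

/-- No measurability of F is required: a non-measurable F stays non-measurable in the chart, and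
then both integrals are zero by convention. -/
lemma setIntegral_source {φ : M → ℝ} (hφ : Continuous φ) (x₀ : M) (F : M → ℝ) :
    ∫ x in (extChartAt (𝓡 n) x₀).source, F x ∂(weightedVolume n φ) =
      ∫ y in (extChartAt (𝓡 n) x₀).target,
        F ((extChartAt (𝓡 n) x₀).symm y) * weightDensity φ x₀ y := by
  have hs := aemeasurable_symm_coordMeasure (n := n) φ x₀
  have h1 : ∫ x in (extChartAt (𝓡 n) x₀).source, F x ∂(weightedVolume n φ) =
      ∫ y, F ((extChartAt (𝓡 n) x₀).symm y) ∂(coordMeasure φ x₀) := by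
    by_cases hF : AEStronglyMeasurable F
        ((weightedVolume n φ).restrict (extChartAt (𝓡 n) x₀).source)
    · rw [weightedVolume_restrict_source hφ] at hF ⊢
      exact integral_map hs hF
    · rw [integral_non_aestronglyMeasurable hF, integral_non_aestronglyMeasurable]
      intro h
      exact hF ((aestronglyMeasurable_restrict_source_iff hφ x₀).2
        (h.mono_ac (absolutelyContinuous_coordMeasure hφ x₀)))
  rw [h1, coordMeasure, integral_withDensity_eq_integral_toReal_smul₀
    (aemeasurable_weightDensity hφ x₀).ennreal_ofReal (ae_of_all _ fun _ ↦ ENNReal.ofReal_lt_top)]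
  refine setIntegral_congr_fun (measurableSet_target x₀) fun y hy ↦ ?_
  simp only [smul_eq_mul]
  rw [ENNReal.toReal_ofReal (weightDensity_pos φ hy).le, mul_comm]

lemma integral_eq_setIntegral_chart {φ : M → ℝ} (hφ : Continuous φ) (x₀ : M)
    {K : Set (EuclideanSpace ℝ (Fin n))} (hKT : K ⊆ (extChartAt (𝓡 n) x₀).target) {F : M → ℝ}
    (hF : ∀ x, F x ≠ 0 → x ∈ (extChartAt (𝓡 n) x₀).symm '' K) :
    ∫ x, F x ∂(weightedVolume n φ) =
      ∫ y in K, F ((extChartAt (𝓡 n) x₀).symm y) * weightDensity φ x₀ y := by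
  rw [← setIntegral_eq_integral_of_forall_compl_eq_zero
    (s := (extChartAt (𝓡 n) x₀).source) fun x hx ↦ ?_, setIntegral_source hφ]
  · refine setIntegral_eq_of_subset_of_forall_sdiff_eq_zero (measurableSet_target x₀) hKT
      fun y hy ↦ ?_
    by_contra h0
    obtain ⟨z, hz, hzy⟩ := hF _ (left_ne_zero_of_mul h0)
    rw [(extChartAt (𝓡 n) x₀).symm.injOn (hKT hz) hy.1 hzy] at hz
    exact hy.2 hz
  · by_contra h0
    obtain ⟨z, hz, rfl⟩ := hF _ h0
    exact hx ((extChartAt (𝓡 n) x₀).map_target (hKT hz))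

/-- The density is bounded below on compact sets. This transfers integrability on the manifold to
Lebesgue measure in the chart. -/
lemma volume_restrict_le_smul_coordMeasure {φ : M → ℝ} (hφ : Continuous φ) {x₀ : M}
    {K : Set (EuclideanSpace ℝ (Fin n))} (hK : IsCompact K)
    (hKT : K ⊆ (extChartAt (𝓡 n) x₀).target) :
    ∃ C : ℝ≥0∞, C ≠ ⊤ ∧ volume.restrict K ≤ C • coordMeasure φ x₀ := by
  obtain ⟨c, hc0, hc⟩ := hK.exists_forall_le' ((continuousOn_weightDensity hφ x₀).mono hKT)
    (a := 0) fun y hy ↦ weightDensity_pos φ (hKT hy)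
  have hc0' := ENNReal.ofReal_pos.2 hc0
  refine ⟨(ENNReal.ofReal c)⁻¹, ENNReal.inv_ne_top.2 hc0'.ne', Measure.le_iff.2 fun A hA ↦ ?_⟩
  rw [Measure.smul_apply, smul_eq_mul, coordMeasure, withDensity_apply _ hA,
    Measure.restrict_restrict hA, Measure.restrict_apply hA, mul_comm, ← div_eq_mul_inv,
    ENNReal.le_div_iff_mul_le (Or.inl hc0'.ne') (Or.inl ENNReal.ofReal_ne_top), mul_comm]
  calc ENNReal.ofReal c * volume (A ∩ K) = ∫⁻ _ in A ∩ K, ENNReal.ofReal c := by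
        rw [setLIntegral_const]
    _ ≤ ∫⁻ y in A ∩ K, ENNReal.ofReal (weightDensity φ x₀ y) :=
        setLIntegral_mono' (hA.inter hK.measurableSet)
          fun y hy ↦ ENNReal.ofReal_le_ofReal (hc y hy.2)
    _ ≤ _ := lintegral_mono_set (Set.inter_subset_inter_right _ hKT)

lemma memLp_comp_symm {φ : M → ℝ} (hφ : Continuous φ) {x₀ : M}
    {K : Set (EuclideanSpace ℝ (Fin n))} (hK : IsCompact K)
    (hKT : K ⊆ (extChartAt (𝓡 n) x₀).target) {F : M → ℝ} {r : ℝ≥0∞}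
    (hF : MemLp F r (weightedVolume n φ)) :
    MemLp (fun y ↦ F ((extChartAt (𝓡 n) x₀).symm y)) r (volume.restrict K) := by
  obtain ⟨C, hC, hle⟩ := volume_restrict_le_smul_coordMeasure hφ hK hKT
  have h1 := hF.restrict (extChartAt (𝓡 n) x₀).source
  rw [weightedVolume_restrict_source hφ] at h1
  exact (h1.comp_of_map (aemeasurable_symm_coordMeasure φ x₀)).of_measure_le_smul hC hle

lemma weightedVolume_image_lt_top {φ : M → ℝ} (hφ : Continuous φ) {x₀ : M}
    {K : Set (EuclideanSpace ℝ (Fin n))} (hK : IsCompact K)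
    (hKT : K ⊆ (extChartAt (𝓡 n) x₀).target) :
    weightedVolume n φ ((extChartAt (𝓡 n) x₀).symm '' K) < ⊤ := by
  have hc : IsCompact ((extChartAt (𝓡 n) x₀).symm '' K) :=
    hK.image_of_continuousOn ((continuousOn_extChartAt_symm (I := 𝓡 n) x₀).mono hKT)
  have hsub : (extChartAt (𝓡 n) x₀).symm '' K ⊆ (extChartAt (𝓡 n) x₀).source := by
    rintro _ ⟨y, hy, rfl⟩
    exact (extChartAt (𝓡 n) x₀).map_target (hKT hy)
  rw [← Measure.restrict_eq_self _ hsub, weightedVolume_restrict_source hφ,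
    Measure.map_apply_of_aemeasurable (aemeasurable_symm_coordMeasure φ x₀) hc.measurableSet,
    coordMeasure, withDensity_apply₀, Measure.restrict_restrict₀]
  · have hpre : (extChartAt (𝓡 n) x₀).symm ⁻¹' ((extChartAt (𝓡 n) x₀).symm '' K) ∩
        (extChartAt (𝓡 n) x₀).target = K := by
      ext y
      constructor
      · rintro ⟨⟨z, hz, hzy⟩, hy⟩
        rwa [← (extChartAt (𝓡 n) x₀).symm.injOn (hKT hz) hy hzy]
      · exact fun hy ↦ ⟨⟨y, hy, rfl⟩, hKT hy⟩
    rw [hpre]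
    have hint := ((continuousOn_weightDensity hφ x₀).mono hKT).integrableOn_compact
      (μ := volume) hK
    exact hint.lintegral_lt_top
  all_goals exact (aemeasurable_symm x₀).nullMeasurableSet_preimage hc.measurableSet

lemma isLocallyFiniteMeasure_weightedVolume {φ : M → ℝ} (hφ : Continuous φ) :
    IsLocallyFiniteMeasure (weightedVolume n φ) := by
  refine ⟨fun x ↦ ?_⟩
  obtain ⟨K, hK, hKT, hKc⟩ := exists_compact_subset (isOpen_target (n := n) x)
    (mem_extChartAt_target (I := 𝓡 n) x)
  refine ⟨_, ?_, weightedVolume_image_lt_top hφ hK hKc⟩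
  have h1 : (extChartAt (𝓡 n) x) ⁻¹' K ∈ 𝓝 x :=
    (continuousAt_extChartAt (I := 𝓡 n) x).preimage_mem_nhds (mem_interior_iff_mem_nhds.1 hKT)
  filter_upwards [h1, extChartAt_source_mem_nhds (I := 𝓡 n) x] with z hz hzs
  exact ⟨_, hz, (extChartAt (𝓡 n) x).left_inv hzs⟩

lemma ae_weightedVolume_iff {φ : M → ℝ} (hφ : Continuous φ) {P : M → Prop} :
    (∀ᵐ x ∂(weightedVolume n φ), P x) ↔ ∀ᵐ x ∂(riemannianVolume n M), P x := by
  have hw : Measurable fun x : M ↦ ENNReal.ofReal (Real.exp (-φ x)) := by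
    have := hφ.measurable
    fun_prop
  constructor
  · exact fun h ↦ (withDensity_absolutelyContinuous' hw.aemeasurable
      (ae_of_all _ fun x ↦ (ENNReal.ofReal_pos.2 (Real.exp_pos _)).ne')).ae_le h
  · exact fun h ↦ (withDensity_absolutelyContinuous _ _).ae_le h

end WeightedVolume

/-! ### Measurable vector fields. -/

section MeasurableField

variable {n : ℕ} {M : Type*} [EMetricSpace M] [ChartedSpace (EuclideanSpace ℝ (Fin n)) M]
  [IsManifold (𝓡 n) ∞ M]

/-- A vector field is measurable if its components in every chart are. -/
def MeasurableField (A : ∀ x : M, TangentSpace (𝓡 n) x) : Prop :=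
  ∀ x₀ : M, AEStronglyMeasurable
    (fun y ↦ chartComponents x₀ y (A ((extChartAt (𝓡 n) x₀).symm y)))
    (volume.restrict (extChartAt (𝓡 n) x₀).target)

lemma coordVec_eq_sum (x₀ : M) (w y : EuclideanSpace ℝ (Fin n)) :
    coordVec x₀ w y = ∑ i, w i • coordVec x₀ (EuclideanSpace.single i 1) y := by
  have h := (EuclideanSpace.basisFun (Fin n) ℝ).sum_repr w
  simp only [EuclideanSpace.basisFun_repr, EuclideanSpace.basisFun_apply] at h
  conv_lhs => rw [← h]
  exact (map_sum (mfderiv (𝓡 n) (𝓡 n) (extChartAt (𝓡 n) x₀).symm y) _ _).trans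
    (Finset.sum_congr rfl fun i _ ↦ coordVec_smul x₀ _ _ _)

lemma eventuallyEq_chart {x₀ : M} {y : EuclideanSpace ℝ (Fin n)}
    (hy : y ∈ (extChartAt (𝓡 n) x₀).target) {ψ : M → ℝ} {ψ' : EuclideanSpace ℝ (Fin n) → ℝ}
    (h : ∀ z ∈ (extChartAt (𝓡 n) x₀).target, ψ ((extChartAt (𝓡 n) x₀).symm z) = ψ' z) :
    ψ =ᶠ[𝓝 ((extChartAt (𝓡 n) x₀).symm y)] ψ' ∘ extChartAt (𝓡 n) x₀ := by
  filter_upwards [(isOpen_extChartAt_source (I := 𝓡 n) x₀).mem_nhds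
    ((extChartAt (𝓡 n) x₀).map_target hy)] with x hx
  rw [Function.comp_apply, ← h _ ((extChartAt (𝓡 n) x₀).map_source hx),
    (extChartAt (𝓡 n) x₀).left_inv hx]

lemma mdifferentiableAt_chart {x₀ : M} {y : EuclideanSpace ℝ (Fin n)}
    (hy : y ∈ (extChartAt (𝓡 n) x₀).target) :
    MDifferentiableAt (𝓡 n) (𝓡 n) (extChartAt (𝓡 n) x₀) ((extChartAt (𝓡 n) x₀).symm y) := by
  have h := (extChartAt (𝓡 n) x₀).map_target hy
  rw [extChartAt_source] at h
  exact (contMDiffAt_extChartAt' (n := ∞) h).mdifferentiableAt (by simp)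

lemma differential_eq {x₀ : M} {y : EuclideanSpace ℝ (Fin n)}
    (hy : y ∈ (extChartAt (𝓡 n) x₀).target) {ψ : M → ℝ} {ψ' : EuclideanSpace ℝ (Fin n) → ℝ}
    (h : ∀ z ∈ (extChartAt (𝓡 n) x₀).target, ψ ((extChartAt (𝓡 n) x₀).symm z) = ψ' z)
    (hψ' : DifferentiableAt ℝ ψ' y)
    (X : TangentSpace (𝓡 n) ((extChartAt (𝓡 n) x₀).symm y)) :
    differential n ψ ((extChartAt (𝓡 n) x₀).symm y) X =
      fderiv ℝ ψ' y (chartComponents x₀ y X) := by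
  have h1 : HasFDerivAt ψ' (fderiv ℝ ψ' y) (extChartAt (𝓡 n) x₀ ((extChartAt (𝓡 n) x₀).symm y)) := by
    rw [(extChartAt (𝓡 n) x₀).right_inv hy]
    exact hψ'.hasFDerivAt
  have h2 := (h1.hasMFDerivAt.comp (I := 𝓡 n) ((extChartAt (𝓡 n) x₀).symm y)
    (mdifferentiableAt_chart hy).hasMFDerivAt).congr_of_eventuallyEq (eventuallyEq_chart hy h)
  exact DFunLike.congr_fun h2.mfderiv X

lemma differential_eq_zero {ψ : M → ℝ} {x : M} (hx : x ∉ tsupport ψ) :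
    differential n ψ x = 0 := by
  have h : ψ =ᶠ[𝓝 x] fun _ ↦ 0 := notMem_tsupport_iff_eventuallyEq.1 hx
  exact ((hasMFDerivAt_const (I := 𝓡 n) (I' := 𝓘(ℝ, ℝ)) (0 : ℝ) x).congr_of_eventuallyEq h).mfderiv

lemma contDiffOn_comp_symm {ψ : M → ℝ} (hψ : ContMDiff (𝓡 n) 𝓘(ℝ, ℝ) ∞ ψ) (x₀ : M) :
    ContDiffOn ℝ ∞ (ψ ∘ (extChartAt (𝓡 n) x₀).symm) (extChartAt (𝓡 n) x₀).target := by
  rw [← contMDiffOn_iff_contDiffOn]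
  exact hψ.comp_contMDiffOn (contMDiffOn_extChartAt_symm x₀)

variable [RiemannianBundle (fun x : M ↦ TangentSpace (𝓡 n) x)]
  [IsContMDiffRiemannianBundle (𝓡 n) ∞ (EuclideanSpace ℝ (Fin n))
      (fun x : M ↦ TangentSpace (𝓡 n) x)]

/-- The Gram matrix of the coordinate vector fields. -/
def gramMatrix (x₀ : M) (y : EuclideanSpace ℝ (Fin n)) : Matrix (Fin n) (Fin n) ℝ :=
  Matrix.of fun i j ↦ inner ℝ (coordVec x₀ (EuclideanSpace.single i 1) y)
      (coordVec x₀ (EuclideanSpace.single j 1) y)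

lemma gramMatrix_mulVec (x₀ : M) (w y : EuclideanSpace ℝ (Fin n)) :
    (gramMatrix x₀ y).mulVec w =
      fun i ↦ inner ℝ (coordVec x₀ w y) (coordVec x₀ (EuclideanSpace.single i 1) y) := by
  funext i
  rw [coordVec_eq_sum x₀ w, sum_inner]
  simp only [Matrix.mulVec, dotProduct, gramMatrix, Matrix.of_apply]
  refine Finset.sum_congr rfl fun j _ ↦ ?_
  rw [real_inner_smul_left, real_inner_comm, mul_comm]

lemma det_gramMatrix_ne_zero {x₀ : M} {y : EuclideanSpace ℝ (Fin n)}
    (hy : y ∈ (extChartAt (𝓡 n) x₀).target) : (gramMatrix x₀ y).det ≠ 0 := by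
  intro h
  have := volDensity_pos hy
  rw [volDensity, show (Matrix.of fun i j : Fin n ↦ inner ℝ
    (coordVec x₀ (EuclideanSpace.single i 1) y)
    (coordVec x₀ (EuclideanSpace.single j 1) y)) = gramMatrix x₀ y from rfl, h] at this
  simp at this

lemma continuous_gramMatrix_domRestrict (x₀ : M) :
    Continuous ((extChartAt (𝓡 n) x₀).target.domRestrict (gramMatrix (n := n) x₀)) :=
  continuous_matrix fun _ _ ↦
    continuousOn_iff_continuous_domRestrict.1 (continuousOn_inner_coordVec x₀ _ _)

/-- Cramer's rule for the components of a vector in terms of its covariant components. -/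
lemma chartComponents_apply {x₀ : M} {y : EuclideanSpace ℝ (Fin n)}
    (hy : y ∈ (extChartAt (𝓡 n) x₀).target)
    (X : TangentSpace (𝓡 n) ((extChartAt (𝓡 n) x₀).symm y)) (i : Fin n) :
    chartComponents x₀ y X i = (gramMatrix x₀ y).det⁻¹ *
      ∑ j, (gramMatrix x₀ y).adjugate i j *
        inner ℝ X (coordVec x₀ (EuclideanSpace.single j 1) y) := by
  have h1 := gramMatrix_mulVec x₀ (chartComponents x₀ y X) y
  rw [coordVec_chartComponents hy] at h1
  have h2 := congrArg (fun b ↦ (gramMatrix x₀ y).adjugate.mulVec b i) h1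
  simp only [Matrix.mulVec_mulVec, Matrix.adjugate_mul, Matrix.smul_mulVec, Matrix.one_mulVec,
    Pi.smul_apply, smul_eq_mul] at h2
  rw [eq_inv_mul_iff_mul_eq₀ (det_gramMatrix_ne_zero hy)]
  exact h2

variable [MeasurableSpace M] [BorelSpace M]

lemma aestronglyMeasurable_euclidean {α : Type*} [MeasurableSpace α] {ν : Measure α}
    {f : α → EuclideanSpace ℝ (Fin n)} (h : ∀ i, AEStronglyMeasurable (fun y ↦ f y i) ν) :
    AEStronglyMeasurable f ν := by
  have h1 : f = fun y ↦ ∑ i, f y i • EuclideanSpace.single i (1 : ℝ) := by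
    funext y
    have h := (EuclideanSpace.basisFun (Fin n) ℝ).sum_repr (f y)
    simpa only [EuclideanSpace.basisFun_repr, EuclideanSpace.basisFun_apply] using h.symm
  rw [h1]
  exact Finset.aestronglyMeasurable_fun_sum _ fun i _ ↦ (h i).smul_const _

/-- A weak gradient is given by its covariant components, whereas `MeasurableField` asks for the
contravariant ones. Cramer's rule converts them with coefficients continuous in the chart, the Gram
determinant being nonzero. -/
lemma measurableField_of_inner {A : ∀ x : M, TangentSpace (𝓡 n) x}
    (h : ∀ x₀ w, AEStronglyMeasurable
      (fun y ↦ (inner ℝ (A ((extChartAt (𝓡 n) x₀).symm y)) (coordVec x₀ w y) : ℝ))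
      (volume.restrict (extChartAt (𝓡 n) x₀).target)) : MeasurableField A := by
  intro x₀
  refine aestronglyMeasurable_euclidean fun i ↦ ?_
  have hT := measurableSet_target (n := n) x₀
  have hadj : ∀ i j, ContinuousOn (fun y ↦ (gramMatrix x₀ y).adjugate i j)
      (extChartAt (𝓡 n) x₀).target := fun i j ↦
    continuousOn_iff_continuous_domRestrict.2
      ((continuous_gramMatrix_domRestrict x₀).matrix_adjugate.matrix_elem i j)
  have hdet : ContinuousOn (fun y ↦ (gramMatrix x₀ y).det⁻¹) (extChartAt (𝓡 n) x₀).target :=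
    (continuousOn_iff_continuous_domRestrict.2
      (continuous_gramMatrix_domRestrict x₀).matrix_det).inv₀ fun y hy ↦ det_gramMatrix_ne_zero hy
  refine ((hdet.aestronglyMeasurable hT).mul (Finset.aestronglyMeasurable_fun_sum Finset.univ
    fun j _ ↦ ((hadj i j).aestronglyMeasurable hT).mul
      (h x₀ (EuclideanSpace.single j 1)))).congr ?_
  filter_upwards [ae_restrict_mem hT] with y hy
  exact (chartComponents_apply hy _ i).symm

lemma HasWeakGradient.measurableField {v : M → ℝ} {G : ∀ x : M, TangentSpace (𝓡 n) x}
    (h : HasWeakGradient v G) : MeasurableField G :=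
  measurableField_of_inner fun x₀ w ↦ ((h x₀).2 w).1.aestronglyMeasurable

lemma MeasurableField.smul {φ : M → ℝ} (hφ : Continuous φ) {c : M → ℝ}
    (hc : AEStronglyMeasurable c (weightedVolume n φ)) {A : ∀ x : M, TangentSpace (𝓡 n) x}
    (hA : MeasurableField A) : MeasurableField (fun x ↦ c x • A x) := fun x₀ ↦
  (((aestronglyMeasurable_restrict_source_iff hφ x₀).1 hc.restrict).smul (hA x₀)).congr
    (ae_of_all _ fun y ↦ (map_smul (mfderiv (𝓡 n) (𝓡 n) (extChartAt (𝓡 n) x₀)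
      ((extChartAt (𝓡 n) x₀).symm y)) _ _).symm)

lemma MeasurableField.inner_coordVec {A : ∀ x : M, TangentSpace (𝓡 n) x} (hA : MeasurableField A)
    (x₀ : M) (w : EuclideanSpace ℝ (Fin n)) : AEStronglyMeasurable
      (fun y ↦ (inner ℝ (A ((extChartAt (𝓡 n) x₀).symm y)) (coordVec x₀ w y) : ℝ))
      (volume.restrict (extChartAt (𝓡 n) x₀).target) := by
  have hT := measurableSet_target (n := n) x₀
  have h1 : AEStronglyMeasurable (fun y ↦ ∑ i,
      chartComponents x₀ y (A ((extChartAt (𝓡 n) x₀).symm y)) i *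
        (inner ℝ (coordVec x₀ (EuclideanSpace.single i 1) y) (coordVec x₀ w y) : ℝ))
      (volume.restrict (extChartAt (𝓡 n) x₀).target) := by
    refine Finset.aestronglyMeasurable_fun_sum _ fun i _ ↦ AEStronglyMeasurable.mul ?_
      ((continuousOn_inner_coordVec x₀ _ _).aestronglyMeasurable hT)
    exact (EuclideanSpace.proj (𝕜 := ℝ) i).continuous.comp_aestronglyMeasurable (hA x₀)
  refine h1.congr ?_
  filter_upwards [ae_restrict_mem hT] with y hy
  conv_rhs => rw [← coordVec_chartComponents hy (A ((extChartAt (𝓡 n) x₀).symm y)),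
    coordVec_eq_sum, sum_inner]
  exact Finset.sum_congr rfl fun i _ ↦ (real_inner_smul_left _ _ _).symm

lemma MeasurableField.aestronglyMeasurable_inner [SecondCountableTopology M] {φ : M → ℝ} (hφ : Continuous φ)
    {A B : ∀ x : M, TangentSpace (𝓡 n) x} (hA : MeasurableField A) (hB : MeasurableField B) :
    AEStronglyMeasurable (fun x ↦ (inner ℝ (A x) (B x) : ℝ)) (weightedVolume n φ) := by
  refine aestronglyMeasurable_of_chart hφ fun x₀ ↦ ?_
  have hT := measurableSet_target (n := n) x₀
  have h1 : AEStronglyMeasurable (fun y ↦ ∑ i,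
      chartComponents x₀ y (B ((extChartAt (𝓡 n) x₀).symm y)) i *
        (inner ℝ (A ((extChartAt (𝓡 n) x₀).symm y))
          (coordVec x₀ (EuclideanSpace.single i 1) y) : ℝ))
      (volume.restrict (extChartAt (𝓡 n) x₀).target) := by
    refine Finset.aestronglyMeasurable_fun_sum _ fun i _ ↦ AEStronglyMeasurable.mul ?_
      (hA.inner_coordVec x₀ _)
    exact (EuclideanSpace.proj (𝕜 := ℝ) i).continuous.comp_aestronglyMeasurable (hB x₀)
  refine h1.congr ?_
  filter_upwards [ae_restrict_mem hT] with y hy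
  rw [Function.comp_apply]
  conv_rhs => rw [← coordVec_chartComponents hy (B ((extChartAt (𝓡 n) x₀).symm y)),
    coordVec_eq_sum, inner_sum]
  exact Finset.sum_congr rfl fun i _ ↦ (real_inner_smul_right _ _ _).symm

lemma MeasurableField.aestronglyMeasurable_differential [SecondCountableTopology M] {φ : M → ℝ} (hφ : Continuous φ)
    {A : ∀ x : M, TangentSpace (𝓡 n) x} (hA : MeasurableField A) {η : M → ℝ}
    (hη : ContMDiff (𝓡 n) 𝓘(ℝ, ℝ) ∞ η) :
    AEStronglyMeasurable (fun x ↦ differential n η x (A x)) (weightedVolume n φ) := by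
  refine aestronglyMeasurable_of_chart hφ fun x₀ ↦ ?_
  have hT := measurableSet_target (n := n) x₀
  have hd := contDiffOn_comp_symm hη x₀
  have hc : ContinuousOn (fderiv ℝ (η ∘ (extChartAt (𝓡 n) x₀).symm))
      (extChartAt (𝓡 n) x₀).target := hd.continuousOn_fderiv_of_isOpen (isOpen_target x₀) (by simp)
  have h1 := (ContinuousLinearMap.apply ℝ ℝ : EuclideanSpace ℝ (Fin n) →L[ℝ]
    (EuclideanSpace ℝ (Fin n) →L[ℝ] ℝ) →L[ℝ] ℝ).aestronglyMeasurable_comp₂ (hA x₀)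
      (hc.aestronglyMeasurable (μ := volume) hT)
  refine h1.congr ?_
  filter_upwards [ae_restrict_mem hT] with y hy
  exact (differential_eq hy (fun _ _ ↦ rfl) ((hd.differentiableOn (by simp)).differentiableAt
    ((isOpen_target x₀).mem_nhds hy)) _).symm

end MeasurableField

/-! ### The test inequality for functions supported in one chart. -/

section LocalTest

variable {n : ℕ} {M : Type*} [EMetricSpace M] [ChartedSpace (EuclideanSpace ℝ (Fin n)) M]
  [IsManifold (𝓡 n) ∞ M]

lemma isCompact_image_symm {x₀ : M} {K : Set (EuclideanSpace ℝ (Fin n))} (hK : IsCompact K)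
    (hKT : K ⊆ (extChartAt (𝓡 n) x₀).target) : IsCompact ((extChartAt (𝓡 n) x₀).symm '' K) :=
  hK.image_of_continuousOn ((continuousOn_extChartAt_symm (I := 𝓡 n) x₀).mono hKT)

/-- A test function supported in a chart target, transported to the manifold. -/
lemma exists_isTestFunction {x₀ : M} {K : Set (EuclideanSpace ℝ (Fin n))} (hK : IsCompact K)
    (hKT : K ⊆ (extChartAt (𝓡 n) x₀).target) {ψ' : EuclideanSpace ℝ (Fin n) → ℝ}
    (hψ' : ContDiff ℝ ∞ ψ') (hψK : tsupport ψ' ⊆ K) :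
    ∃ ψ : M → ℝ, IsTestFunction n ψ ∧
      (∀ y ∈ (extChartAt (𝓡 n) x₀).target, ψ ((extChartAt (𝓡 n) x₀).symm y) = ψ' y) ∧
      ∀ x, ψ x ≠ 0 → x ∈ (extChartAt (𝓡 n) x₀).symm '' K := by
  set ψ : M → ℝ := (extChartAt (𝓡 n) x₀).source.indicator (ψ' ∘ extChartAt (𝓡 n) x₀) with hψ
  have hval : ∀ y ∈ (extChartAt (𝓡 n) x₀).target, ψ ((extChartAt (𝓡 n) x₀).symm y) = ψ' y := by
    intro y hy
    rw [hψ, Set.indicator_of_mem ((extChartAt (𝓡 n) x₀).map_target hy), Function.comp_apply,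
      (extChartAt (𝓡 n) x₀).right_inv hy]
  have hsupp : ∀ x, ψ x ≠ 0 → x ∈ (extChartAt (𝓡 n) x₀).symm '' K := by
    intro x hx
    have hxS : x ∈ (extChartAt (𝓡 n) x₀).source := Set.mem_of_indicator_ne_zero hx
    rw [hψ, Set.indicator_of_mem hxS] at hx
    exact ⟨_, hψK (subset_tsupport _ hx), (extChartAt (𝓡 n) x₀).left_inv hxS⟩
  have hc := isCompact_image_symm hK hKT
  refine ⟨ψ, ⟨fun x ↦ ?_, HasCompactSupport.intro hc fun x hx ↦ ?_⟩, hval, hsupp⟩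
  · by_cases hx : x ∈ (extChartAt (𝓡 n) x₀).source
    · have h1 : ContMDiffAt (𝓡 n) 𝓘(ℝ, ℝ) ∞ (ψ' ∘ extChartAt (𝓡 n) x₀) x :=
        hψ'.contMDiff.contMDiffAt.comp x
          (contMDiffAt_extChartAt' (by rwa [extChartAt_source] at hx))
      refine h1.congr_of_eventuallyEq ?_
      filter_upwards [(isOpen_extChartAt_source (I := 𝓡 n) x₀).mem_nhds hx] with z hz
      rw [hψ, Set.indicator_of_mem hz]
    · have h1 : x ∉ (extChartAt (𝓡 n) x₀).symm '' K := by
        rintro ⟨y, hy, rfl⟩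
        exact hx ((extChartAt (𝓡 n) x₀).map_target (hKT hy))
      refine (contMDiffAt_const (c := (0 : ℝ))).congr_of_eventuallyEq ?_
      filter_upwards [hc.isClosed.isOpen_compl.mem_nhds h1] with z hz
      by_contra h0
      exact hz (hsupp z h0)
  · by_contra h0
    exact hx (hsupp x h0)

/-- A test function supported in a chart domain, read in the chart. -/
lemma exists_contDiff_chart {x₀ : M} {η : M → ℝ} (hη : IsTestFunction n η)
    (hηS : tsupport η ⊆ (extChartAt (𝓡 n) x₀).source) :
    ∃ η' : EuclideanSpace ℝ (Fin n) → ℝ, ContDiff ℝ ∞ η' ∧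
      tsupport η' ⊆ extChartAt (𝓡 n) x₀ '' tsupport η ∧
      ∀ y ∈ (extChartAt (𝓡 n) x₀).target, η ((extChartAt (𝓡 n) x₀).symm y) = η' y := by
  have hc : IsCompact (extChartAt (𝓡 n) x₀ '' tsupport η) :=
    IsCompact.image_of_continuousOn hη.2 ((continuousOn_extChartAt (I := 𝓡 n) x₀).mono hηS)
  have hcT : extChartAt (𝓡 n) x₀ '' tsupport η ⊆ (extChartAt (𝓡 n) x₀).target := by
    rintro _ ⟨x, hx, rfl⟩
    exact (extChartAt (𝓡 n) x₀).map_source (hηS hx)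
  set η' : EuclideanSpace ℝ (Fin n) → ℝ :=
    (extChartAt (𝓡 n) x₀).target.indicator (η ∘ (extChartAt (𝓡 n) x₀).symm) with hη'
  have hsupp : Function.support η' ⊆ extChartAt (𝓡 n) x₀ '' tsupport η := by
    intro y hy
    have hyT : y ∈ (extChartAt (𝓡 n) x₀).target := Set.mem_of_indicator_ne_zero hy
    rw [Function.mem_support, hη', Set.indicator_of_mem hyT] at hy
    exact ⟨_, subset_tsupport _ hy, (extChartAt (𝓡 n) x₀).right_inv hyT⟩
  refine ⟨η', contDiff_iff_contDiffAt.2 fun y ↦ ?_, closure_minimal hsupp hc.isClosed,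
    fun y hy ↦ by rw [hη', Set.indicator_of_mem hy]; rfl⟩
  by_cases hy : y ∈ (extChartAt (𝓡 n) x₀).target
  · refine ((contDiffOn_comp_symm hη.1 x₀).contDiffAt
      ((isOpen_target x₀).mem_nhds hy)).congr_of_eventuallyEq ?_
    filter_upwards [(isOpen_target x₀).mem_nhds hy] with z hz
    rw [hη', Set.indicator_of_mem hz]
  · refine (contDiffAt_const (c := (0 : ℝ))).congr_of_eventuallyEq ?_
    filter_upwards [hc.isClosed.isOpen_compl.mem_nhds fun h ↦ hy (hcT h)] with z hz
    by_contra h0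
    exact hz (hsupp h0)

variable [RiemannianBundle (fun x : M ↦ TangentSpace (𝓡 n) x)]
  [IsContMDiffRiemannianBundle (𝓡 n) ∞ (EuclideanSpace ℝ (Fin n))
      (fun x : M ↦ TangentSpace (𝓡 n) x)]
  [MeasurableSpace M] [BorelSpace M]

/-- The covariant components of a vector at `α⁻¹(y)` as a linear form. -/
def covector (x₀ : M) (y : EuclideanSpace ℝ (Fin n))
    (X : TangentSpace (𝓡 n) ((extChartAt (𝓡 n) x₀).symm y)) :
    EuclideanSpace ℝ (Fin n) →L[ℝ] ℝ :=
  LinearMap.toContinuousLinearMap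
    { toFun := fun w ↦ inner ℝ X (coordVec x₀ w y)
      map_add' := fun w w' ↦ by rw [coordVec_add, inner_add_right]
      map_smul' := fun c w ↦ by rw [coordVec_smul, real_inner_smul_right]; rfl }

lemma covector_apply (x₀ : M) (y : EuclideanSpace ℝ (Fin n))
    (X : TangentSpace (𝓡 n) ((extChartAt (𝓡 n) x₀).symm y)) (w : EuclideanSpace ℝ (Fin n)) :
    covector x₀ y X w = inner ℝ X (coordVec x₀ w y) := rfl

lemma MeasurableField.aestronglyMeasurable_covector {G : ∀ x : M, TangentSpace (𝓡 n) x}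
    (hG : MeasurableField G) (x₀ : M) : AEStronglyMeasurable
      (fun y ↦ covector x₀ y (G ((extChartAt (𝓡 n) x₀).symm y)))
      (volume.restrict (extChartAt (𝓡 n) x₀).target) := by
  have h : (fun y ↦ covector x₀ y (G ((extChartAt (𝓡 n) x₀).symm y))) =
      fun y ↦ ∑ i, (inner ℝ (G ((extChartAt (𝓡 n) x₀).symm y))
        (coordVec x₀ (EuclideanSpace.single i 1) y) : ℝ) •
          (EuclideanSpace.proj i : EuclideanSpace ℝ (Fin n) →L[ℝ] ℝ) := by
    funext y
    ext w
    rw [covector_apply, coordVec_eq_sum, inner_sum, sum_apply]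
    refine Finset.sum_congr rfl fun i _ ↦ ?_
    rw [real_inner_smul_right, mul_comm]
    rfl
  rw [h]
  exact Finset.aestronglyMeasurable_fun_sum _ fun i _ ↦ (hG.inner_coordVec x₀ _).smul_const _

lemma memLp_covector {φ : M → ℝ} (hφ : Continuous φ) {G : ∀ x : M, TangentSpace (𝓡 n) x}
    (hG : MeasurableField G) {P : ℝ≥0∞} (hGP : MemLp (fun x ↦ ‖G x‖) P (weightedVolume n φ))
    {x₀ : M} {K : Set (EuclideanSpace ℝ (Fin n))} (hK : IsCompact K)
    (hKT : K ⊆ (extChartAt (𝓡 n) x₀).target) :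
    MemLp (fun y ↦ covector x₀ y (G ((extChartAt (𝓡 n) x₀).symm y))) P (volume.restrict K) := by
  obtain ⟨C, hC0, hC⟩ := exists_norm_coordVec_le hK hKT
  refine MemLp.of_le_mul (c := C) (memLp_comp_symm hφ hK hKT hGP)
    ((hG.aestronglyMeasurable_covector x₀).mono_measure (Measure.restrict_mono_set _ hKT)) ?_
  filter_upwards [ae_restrict_mem hK.measurableSet] with y hy
  rw [norm_norm]
  refine ContinuousLinearMap.opNorm_le_bound _ (by positivity) fun w ↦ ?_
  rw [covector_apply]
  refine (norm_inner_le_norm _ _).trans ?_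
  calc _ ≤ ‖G ((extChartAt (𝓡 n) x₀).symm y)‖ * (C * ‖w‖) := by gcongr; exact hC y hy w
    _ = _ := by ring

lemma memLp_chartComponents {φ : M → ℝ} (hφ : Continuous φ)
    {A : ∀ x : M, TangentSpace (𝓡 n) x}
    (hA : MeasurableField A) {P : ℝ≥0∞} (hAP : MemLp (fun x ↦ ‖A x‖) P (weightedVolume n φ))
    {x₀ : M} {K : Set (EuclideanSpace ℝ (Fin n))} (hK : IsCompact K)
    (hKT : K ⊆ (extChartAt (𝓡 n) x₀).target) :
    MemLp (fun y ↦ weightDensity φ x₀ y • chartComponents x₀ y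
      (A ((extChartAt (𝓡 n) x₀).symm y))) P (volume.restrict K) := by
  obtain ⟨c, hc0, hc⟩ := exists_le_norm_coordVec hK hKT
  obtain ⟨C, hC⟩ := hK.exists_bound_of_continuousOn ((continuousOn_weightDensity hφ x₀).mono hKT)
  refine MemLp.of_le_mul (c := C * c⁻¹) (memLp_comp_symm hφ hK hKT hAP)
    (((aemeasurable_weightDensity hφ x₀).aestronglyMeasurable.smul (hA x₀)).mono_measure
      (Measure.restrict_mono_set _ hKT)) ?_
  filter_upwards [ae_restrict_mem hK.measurableSet] with y hy
  rw [norm_norm, norm_smul, mul_assoc]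
  have h1 := hc y hy (chartComponents x₀ y (A ((extChartAt (𝓡 n) x₀).symm y)))
  rw [coordVec_chartComponents (hKT hy)] at h1
  have h2 := hC y hy
  have h0 := (norm_nonneg _).trans h2
  gcongr
  rwa [le_inv_mul_iff₀ hc0]

variable [IsRiemannianManifold (𝓡 n) M]

/-- A Lipschitz function in a chart, compared with the norm at a nearby point. -/
lemma exists_abs_sub_le_norm_coordVec {x₀ : M} {K : Set (EuclideanSpace ℝ (Fin n))}
    (hK : IsCompact K) (hKT : K ⊆ (extChartAt (𝓡 n) x₀).target) {κ : NNReal} {χ : M → ℝ}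
    (hχ : LipschitzWith κ χ) :
    ∃ ε > 0, ∀ y ∈ K, ∀ x₁ ∈ Metric.ball y ε, ∀ x₂ ∈ Metric.ball y ε,
      |χ ((extChartAt (𝓡 n) x₀).symm x₁) - χ ((extChartAt (𝓡 n) x₀).symm x₂)| ≤
        2 * κ * ‖coordVec x₀ (x₁ - x₂) y‖ := by
  obtain ⟨ε, hε, h⟩ := exists_norm_coordVec_le_two_mul hK hKT
  refine ⟨ε, hε, fun y hy x₁ h₁ x₂ h₂ ↦ ?_⟩
  have h3 := edist_symm_le (convex_ball y ε) (fun x hx ↦ (h y hy x hx).1) h₁ h₂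
    (C := 2 * ‖coordVec x₀ (x₁ - x₂) y‖) fun x hx ↦ (h y hy x hx).2 _
  have h4 := (hχ _ _).trans (mul_le_mul_right h3 (κ : ℝ≥0∞))
  have hnn : 0 ≤ 2 * ‖coordVec x₀ (x₁ - x₂) y‖ := mul_nonneg zero_le_two (norm_nonneg _)
  rw [edist_dist, ← ENNReal.ofReal_coe_nnreal, ← ENNReal.ofReal_mul κ.coe_nonneg,
    ENNReal.ofReal_le_ofReal_iff (mul_nonneg κ.coe_nonneg hnn), Real.dist_eq] at h4
  exact h4.trans_eq (by ring)

set_option maxHeartbeats 800000 in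
/-- The effect of testing `f = e^φ div (e^{-φ} A)` with `η Φ(v) χ`, where `η` is supported in
a chart and `χ` is Lipschitz. -/
lemma abs_integral_local_test_le {φ : M → ℝ} (hφ : Continuous φ) {P P' R : ℝ≥0∞}
    [P.HolderTriple P' 1] (hP : 1 ≤ P) (hPt : P ≠ ⊤) (hP' : 1 ≤ P') (hR : 1 ≤ R)
    {f v : M → ℝ} (hf : MemLp f R (weightedVolume n φ))
    {A G : ∀ x : M, TangentSpace (𝓡 n) x} (hA : MeasurableField A)
    (hAP : MemLp (fun x ↦ ‖A x‖) P' (weightedVolume n φ)) (hG : HasWeakGradient v G)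
    (hGP : MemLp (fun x ↦ ‖G x‖) P (weightedVolume n φ))
    (hfA : ∀ ψ : M → ℝ, IsTestFunction n ψ → ∫ x, f x * ψ x ∂(weightedVolume n φ) =
      -∫ x, differential n ψ x (A x) ∂(weightedVolume n φ))
    {κ : NNReal} {χ : M → ℝ} (hχ : LipschitzWith κ χ)
    {Φ : ℝ → ℝ} (hΦ : ContDiff ℝ ∞ Φ) {B : ℝ} (hB : ∀ s, |Φ s| ≤ B) (hB' : ∀ s, |deriv Φ s| ≤ B)
    {η : M → ℝ} (hη : IsTestFunction n η) {x₀ : M}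
    (hηS : tsupport η ⊆ (extChartAt (𝓡 n) x₀).source) :
    |(∫ x, f x * (η x * Φ (v x) * χ x) ∂(weightedVolume n φ)) +
        ((∫ x, Φ (v x) * χ x * differential n η x (A x) ∂(weightedVolume n φ)) +
          ∫ x, η x * χ x * deriv Φ (v x) * inner ℝ (G x) (A x) ∂(weightedVolume n φ))| ≤
      ∫ x, |η x| * |Φ (v x)| * (2 * κ * ‖A x‖) ∂(weightedVolume n φ) := by
  set K := extChartAt (𝓡 n) x₀ '' tsupport η with hKdef
  have hK : IsCompact K :=
    IsCompact.image_of_continuousOn hη.2 ((continuousOn_extChartAt (I := 𝓡 n) x₀).mono hηS)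
  have hKT : K ⊆ (extChartAt (𝓡 n) x₀).target := by
    rintro _ ⟨x, hx, rfl⟩
    exact (extChartAt (𝓡 n) x₀).map_source (hηS hx)
  have hmemK : ∀ x ∈ tsupport η, x ∈ (extChartAt (𝓡 n) x₀).symm '' K := fun x hx ↦
    ⟨_, ⟨x, hx, rfl⟩, (extChartAt (𝓡 n) x₀).left_inv (hηS hx)⟩
  have hKm := hK.measurableSet
  have hfin : IsFiniteMeasure (volume.restrict K) := ⟨by
    rw [Measure.restrict_apply_univ]; exact hK.measure_lt_top⟩
  obtain ⟨η', hη', hη'K, hηη'⟩ := exists_contDiff_chart hη hηS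
  obtain ⟨ε, hε, hεχ⟩ := exists_abs_sub_le_norm_coordVec hK hKT hχ
  have hω := (continuousOn_weightDensity hφ x₀).mono hKT
  have hf' : IntegrableOn (fun y ↦ f ((extChartAt (𝓡 n) x₀).symm y) * weightDensity φ x₀ y) K := by
    have h1 : IntegrableOn (fun y ↦ f ((extChartAt (𝓡 n) x₀).symm y)) K :=
      (memLp_comp_symm hφ hK hKT hf).integrable hR
    exact h1.mul_continuousOn hω hK
  have hAint : IntegrableOn (fun y ↦ ‖A ((extChartAt (𝓡 n) x₀).symm y)‖ *
      weightDensity φ x₀ y) K := by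
    have h1 : IntegrableOn (fun y ↦ ‖A ((extChartAt (𝓡 n) x₀).symm y)‖) K :=
      (memLp_comp_symm hφ hK hKT hAP).integrable hP'
    exact h1.mul_continuousOn hω hK
  have ha := memLp_chartComponents hφ hA hAP hK hKT
  have hN : ∀ y ∈ K, 2 * κ * ‖coordVec x₀ (weightDensity φ x₀ y • chartComponents x₀ y
      (A ((extChartAt (𝓡 n) x₀).symm y))) y‖ =
      2 * κ * ‖A ((extChartAt (𝓡 n) x₀).symm y)‖ * weightDensity φ x₀ y := by
    intro y hy
    rw [coordVec_smul, coordVec_chartComponents (hKT hy), norm_smul,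
      Real.norm_of_nonneg (weightDensity_pos φ (hKT hy)).le]
    ring
  have hdη : ∀ {η : M → ℝ} {η' : EuclideanSpace ℝ (Fin n) → ℝ}, ContDiff ℝ ∞ η' →
      (∀ y ∈ (extChartAt (𝓡 n) x₀).target, η ((extChartAt (𝓡 n) x₀).symm y) = η' y) → ∀ y ∈ K,
      fderiv ℝ η' y (weightDensity φ x₀ y • chartComponents x₀ y
        (A ((extChartAt (𝓡 n) x₀).symm y))) =
      differential n η ((extChartAt (𝓡 n) x₀).symm y) (A ((extChartAt (𝓡 n) x₀).symm y)) *
        weightDensity φ x₀ y := by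
    intro η η' hη' hηη' y hy
    rw [differential_eq (hKT hy) hηη' (hη'.differentiable (by simp) y), map_smul, smul_eq_mul,
      mul_comm]
  -- The weight density is absorbed into f and into the vector field, which leaves Lebesgue measure
  -- and an equation in divergence form. N is the Riemannian norm times 2κ, where the 2 accounts for
  -- the variation of the metric near y.
  have key := abs_integral_test_le (μ := volume) (isOpen_target x₀) hK hKT (P := P) (P' := P') hP
    hPt hf' ha (ha.integrable hP') (hG x₀).1
    (D := fun y ↦ covector x₀ y (G ((extChartAt (𝓡 n) x₀).symm y)))
    (fun L hL hLT ↦ memLp_covector hφ hG.measurableField hGP hL hLT)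
    (fun ψ hψ hψc hψT w ↦ ((hG x₀).2 w).2 ψ hψ hψc hψT) ?_ hη' hη'K hΦ hB hB'
    (χ := fun y ↦ χ ((extChartAt (𝓡 n) x₀).symm y))
    (hχ.continuous.comp_continuousOn (continuousOn_extChartAt_symm (I := 𝓡 n) x₀))
    (N := fun y w ↦ 2 * κ * ‖coordVec x₀ w y‖) ?_ hε hεχ ?_
  · have e1 := integral_eq_setIntegral_chart hφ x₀ hKT
      (F := fun x ↦ f x * (η x * Φ (v x) * χ x)) fun x hx ↦ hmemK x <| subset_tsupport _ <| by
        intro h0; simp [h0] at hx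
    have e2 := integral_eq_setIntegral_chart hφ x₀ hKT
      (F := fun x ↦ Φ (v x) * χ x * differential n η x (A x)) fun x hx ↦ hmemK x <| by
        by_contra h0; rw [differential_eq_zero h0] at hx; simp at hx
    have e3 := integral_eq_setIntegral_chart hφ x₀ hKT
      (F := fun x ↦ η x * χ x * deriv Φ (v x) * inner ℝ (G x) (A x)) fun x hx ↦
        hmemK x <| subset_tsupport _ <| by intro h0; simp [h0] at hx
    have e4 := integral_eq_setIntegral_chart hφ x₀ hKT
      (F := fun x ↦ |η x| * |Φ (v x)| * (2 * κ * ‖A x‖)) fun x hx ↦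
        hmemK x <| subset_tsupport _ <| by intro h0; simp [h0] at hx
    rw [e1, e2, e3, e4]
    refine (le_of_eq_of_le (congrArg abs (congrArg₂ _ ?_ (congrArg₂ _ ?_ ?_))) key).trans_eq ?_
    · refine setIntegral_congr_fun hKm fun y hy ↦ ?_
      rw [hηη' y (hKT hy)]
      ring
    · refine setIntegral_congr_fun hKm fun y hy ↦ ?_
      rw [hdη hη' hηη' y hy]
      ring
    · refine setIntegral_congr_fun hKm fun y hy ↦ ?_
      rw [hηη' y (hKT hy), covector_apply, coordVec_smul, coordVec_chartComponents (hKT hy),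
        real_inner_smul_right]
      ring
    · refine setIntegral_congr_fun hKm fun y hy ↦ ?_
      rw [hN y hy, hηη' y (hKT hy)]
      ring
  · intro ψ' hψ' hψ'K
    obtain ⟨ψ, hψ, hψψ', hψK⟩ := exists_isTestFunction hK hKT hψ' hψ'K
    have h1 := hfA ψ hψ
    rw [integral_eq_setIntegral_chart hφ x₀ hKT (F := fun x ↦ f x * ψ x) fun x hx ↦
        hψK x (right_ne_zero_of_mul hx),
      integral_eq_setIntegral_chart hφ x₀ hKT (F := fun x ↦ differential n ψ x (A x))
        fun x hx ↦ closure_minimal (fun x hx ↦ hψK x hx) (isCompact_image_symm hK hKT).isClosed <| by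
          by_contra h0; rw [differential_eq_zero h0] at hx; simp at hx] at h1
    refine Eq.trans ?_ (h1.trans (congrArg Neg.neg ?_))
    · refine setIntegral_congr_fun hKm fun y hy ↦ ?_
      rw [hψψ' y (hKT hy)]
      ring
    · exact setIntegral_congr_fun hKm fun y hy ↦ (hdη hψ' hψψ' y hy).symm
  · intro y _ c hc w
    rw [coordVec_smul, norm_smul, Real.norm_of_nonneg hc.le]
    ring
  · have hAint' : IntegrableOn (fun y ↦ 2 * κ * (‖A ((extChartAt (𝓡 n) x₀).symm y)‖ *
        weightDensity φ x₀ y)) K := hAint.const_mul _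
    refine hAint'.congr_fun (fun y hy ↦ ?_) hKm
    rw [hN y hy]
    ring

end LocalTest

/-! ### The Hopf–Rinow compactness argument and Lipschitz cutoffs. -/

section LengthSpace

variable {X : Type*} [EMetricSpace X]

/-- In a complete locally compact length space the closed balls of finite radius are compact. -/
lemma isCompact_closedEBall [CompleteSpace X] [LocallyCompactSpace X]
    (hlen : ∀ (x y : X) (r δ : ℝ≥0∞), edist x y < r + δ →
      ∃ z, edist x z ≤ r ∧ (edist z y < δ ∨ z = y)) (x : X) (r : ℝ) :
    IsCompact (Metric.closedEBall x (ENNReal.ofReal r)) := by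
  have hmono : ∀ {r s : ℝ}, r ≤ s → IsCompact (Metric.closedEBall x (ENNReal.ofReal s)) →
      IsCompact (Metric.closedEBall x (ENNReal.ofReal r)) := fun hrs h ↦
    h.of_isClosed_subset Metric.isClosed_closedEBall
      (Metric.closedEBall_subset_closedEBall (ENNReal.ofReal_le_ofReal hrs))
  have hsing : ∀ r : ℝ, r ≤ 0 → IsCompact (Metric.closedEBall x (ENNReal.ofReal r)) := by
    intro r hr
    rw [ENNReal.ofReal_of_nonpos hr, Metric.closedEBall_zero]
    exact isCompact_singleton
  by_contra hbad
  -- Let R be the infimum of the bad radii. The ball of radius R is totally bounded, since the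
  -- length property brings each of its points δ-close to the compact ball of radius R - δ/2.
  -- Completeness makes it compact, and local compactness then gives a slightly larger compact ball,
  -- which contradicts the choice of R.
  set S : Set ℝ := {s | ¬ IsCompact (Metric.closedEBall x (ENNReal.ofReal s))} with hS
  have hSne : S.Nonempty := ⟨r, hbad⟩
  have hSbdd : BddBelow S := ⟨0, fun s hs ↦ by
    by_contra h
    exact hs (hsing s (not_le.1 h).le)⟩
  set R := sInf S
  have hlt : ∀ s < R, IsCompact (Metric.closedEBall x (ENNReal.ofReal s)) := fun s hs ↦ by
    by_contra h
    exact absurd (csInf_le hSbdd h) (not_le.2 hs)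
  have hR : IsCompact (Metric.closedEBall x (ENNReal.ofReal R)) := by
    rcases le_or_gt R 0 with h0 | h0
    · exact hsing R h0
    refine TotallyBounded.isCompact_of_isClosed ?_ Metric.isClosed_closedEBall
    rw [EMetric.totallyBounded_iff]
    intro ε hε
    obtain ⟨δ, hδ, hδε⟩ : ∃ δ : ℝ, 0 < δ ∧ ENNReal.ofReal δ + ENNReal.ofReal δ < ε := by
      rcases eq_or_ne ε ⊤ with rfl | hε'
      · exact ⟨1, one_pos, by simp⟩
      · have h1 := ENNReal.toReal_pos hε.ne' hε'
        refine ⟨ε.toReal / 4, by positivity, ?_⟩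
        rw [← ENNReal.ofReal_add (by positivity) (by positivity),
          ENNReal.ofReal_lt_iff_lt_toReal (by positivity) hε']
        linarith
    have hc := hlt (R - δ / 2) (by linarith)
    obtain ⟨t, ht, hcov⟩ := EMetric.totallyBounded_iff.1 hc.totallyBounded (ENNReal.ofReal δ)
      (ENNReal.ofReal_pos.2 hδ)
    refine ⟨t, ht, fun y hy ↦ ?_⟩
    have hxy : edist x y < ENNReal.ofReal (R - δ / 2) + ENNReal.ofReal δ := by
      refine (edist_comm x y).trans_le hy |>.trans_lt ?_
      calc ENNReal.ofReal R < ENNReal.ofReal (R - δ / 2 + δ) :=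
            (ENNReal.ofReal_lt_ofReal_iff (by linarith)).2 (by linarith)
        _ ≤ _ := ENNReal.ofReal_add_le
    obtain ⟨z, hz, hzy⟩ := hlen x y _ _ hxy
    have hzy' : edist z y < ENNReal.ofReal δ := by
      rcases hzy with h | rfl
      · exact h
      · simpa using hδ
    have hzm := hcov (show z ∈ Metric.closedEBall x _ from (edist_comm z x).trans_le hz)
    simp only [Set.mem_iUnion, exists_prop] at hzm ⊢
    obtain ⟨w, hw, hzw⟩ := hzm
    refine ⟨w, hw, ?_⟩
    calc edist y w ≤ edist y z + edist z w := edist_triangle _ _ _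
      _ ≤ ENNReal.ofReal δ + ENNReal.ofReal δ :=
        add_le_add ((edist_comm y z).trans_le hzy'.le) (Metric.mem_eball.1 hzw).le
      _ < ε := hδε
  obtain ⟨δ, hδ, hδc⟩ := hR.exists_isCompact_cthickening
  have hR' : IsCompact (Metric.closedEBall x (ENNReal.ofReal (R + δ / 2))) := by
    refine hδc.of_isClosed_subset Metric.isClosed_closedEBall fun y hy ↦ ?_
    have hxy : edist x y < ENNReal.ofReal R + ENNReal.ofReal δ := by
      refine (edist_comm x y).trans_le hy |>.trans_lt ?_
      rcases le_or_gt R 0 with h0 | h0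
      · rw [ENNReal.ofReal_of_nonpos h0, zero_add]
        exact (ENNReal.ofReal_lt_ofReal_iff hδ).2 (by linarith)
      · rw [← ENNReal.ofReal_add h0.le hδ.le]
        exact (ENNReal.ofReal_lt_ofReal_iff (by linarith)).2 (by linarith)
    obtain ⟨z, hz, hzy⟩ := hlen x y _ _ hxy
    refine Metric.mem_cthickening_of_edist_le y z δ _ ((edist_comm z x).trans_le hz) ?_
    rcases hzy with h | rfl
    · exact (edist_comm y z).trans_le h.le
    · simp
  obtain ⟨s, hs, hsR⟩ := exists_lt_of_csInf_lt hSne (show R < R + δ / 2 by linarith)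
  exact hs (hmono hsR.le hR')

/-- Lipschitz cutoff functions with compact support and small Lipschitz constant. -/
lemma exists_cutoff [SecondCountableTopology X]
    (hc : ∀ (x : X) (r : ℝ), IsCompact (Metric.closedEBall x (ENNReal.ofReal r))) :
    ∃ χ : ℕ → X → ℝ, (∀ k : ℕ, LipschitzWith ((k : NNReal) + 1)⁻¹ (χ k)) ∧
      (∀ k x, 0 ≤ χ k x) ∧ (∀ k x, χ k x ≤ 1) ∧ (∀ k, HasCompactSupport (χ k)) ∧
      ∀ x, ∀ᶠ k in atTop, χ k x = 1 := by
  rcases isEmpty_or_nonempty X with hX | hX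
  · exact ⟨fun _ _ ↦ 0, fun k ↦ LipschitzWith.const' 0 |>.weaken zero_le, by simp, by simp,
      fun k ↦ HasCompactSupport.zero, fun x ↦ (hX.false x).elim⟩
  set F : ℕ → Set X := fun k ↦ TopologicalSpace.denseSeq X '' Set.Iic k with hF
  -- Distances may be infinite, so one base point is not enough; the distance to the first k + 1
  -- terms of a dense sequence is used instead. The cap 2(k+1) keeps it finite and is the value at
  -- which the cutoff reaches zero.
  set h : ℕ → X → ℝ≥0∞ := fun k x ↦ min (Metric.infEDist x (F k)) (ENNReal.ofReal (2 * (k + 1)))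
  have hle : ∀ k x, (h k x).toReal ≤ 2 * (k + 1) := fun k x ↦
    ENNReal.toReal_le_of_le_ofReal (by positivity) (min_le_right _ _)
  have htop : ∀ k x, h k x ≠ ⊤ := fun k x ↦
    ((min_le_right _ _).trans_lt ENNReal.ofReal_lt_top).ne
  have hsub : ∀ k x y, edist x y ≠ ⊤ → (h k x).toReal ≤ (h k y).toReal + (edist x y).toReal := by
    intro k x y hxy
    rw [← ENNReal.toReal_add (htop k y) hxy]
    refine ENNReal.toReal_mono (ENNReal.add_ne_top.2 ⟨htop k y, hxy⟩) ?_
    change min _ _ ≤ min _ _ + _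
    rw [min_add]
    exact min_le_min Metric.infEDist_le_infEDist_add_edist le_self_add
  have hk : ∀ k : ℕ, (0 : ℝ) < k + 1 := fun k ↦ by positivity
  refine ⟨fun k x ↦ min 1 (2 - (h k x).toReal / (k + 1)), fun k ↦ ?_, fun k x ↦ ?_, fun k x ↦
    min_le_left _ _, fun k ↦ ?_, fun x ↦ ?_⟩
  · intro x y
    rcases eq_or_ne (edist x y) ⊤ with hxy | hxy
    · rw [hxy, ENNReal.mul_top (by positivity)]
      exact le_top
    have h1 := hsub k x y hxy
    have h2 := hsub k y x (by rwa [edist_comm])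
    rw [edist_comm y x] at h2
    have h3 : |(h k x).toReal - (h k y).toReal| ≤ (edist x y).toReal :=
      abs_le.2 ⟨by linarith, by linarith⟩
    rw [edist_dist, Real.dist_eq, ← ENNReal.ofReal_toReal hxy, ← ENNReal.ofReal_coe_nnreal,
      ← ENNReal.ofReal_mul NNReal.zero_le_coe]
    refine ENNReal.ofReal_le_ofReal ?_
    calc |min 1 (2 - (h k x).toReal / (k + 1)) - min 1 (2 - (h k y).toReal / (k + 1))|
        ≤ |(2 - (h k x).toReal / (k + 1)) - (2 - (h k y).toReal / (k + 1))| := by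
          have := abs_min_sub_min_le_max (1 : ℝ) (2 - (h k x).toReal / (k + 1)) 1
            (2 - (h k y).toReal / (k + 1))
          simpa using this
      _ = ((k : ℝ) + 1)⁻¹ * |(h k x).toReal - (h k y).toReal| := by
          rw [← abs_neg, ← abs_of_pos (inv_pos.2 (hk k)), abs_inv, ← abs_inv, ← abs_mul]
          congr 1
          ring
      _ ≤ ((k : ℝ) + 1)⁻¹ * (edist x y).toReal := by
          gcongr
      _ = _ := by push_cast; rfl
  · refine le_min zero_le_one ?_
    have : (h k x).toReal / (k + 1) ≤ 2 := by
      rw [div_le_iff₀ (hk k)]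
      exact hle k x
    linarith
  · have hcK : IsCompact (⋃ z ∈ F k, Metric.closedEBall z (ENNReal.ofReal (2 * (k + 1)))) :=
      ((Set.finite_Iic k).image _).isCompact_biUnion fun z _ ↦ hc z _
    refine HasCompactSupport.intro hcK fun x hx ↦ ?_
    have h1 : ENNReal.ofReal (2 * (k + 1)) ≤ Metric.infEDist x (F k) := by
      by_contra hlt
      obtain ⟨z, hz, hxz⟩ := Metric.infEDist_lt_iff.1 (not_le.1 hlt)
      exact hx (Set.mem_biUnion hz hxz.le)
    have h2 : (h k x).toReal = 2 * (k + 1) := by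
      change (min (Metric.infEDist x (F k)) _).toReal = _
      rw [min_eq_right h1, ENNReal.toReal_ofReal (by positivity)]
    simp only [h2, mul_div_assoc, div_self (hk k).ne']
    norm_num
  -- Some term of the dense sequence lies within distance 1 of x. Once k reaches its index, h k x ≤
  -- 1 ≤ k + 1 and the cutoff equals one.
  · obtain ⟨j, hj⟩ := (TopologicalSpace.denseRange_denseSeq X).exists_mem_open
      (Metric.isOpen_eball (x := x) (ε := 1)) ⟨x, Metric.mem_eball_self one_pos⟩
    filter_upwards [eventually_ge_atTop j] with k hkj
    refine min_eq_left ?_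
    have hj' : edist x (TopologicalSpace.denseSeq X j) ≤ 1 := by
      rw [edist_comm]
      exact (Metric.mem_eball.1 hj).le
    have hjF : TopologicalSpace.denseSeq X j ∈ F k := ⟨j, hkj, rfl⟩
    have h1 : Metric.infEDist x (F k) ≤ 1 := (Metric.infEDist_le_edist_of_mem hjF).trans hj'
    have h2 : (h k x).toReal ≤ 1 :=
      ENNReal.toReal_le_of_le_ofReal zero_le_one ((min_le_left _ _).trans (by simpa using h1))
    have h3 : (h k x).toReal / (k + 1) ≤ 1 := by
      rw [div_le_one (hk k)]
      have : (0 : ℝ) ≤ k := by positivity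
      linarith
    linarith

end LengthSpace

/-! ### Riemannian manifolds as length spaces. -/

section Riemannian

/-- A Riemannian manifold is a length space. -/
lemma exists_edist_le_edist_lt (n : ℕ) {M : Type*} [EMetricSpace M]
    [ChartedSpace (EuclideanSpace ℝ (Fin n)) M]
    [IsManifold (𝓡 n) ∞ M] [RiemannianBundle (fun x : M ↦ TangentSpace (𝓡 n) x)]
    [IsContMDiffRiemannianBundle (𝓡 n) ∞ (EuclideanSpace ℝ (Fin n))
      (fun x : M ↦ TangentSpace (𝓡 n) x)]
    [IsRiemannianManifold (𝓡 n) M]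
    (x y : M) (r δ : ℝ≥0∞) (h : edist x y < r + δ) :
    ∃ z, edist x z ≤ r ∧ (edist z y < δ ∨ z = y) := by
  rcases le_or_gt (edist x y) r with hxy | hxy
  · exact ⟨y, hxy, Or.inr rfl⟩
  rw [IsRiemannianManifold.out (I := 𝓡 n)] at h
  obtain ⟨γ, h0, h1, hγ, hlen⟩ := Manifold.exists_lt_of_riemannianEDist_lt h
  have hcont : ContinuousOn (fun t ↦ edist x (γ t)) (Set.Icc 0 1) :=
    continuous_edist.comp_continuousOn (continuousOn_const.prodMk hγ.continuousOn)
  -- An almost minimizing path is cut where its distance from x equals r. The first piece has length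
  -- at least r, so less than δ is left for the second.
  obtain ⟨t, ht, htr⟩ := intermediate_value_Icc zero_le_one hcont
    (show r ∈ Set.Icc (edist x (γ 0)) (edist x (γ 1)) from
      ⟨by rw [h0, edist_self]; exact zero_le, by rw [h1]; exact hxy.le⟩)
  refine ⟨γ t, htr.le, Or.inl ?_⟩
  have hl := Manifold.riemannianEDist_le_pathELength
    (hγ.mono (Set.Icc_subset_Icc_right ht.2)) h0 rfl ht.1
  have hr' := Manifold.riemannianEDist_le_pathELength
    (hγ.mono (Set.Icc_subset_Icc_left ht.1)) rfl h1 ht.2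
  rw [← IsRiemannianManifold.out (I := 𝓡 n)] at hl hr'
  have hadd := Manifold.pathELength_add (I := 𝓡 n) (γ := γ) ht.1 ht.2
  simp only at htr
  rw [htr] at hl
  have h2 : r + edist (γ t) y < r + δ :=
    (add_le_add hl hr').trans_lt (hadd.trans_lt hlen)
  exact lt_of_add_lt_add_left h2

lemma exists_cutoff_manifold (n : ℕ) {M : Type*} [EMetricSpace M]
    [ChartedSpace (EuclideanSpace ℝ (Fin n)) M]
    [IsManifold (𝓡 n) ∞ M] [RiemannianBundle (fun x : M ↦ TangentSpace (𝓡 n) x)]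
    [IsContMDiffRiemannianBundle (𝓡 n) ∞ (EuclideanSpace ℝ (Fin n))
      (fun x : M ↦ TangentSpace (𝓡 n) x)]
    [IsRiemannianManifold (𝓡 n) M]
    [CompleteSpace M] [SecondCountableTopology M] :
    ∃ χ : ℕ → M → ℝ, (∀ k : ℕ, LipschitzWith ((k : NNReal) + 1)⁻¹ (χ k)) ∧
      (∀ k x, 0 ≤ χ k x) ∧ (∀ k x, χ k x ≤ 1) ∧ (∀ k, HasCompactSupport (χ k)) ∧
      ∀ x, ∀ᶠ k in atTop, χ k x = 1 := by
  have := ChartedSpace.locallyCompactSpace (EuclideanSpace ℝ (Fin n)) M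
  exact exists_cutoff (isCompact_closedEBall (exists_edist_le_edist_lt n))

end Riemannian

/-! ### Globalization by a partition of unity. -/

section Partition

variable {n : ℕ} {M : Type*} [EMetricSpace M] [ChartedSpace (EuclideanSpace ℝ (Fin n)) M]
  [IsManifold (𝓡 n) ∞ M]

variable (n) in
/-- Finitely many test functions supported in charts which sum up to one where `χ ≠ 0`. -/
lemma exists_finset_testFunction_sum_eq_one [SecondCountableTopology M] {χ : M → ℝ}
    (hχ : HasCompactSupport χ) :
    ∃ (F : Finset M) (η : M → M → ℝ), (∀ i, IsTestFunction n (η i) ∧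
      tsupport (η i) ⊆ (extChartAt (𝓡 n) i).source ∧ ∀ x, 0 ≤ η i x) ∧
      (∀ x, ∑ i ∈ F, η i x ≤ 1) ∧ ∀ x, χ x ≠ 0 → ∑ i ∈ F, η i x = 1 := by
  have hlc := ChartedSpace.locallyCompactSpace (EuclideanSpace ℝ (Fin n)) M
  have hN : ∀ x : M, ∃ N : Set M, IsCompact N ∧ x ∈ interior N ∧
      N ⊆ (extChartAt (𝓡 n) x).source := fun x ↦
    exists_compact_subset (isOpen_extChartAt_source x) (mem_extChartAt_source (I := 𝓡 n) x)
  choose N hNc hxN hNS using hN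
  obtain ⟨g, hg⟩ := SmoothPartitionOfUnity.exists_isSubordinate (𝓡 n) (isClosed_univ (X := M))
    (fun x ↦ interior (N x)) (fun x ↦ isOpen_interior)
    (fun x _ ↦ Set.mem_iUnion_of_mem x (hxN x))
  have hfin := g.locallyFinite.finite_nonempty_inter_compact hχ
  refine ⟨hfin.toFinset, fun i x ↦ g i x, fun i ↦ ⟨⟨(g i).contMDiff, ?_⟩, ?_,
    fun x ↦ g.nonneg i x⟩, fun x ↦ ?_, fun x hx ↦ ?_⟩
  · exact (hNc i).of_isClosed_subset (isClosed_tsupport _) ((hg i).trans interior_subset)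
  · exact ((hg i).trans interior_subset).trans (hNS i)
  · rw [← g.sum_eq_one (Set.mem_univ x)]
    have hfx : (Function.support fun i ↦ g i x).Finite := g.locallyFinite.point_finite x
    rw [finsum_eq_sum _ hfx]
    rw [← Finset.sum_filter_ne_zero]
    refine Finset.sum_le_sum_of_subset_of_nonneg (fun i hi ↦ ?_) fun i _ _ ↦ g.nonneg i x
    rw [Finset.mem_filter] at hi
    rw [Set.Finite.mem_toFinset]
    exact hi.2
  · rw [← g.sum_eq_one (Set.mem_univ x)]
    refine (finsum_eq_sum_of_support_subset _ fun i hi ↦ ?_).symm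
    simp only [Set.Finite.coe_toFinset, Set.mem_ofPred_eq]
    exact ⟨x, hi, subset_tsupport _ hx⟩

/-- The set where χ ≠ 0 is open, so the sum of the η i is constantly one near x. -/
lemma sum_differential_eq_zero {F : Finset M} {η : M → M → ℝ} (hη : ∀ i, IsTestFunction n (η i))
    {χ : M → ℝ} (hχ : Continuous χ) (h1 : ∀ x, χ x ≠ 0 → ∑ i ∈ F, η i x = 1) {x : M}
    (hx : χ x ≠ 0) (X : TangentSpace (𝓡 n) x) :
    ∑ i ∈ F, differential n (η i) x X = 0 := by
  have hd : ∀ s : Finset M, HasMFDerivAt (𝓡 n) 𝓘(ℝ, ℝ) (fun z ↦ ∑ i ∈ s, η i z) x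
      (∑ i ∈ s, differential n (η i) x) := by
    classical
    intro s
    induction s using Finset.induction_on with
    | empty =>
      simp only [Finset.sum_empty]
      exact hasMFDerivAt_const (0 : ℝ) x
    | insert i s hi ih =>
      have hd : HasMFDerivAt (𝓡 n) 𝓘(ℝ, ℝ) (η i) x (differential n (η i) x) :=
        (((hη i).1 x).mdifferentiableAt (by simp)).hasMFDerivAt
      have e₁ : (fun z ↦ ∑ j ∈ insert i s, η j z) = fun z ↦ η i z + ∑ j ∈ s, η j z :=
        funext fun z ↦ Finset.sum_insert hi
      have e₂ : ∑ j ∈ insert i s, differential n (η j) x =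
        differential n (η i) x + ∑ j ∈ s, differential n (η j) x := Finset.sum_insert hi
      exact Eq.mpr (congrArg₂ (fun (f : M → ℝ) (L : TangentSpace (𝓡 n) x →L[ℝ] ℝ) ↦
        HasMFDerivAt (𝓡 n) 𝓘(ℝ, ℝ) f x L) e₁ e₂) (hd.add ih)
  have hev : (fun z ↦ ∑ i ∈ F, η i z) =ᶠ[𝓝 x] fun _ ↦ (1 : ℝ) := by
    filter_upwards [hχ.continuousAt.eventually_ne hx] with z hz
    exact h1 z hz
  have h2 := (hasMFDerivAt_const (I := 𝓡 n) (I' := 𝓘(ℝ, ℝ)) (1 : ℝ) x).congr_of_eventuallyEq hev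
  have h3 := hasMFDerivAt_unique (hd F) h2
  have h4 := DFunLike.congr_fun h3 X
  rw [← sum_apply]
  exact h4

variable [RiemannianBundle (fun x : M ↦ TangentSpace (𝓡 n) x)]
  [IsContMDiffRiemannianBundle (𝓡 n) ∞ (EuclideanSpace ℝ (Fin n))
      (fun x : M ↦ TangentSpace (𝓡 n) x)]

lemma exists_abs_differential_le {η : M → ℝ} (hη : IsTestFunction n η) {x₀ : M}
    (hηS : tsupport η ⊆ (extChartAt (𝓡 n) x₀).source) :
    ∃ C : ℝ, ∀ (x : M) (X : TangentSpace (𝓡 n) x), |differential n η x X| ≤ C * ‖X‖ := by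
  have hK : IsCompact (extChartAt (𝓡 n) x₀ '' tsupport η) :=
    IsCompact.image_of_continuousOn hη.2 ((continuousOn_extChartAt (I := 𝓡 n) x₀).mono hηS)
  have hKT : extChartAt (𝓡 n) x₀ '' tsupport η ⊆ (extChartAt (𝓡 n) x₀).target := by
    rintro _ ⟨x, hx, rfl⟩
    exact (extChartAt (𝓡 n) x₀).map_source (hηS hx)
  obtain ⟨η', hη', -, hηη'⟩ := exists_contDiff_chart hη hηS
  obtain ⟨C, hC⟩ := hK.exists_bound_of_continuousOn (f := fderiv ℝ η')
    (hη'.continuous_fderiv (by simp)).continuousOn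
  obtain ⟨c, hc0, hc⟩ := exists_le_norm_coordVec hK hKT
  have hcov : ∀ y ∈ extChartAt (𝓡 n) x₀ '' tsupport η,
      ∀ X : TangentSpace (𝓡 n) ((extChartAt (𝓡 n) x₀).symm y),
      |differential n η ((extChartAt (𝓡 n) x₀).symm y) X| ≤ |C| * c⁻¹ * ‖X‖ := by
    intro y hy X
    rw [differential_eq (hKT hy) hηη' (hη'.differentiable (by simp) y)]
    have h1 := hc y hy (chartComponents x₀ y X)
    rw [coordVec_chartComponents (hKT hy)] at h1
    refine ((fderiv ℝ η' y).le_opNorm _).trans ?_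
    rw [mul_assoc]
    refine mul_le_mul ((hC y hy).trans (le_abs_self C)) ?_ (norm_nonneg _) (abs_nonneg _)
    rwa [le_inv_mul_iff₀ hc0]
  refine ⟨|C| * c⁻¹, fun x X ↦ ?_⟩
  by_cases hx : x ∈ tsupport η
  · have h2 := hcov _ ⟨x, hx, rfl⟩
    rw [(extChartAt (𝓡 n) x₀).left_inv (hηS hx)] at h2
    exact h2 X
  · rw [differential_eq_zero hx]
    refine (abs_zero (α := ℝ)).trans_le ?_
    exact mul_nonneg (by positivity) (norm_nonneg X)

variable [MeasurableSpace M] [BorelSpace M] [SecondCountableTopology M]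
  [IsRiemannianManifold (𝓡 n) M]

set_option maxHeartbeats 1000000 in
/-- The effect of testing `f = e^φ div (e^{-φ} A)` with `Φ(v) χ`, where `χ` is Lipschitz with
compact support. -/
lemma exists_abs_integral_test_le {φ : M → ℝ} (hφ : Continuous φ) {P P' R : ℝ≥0∞}
    [P.HolderTriple P' 1] (hP : 1 ≤ P) (hPt : P ≠ ⊤) (hP' : 1 ≤ P') (hR : 1 ≤ R)
    {f v : M → ℝ} (hf : MemLp f R (weightedVolume n φ))
    (hv : AEStronglyMeasurable v (weightedVolume n φ))
    {A G : ∀ x : M, TangentSpace (𝓡 n) x} (hA : MeasurableField A)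
    (hAP : MemLp (fun x ↦ ‖A x‖) P' (weightedVolume n φ)) (hG : HasWeakGradient v G)
    (hGP : MemLp (fun x ↦ ‖G x‖) P (weightedVolume n φ))
    (hfA : ∀ ψ : M → ℝ, IsTestFunction n ψ → ∫ x, f x * ψ x ∂(weightedVolume n φ) =
      -∫ x, differential n ψ x (A x) ∂(weightedVolume n φ))
    {κ : NNReal} {χ : M → ℝ} (hχ : LipschitzWith κ χ) (hχc : HasCompactSupport χ)
    (hχ1 : ∀ x, |χ x| ≤ 1) :
    ∃ ρ : M → ℝ, Continuous ρ ∧ HasCompactSupport ρ ∧ (∀ x, 0 ≤ ρ x) ∧ (∀ x, ρ x ≤ 1) ∧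
      ∀ Φ : ℝ → ℝ, ContDiff ℝ ∞ Φ → ∀ B : ℝ, (∀ s, |Φ s| ≤ B) → (∀ s, |deriv Φ s| ≤ B) →
      |(∫ x, f x * (Φ (v x) * χ x) ∂(weightedVolume n φ)) +
          ∫ x, χ x * deriv Φ (v x) * inner ℝ (G x) (A x) ∂(weightedVolume n φ)| ≤
        ∫ x, ρ x * |Φ (v x)| * (2 * κ * ‖A x‖) ∂(weightedVolume n φ) := by
  have hfinm := isLocallyFiniteMeasure_weightedVolume (n := n) hφ
  obtain ⟨F, η, hη, hle, hone⟩ := exists_finset_testFunction_sum_eq_one n hχc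
  have hηc : ∀ i, Continuous (η i) := fun i ↦ (hη i).1.1.continuous
  -- This cutoff depends on χ and not on Φ, so that limits in Φ can later be taken with it fixed.
  refine ⟨fun x ↦ ∑ i ∈ F, η i x, continuous_finsetSum _ fun i _ ↦ hηc i, ?_,
    fun x ↦ Finset.sum_nonneg fun i _ ↦ (hη i).2.2 x, hle, fun Φ hΦ B hB hB' ↦ ?_⟩
  · refine HasCompactSupport.intro (K := ⋃ i ∈ F, tsupport (η i))
      (F.isCompact_biUnion fun i _ ↦ (hη i).1.2) fun x hx ↦ Finset.sum_eq_zero fun i hi ↦ ?_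
    by_contra h0
    exact hx (Set.mem_biUnion hi (subset_tsupport _ h0))
  have hΦm : AEStronglyMeasurable (fun x ↦ Φ (v x)) (weightedVolume n φ) :=
    hΦ.continuous.comp_aestronglyMeasurable hv
  have hΦm' : AEStronglyMeasurable (fun x ↦ deriv Φ (v x)) (weightedVolume n φ) :=
    (hΦ.continuous_deriv (by simp)).comp_aestronglyMeasurable hv
  have hχm : AEStronglyMeasurable χ (weightedVolume n φ) :=
    hχ.continuous.aestronglyMeasurable
  have hfl : LocallyIntegrable f (weightedVolume n φ) := hf.locallyIntegrable hR
  have hAl : LocallyIntegrable (fun x ↦ ‖A x‖) (weightedVolume n φ) := hAP.locallyIntegrable hP'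
  have hΦχ : AEStronglyMeasurable (fun x ↦ Φ (v x) * χ x) (weightedVolume n φ) := hΦm.mul hχm
  have hΦχB : ∀ x, ‖Φ (v x) * χ x‖ ≤ B := fun x ↦ by
    rw [norm_mul, Real.norm_eq_abs, Real.norm_eq_abs]
    calc _ ≤ |Φ (v x)| * 1 := by gcongr; exact hχ1 x
      _ ≤ B := by rw [mul_one]; exact hB _
  have hGA : Integrable (fun x ↦ (inner ℝ (G x) (A x) : ℝ)) (weightedVolume n φ) := by
    refine (hGP.integrable_mul hAP).mono'
      (hG.measurableField.aestronglyMeasurable_inner hφ hA) (ae_of_all _ fun x ↦ ?_)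
    exact norm_inner_le_norm _ _
  have i1 : ∀ i ∈ F, Integrable (fun x ↦ f x * (η i x * Φ (v x) * χ x)) (weightedVolume n φ) := by
    intro i _
    have h1 := hfl.integrable_smul_right_of_hasCompactSupport (hηc i) (hη i).1.2
    refine (h1.mul_bdd (c := B) hΦχ (ae_of_all _ hΦχB)).congr (ae_of_all _ fun x ↦ ?_)
    simp only [smul_eq_mul]
    ring
  have i2 : ∀ i ∈ F, Integrable (fun x ↦ Φ (v x) * χ x * differential n (η i) x (A x))
      (weightedVolume n φ) := by
    intro i _
    obtain ⟨C, hC⟩ := exists_abs_differential_le (hη i).1 (hη i).2.1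
    refine Integrable.bdd_mul (c := B) ?_ hΦχ (ae_of_all _ hΦχB)
    have h1 : IntegrableOn (fun x ↦ C * ‖A x‖) (tsupport (η i)) (weightedVolume n φ) :=
      (hAl.integrableOn_isCompact (hη i).1.2).const_mul C
    have h2 := (integrable_indicator_iff (isClosed_tsupport (η i)).measurableSet).2 h1
    refine h2.mono' (hA.aestronglyMeasurable_differential hφ (hη i).1.1) (ae_of_all _ fun x ↦ ?_)
    by_cases hx : x ∈ tsupport (η i)
    · rw [Set.indicator_of_mem hx]
      exact hC x _
    · rw [Set.indicator_of_notMem hx, differential_eq_zero hx]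
      exact (norm_zero (E := ℝ)).le
  have i3 : ∀ i ∈ F, Integrable (fun x ↦ η i x * χ x * deriv Φ (v x) * inner ℝ (G x) (A x))
      (weightedVolume n φ) := by
    intro i _
    obtain ⟨C, hC⟩ := (hη i).1.2.exists_bound_of_continuous (hηc i)
    refine Integrable.bdd_mul (c := C * 1 * B) hGA
      (((hηc i).aestronglyMeasurable.mul hχm).mul hΦm') (ae_of_all _ fun x ↦ ?_)
    rw [norm_mul, norm_mul]
    have h0 := (norm_nonneg _).trans (hC x)
    gcongr
    · exact hC x
    · exact hχ1 x
    · exact hB' _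
  have i4 : ∀ i ∈ F, Integrable (fun x ↦ |η i x| * |Φ (v x)| * (2 * κ * ‖A x‖))
      (weightedVolume n φ) := by
    intro i _
    have h1 := (hAl.integrable_smul_right_of_hasCompactSupport (hηc i) (hη i).1.2).norm
    have h2 := (h1.mul_bdd (c := B) hΦm.norm (ae_of_all _ fun x ↦ by
      rw [norm_norm]; exact hB _)).const_mul (2 * κ)
    refine h2.congr (ae_of_all _ fun x ↦ ?_)
    simp only [smul_eq_mul, norm_mul, Real.norm_eq_abs, abs_norm]
    ring
  have s1 : ∫ x, f x * (Φ (v x) * χ x) ∂(weightedVolume n φ) =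
      ∑ i ∈ F, ∫ x, f x * (η i x * Φ (v x) * χ x) ∂(weightedVolume n φ) := by
    rw [← integral_finsetSum _ i1]
    refine integral_congr_ae (ae_of_all _ fun x ↦ ?_)
    simp only
    rcases eq_or_ne (χ x) 0 with h0 | h0
    · simp [h0]
    · calc f x * (Φ (v x) * χ x) = (∑ i ∈ F, η i x) * (f x * (Φ (v x) * χ x)) := by
            rw [hone x h0, one_mul]
        _ = _ := by
            rw [Finset.sum_mul]
            exact Finset.sum_congr rfl fun i _ ↦ by ring
  -- The terms created by localization cancel: the differentials of the η i sum to zero wherever χ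
  -- does not vanish.
  have s2 : ∑ i ∈ F, ∫ x, Φ (v x) * χ x * differential n (η i) x (A x) ∂(weightedVolume n φ) =
      0 := by
    rw [← integral_finsetSum _ i2]
    refine integral_eq_zero_of_ae (ae_of_all _ fun x ↦ ?_)
    simp only [Pi.zero_apply, ← Finset.mul_sum]
    rcases eq_or_ne (χ x) 0 with h0 | h0
    · simp [h0]
    · rw [sum_differential_eq_zero (fun i ↦ (hη i).1) hχ.continuous hone h0, mul_zero]
  have s3 : ∫ x, χ x * deriv Φ (v x) * inner ℝ (G x) (A x) ∂(weightedVolume n φ) =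
      ∑ i ∈ F, ∫ x, η i x * χ x * deriv Φ (v x) * inner ℝ (G x) (A x) ∂(weightedVolume n φ) := by
    rw [← integral_finsetSum _ i3]
    refine integral_congr_ae (ae_of_all _ fun x ↦ ?_)
    simp only [← Finset.sum_mul]
    rcases eq_or_ne (χ x) 0 with h0 | h0
    · simp [h0]
    · rw [hone x h0, one_mul]
  have s4 : ∫ x, (∑ i ∈ F, η i x) * |Φ (v x)| * (2 * κ * ‖A x‖) ∂(weightedVolume n φ) =
      ∑ i ∈ F, ∫ x, |η i x| * |Φ (v x)| * (2 * κ * ‖A x‖) ∂(weightedVolume n φ) := by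
    rw [← integral_finsetSum _ i4]
    refine integral_congr_ae (ae_of_all _ fun x ↦ ?_)
    simp only [Finset.sum_mul]
    exact Finset.sum_congr rfl fun i _ ↦ by rw [abs_of_nonneg ((hη i).2.2 x)]
  rw [s1, s3, s4, ← zero_add (∑ i ∈ F, ∫ x, η i x * χ x * deriv Φ (v x) * inner ℝ (G x) (A x)
    ∂(weightedVolume n φ)), ← s2, ← Finset.sum_add_distrib, ← Finset.sum_add_distrib]
  refine (Finset.abs_sum_le_sum_abs _ _).trans (Finset.sum_le_sum fun i _ ↦ ?_)
  exact abs_integral_local_test_le hφ hP hPt hP' hR hf hA hAP hG hGP hfA hχ hΦ hB hB'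
    (hη i).1 (hη i).2.1

end Partition

/-! ### Removal of the truncation and of the cutoff. -/

section Truncation

/-- A smooth cutoff function `β` on the line, together with a bound for `s β'(s)`. -/
lemma exists_smooth_cutoff : ∃ β : ℝ → ℝ, ContDiff ℝ ∞ β ∧ (∀ s, 0 ≤ β s) ∧ (∀ s, β s ≤ 1) ∧
    (∀ s, |s| ≤ 1 → β s = 1) ∧ (∀ s, 2 ≤ |s| → β s = 0) ∧
    (∀ s, |s| < 1 → deriv β s = 0) ∧ (∀ s, 2 < |s| → deriv β s = 0) ∧
    ∃ C, ∀ s, |s * deriv β s| ≤ C := by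
  let b : ContDiffBump (0 : ℝ) := ⟨1, 2, one_pos, one_lt_two⟩
  have h1 : ∀ s : ℝ, |s| ≤ 1 → b s = 1 := fun s hs ↦
    b.one_of_mem_closedBall (by simpa [Metric.mem_closedBall, Real.dist_eq] using hs)
  have h2 : ∀ s : ℝ, 2 ≤ |s| → b s = 0 := fun s hs ↦
    b.zero_of_le_dist (by simpa [Real.dist_eq] using hs)
  refine ⟨b, b.contDiff, fun s ↦ b.nonneg, fun s ↦ b.le_one, h1, h2, fun s hs ↦ ?_,
    fun s hs ↦ ?_, ?_⟩
  · have : (b : ℝ → ℝ) =ᶠ[𝓝 s] fun _ ↦ 1 := by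
      filter_upwards [(isOpen_lt continuous_abs continuous_const).mem_nhds hs] with t ht
      exact h1 t (le_of_lt ht)
    rw [this.deriv_eq, deriv_const]
  · have : (b : ℝ → ℝ) =ᶠ[𝓝 s] fun _ ↦ 0 := by
      filter_upwards [(isOpen_lt continuous_const continuous_abs).mem_nhds hs] with t ht
      exact h2 t (le_of_lt ht)
    rw [this.deriv_eq, deriv_const]
  · have hb : ContDiff ℝ 1 b := b.contDiff
    have hc : Continuous (deriv b) := hb.continuous_deriv le_rfl
    have hs : HasCompactSupport fun s : ℝ ↦ s * deriv b s := b.hasCompactSupport.deriv.mul_left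
    obtain ⟨C, hC⟩ := hs.exists_bound_of_continuous (by fun_prop)
    exact ⟨C, hC⟩

variable {β : ℝ → ℝ}

lemma hasDerivAt_mul_cutoff (hβ : ContDiff ℝ ∞ β) (c s : ℝ) :
    HasDerivAt (fun s ↦ s * β (c * s)) (β (c * s) + c * s * deriv β (c * s)) s := by
  have h := (hβ.differentiable (by simp) (c * s)).hasDerivAt
  have h2 := h.comp s ((hasDerivAt_id s).const_mul c)
  have h3 := (hasDerivAt_id s).mul h2
  have e : β (c * s) + c * s * deriv β (c * s) =
      1 * (β ∘ HMul.hMul c) s + id s * (deriv β (c * s) * (c * 1)) := by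
    simp only [Function.comp_apply, id]
    ring
  rw [e]
  exact h3

lemma hasDerivAt_mul_cutoff₂ (hβ : ContDiff ℝ ∞ β) (c s : ℝ) :
    HasDerivAt (fun s ↦ s * β (c⁻¹ * s) * (1 - β (c * s)))
      ((β (c⁻¹ * s) + c⁻¹ * s * deriv β (c⁻¹ * s)) * (1 - β (c * s)) -
        β (c⁻¹ * s) * (c * s * deriv β (c * s))) s := by
  have h := (hβ.differentiable (by simp) (c * s)).hasDerivAt
  have h2 := (h.comp s ((hasDerivAt_id s).const_mul c)).const_sub 1
  have h3 := (hasDerivAt_mul_cutoff hβ c⁻¹ s).mul h2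
  have e : (β (c⁻¹ * s) + c⁻¹ * s * deriv β (c⁻¹ * s)) * (1 - β (c * s)) -
        β (c⁻¹ * s) * (c * s * deriv β (c * s)) =
      (β (c⁻¹ * s) + c⁻¹ * s * deriv β (c⁻¹ * s)) * (1 - (β ∘ HMul.hMul c) s) +
        s * β (c⁻¹ * s) * -(deriv β (c * s) * (c * 1)) := by
    simp only [Function.comp_apply]
    ring
  rw [e]
  exact h3

variable {α : Type*} [MeasurableSpace α] {μ : Measure α}

lemma eventually_cutoff_large {s : ℝ} (hs : s ≠ 0) (a : ℝ) :
    ∀ᶠ m : ℕ in atTop, a < |((m : ℝ) + 1) * s| := by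
  have h : Tendsto (fun m : ℕ ↦ ((m : ℝ) + 1) * |s|) atTop atTop :=
    (tendsto_natCast_atTop_atTop.atTop_add tendsto_const_nhds).atTop_mul_const (abs_pos.2 hs)
  filter_upwards [h.eventually_gt_atTop a] with m hm
  rwa [abs_mul, abs_of_pos (by positivity : (0 : ℝ) < m + 1)]

lemma eventually_cutoff_small (s : ℝ) :
    ∀ᶠ m : ℕ in atTop, |((m : ℝ) + 1)⁻¹ * s| < 1 := by
  have h : Tendsto (fun m : ℕ ↦ |((m : ℝ) + 1)⁻¹ * s|) atTop (𝓝 |0 * s|) := by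
    have := tendsto_one_div_add_atTop_nhds_zero_nat (𝕜 := ℝ)
    simp only [one_div] at this
    exact (this.mul_const s).abs
  rw [zero_mul, abs_zero] at h
  exact h.eventually_lt_const one_pos

set_option maxHeartbeats 1000000 in
/-- Testing with truncations of `v` times cutoffs `χ k → 1` gives `∫ f v = -∫ h`, if the error
terms become small. -/
lemma integral_mul_eq_neg_of_test {f v h N : α → ℝ} (hfv : Integrable (fun x ↦ f x * v x) μ)
    (hh : Integrable h μ) {r P P' : ℝ≥0∞} [P.HolderTriple P' 1] (hr0 : r ≠ 0) (hrt : r ≠ ⊤)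
    (hv : MemLp v r μ) (hN : MemLp N P' μ) (hN0 : ∀ x, 0 ≤ N x)
    {χ ρ : ℕ → α → ℝ} {κ : ℕ → ℝ} (hκ0 : ∀ k, 0 ≤ κ k) (hκ : Tendsto κ atTop (𝓝 0))
    (hρ0 : ∀ k x, 0 ≤ ρ k x) (hρ1 : ∀ k x, ρ k x ≤ 1)
    (hρN : ∀ k, Integrable (fun x ↦ ρ k x * N x) μ)
    (hχm : ∀ k, AEStronglyMeasurable (χ k) μ) (hχ1 : ∀ k x, |χ k x| ≤ 1)
    (hfχ : ∀ k, Integrable (fun x ↦ f x * χ k x) μ)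
    (hχ : ∀ x, ∀ᶠ k in atTop, χ k x = 1)
    (htest : ∀ k, ∀ Φ : ℝ → ℝ, ContDiff ℝ ∞ Φ → ∀ B : ℝ, (∀ s, |Φ s| ≤ B) →
      (∀ s, |deriv Φ s| ≤ B) →
      |(∫ x, f x * (Φ (v x) * χ k x) ∂μ) + ∫ x, χ k x * deriv Φ (v x) * h x ∂μ| ≤
        ∫ x, ρ k x * |Φ (v x)| * (2 * κ k * N x) ∂μ) :
    ∫ x, f x * v x ∂μ = -∫ x, h x ∂μ := by
  obtain ⟨β, hβ, hβ0, hβ1, hβone, hβzero, hγ1, hγ2, C, hC⟩ := exists_smooth_cutoff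
  have hC0 : 0 ≤ C := (abs_nonneg _).trans (hC 0)
  have hc0 : ∀ m : ℕ, (0 : ℝ) < m + 1 := fun m ↦ by positivity
  have hβa : ∀ s, |β s| ≤ 1 := fun s ↦ abs_le.2 ⟨by linarith [hβ0 s], hβ1 s⟩
  have hβa' : ∀ s, |1 - β s| ≤ 1 := fun s ↦ abs_le.2 ⟨by linarith [hβ1 s], by linarith [hβ0 s]⟩
  have hvm := hv.1
  -- the contribution of the zero set of `v`
  have hzero : ∀ k, ∫ x, χ k x * (if v x = 0 then 1 else 0) * h x ∂μ = 0 := by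
    intro k
    -- These functions tend to zero uniformly while their derivatives tend boundedly to the
    -- indicator of {0}. With k fixed and m → ∞ every other term disappears, which is an integrated
    -- form of the fact that ∇v = 0 almost everywhere on {v = 0}.
    set Φ : ℕ → ℝ → ℝ := fun m s ↦ s * β ((m + 1) * s) with hΦ
    have hΦs : ∀ m, ContDiff ℝ ∞ (Φ m) := fun m ↦ by
      have := hβ
      rw [hΦ]
      fun_prop
    have hΦd : ∀ m s, deriv (Φ m) s =
        β ((m + 1) * s) + (m + 1) * s * deriv β ((m + 1) * s) := fun m s ↦
      (hasDerivAt_mul_cutoff hβ _ s).deriv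
    have hΦB : ∀ m s, |Φ m s| ≤ 2 / (m + 1) := fun m s ↦ by
      rcases le_or_gt 2 |(m + 1) * s| with h2 | h2
      · simp only [hΦ, hβzero _ h2, mul_zero, abs_zero]
        positivity
      · rw [abs_mul, abs_of_pos (hc0 m)] at h2
        rw [le_div_iff₀ (hc0 m), hΦ, abs_mul]
        calc |s| * |β ((m + 1) * s)| * (m + 1) ≤ |s| * 1 * (m + 1) := by
              gcongr
              exact hβa _
          _ ≤ 2 := by linarith
    have hΦB' : ∀ m s, |deriv (Φ m) s| ≤ 1 + C := fun m s ↦ by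
      rw [hΦd]
      exact (abs_add_le _ _).trans (add_le_add (hβa _) (hC _))
    have hΦB2 : ∀ m s, |Φ m s| ≤ 2 := fun m s ↦ (hΦB m s).trans (by
      rw [div_le_iff₀ (hc0 m)]
      have : (0 : ℝ) ≤ m := by positivity
      linarith)
    have hlimB : Tendsto (fun m : ℕ ↦ 2 / ((m : ℝ) + 1)) atTop (𝓝 0) := by
      have := (tendsto_one_div_add_atTop_nhds_zero_nat (𝕜 := ℝ)).const_mul 2
      simpa [div_eq_mul_inv] using this
    have hlimΦ : ∀ s, Tendsto (fun m ↦ Φ m s) atTop (𝓝 0) := fun s ↦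
      squeeze_zero_norm (fun m ↦ hΦB m s) hlimB
    have l1 : Tendsto (fun m ↦ ∫ x, f x * (Φ m (v x) * χ k x) ∂μ) atTop (𝓝 0) := by
      have := tendsto_integral_of_dominated_convergence (μ := μ)
        (F := fun m x ↦ f x * (Φ m (v x) * χ k x)) (f := fun _ ↦ (0 : ℝ))
        (fun x ↦ 2 * ‖f x * χ k x‖) (fun m ↦ ?_) ((hfχ k).norm.const_mul 2)
        (fun m ↦ ae_of_all _ fun x ↦ ?_) (ae_of_all _ fun x ↦ ?_)
      · simpa using this
      · refine ((hfχ k).1.mul ((hΦs m).continuous.comp_aestronglyMeasurable hvm)).congr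
          (ae_of_all _ fun x ↦ ?_)
        simp only [Pi.mul_apply]
        ring
      · rw [show f x * (Φ m (v x) * χ k x) = Φ m (v x) * (f x * χ k x) by ring, norm_mul]
        gcongr
        exact hΦB2 m _
      · have := ((hlimΦ (v x)).mul_const (χ k x)).const_mul (f x)
        simpa using this
    have l2 : Tendsto (fun m ↦ ∫ x, χ k x * deriv (Φ m) (v x) * h x ∂μ) atTop
        (𝓝 (∫ x, χ k x * (if v x = 0 then 1 else 0) * h x ∂μ)) := by
      refine tendsto_integral_of_dominated_convergence (fun x ↦ (1 + C) * ‖h x‖) (fun m ↦ ?_)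
        (hh.norm.const_mul _) (fun m ↦ ae_of_all _ fun x ↦ ?_) (ae_of_all _ fun x ↦ ?_)
      · exact ((hχm k).mul (((hΦs m).continuous_deriv (by simp)).comp_aestronglyMeasurable
          hvm)).mul hh.1
      · rw [norm_mul, norm_mul]
        gcongr
        calc ‖χ k x‖ * ‖deriv (Φ m) (v x)‖ ≤ 1 * (1 + C) :=
              mul_le_mul (hχ1 k x) (hΦB' m _) (norm_nonneg _) zero_le_one
          _ = 1 + C := one_mul _
      · refine Tendsto.mul_const _ (Tendsto.const_mul _ ?_)
        by_cases hx : v x = 0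
        · simp only [hx, hΦd, mul_zero, hβone 0 (by simp), zero_mul, add_zero, if_true]
          exact tendsto_const_nhds
        · rw [if_neg hx]
          refine tendsto_const_nhds.congr' ?_
          filter_upwards [eventually_cutoff_large hx 2] with m hm
          rw [hΦd, hβzero _ hm.le, hγ2 _ hm]
          ring
    have l3 : Tendsto (fun m : ℕ ↦ 2 / ((m : ℝ) + 1) * (2 * κ k * ∫ x, ρ k x * N x ∂μ)) atTop
        (𝓝 0) := by
      simpa using hlimB.mul_const (2 * κ k * ∫ x, ρ k x * N x ∂μ)
    have l4 := (l1.add l2).abs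
    rw [zero_add] at l4
    have hle := le_of_tendsto_of_tendsto' l4 l3 fun m ↦ by
      refine (htest k (Φ m) (hΦs m) (2 + C) (fun s ↦ (hΦB2 m s).trans (by linarith))
        (fun s ↦ (hΦB' m s).trans (by linarith))).trans ?_
      rw [← integral_const_mul, ← integral_const_mul]
      refine integral_mono_of_nonneg (ae_of_all _ fun x ↦ ?_)
        (((hρN k).const_mul _).const_mul _) (ae_of_all _ fun x ↦ ?_)
      · have := hρ0 k x
        have := hN0 x
        have := hκ0 k
        simp only [Pi.zero_apply]
        positivity
      · have h1 := hρ0 k x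
        have h2 := hN0 x
        have h3 := hκ0 k
        calc ρ k x * |Φ m (v x)| * (2 * κ k * N x) ≤
            ρ k x * (2 / (m + 1)) * (2 * κ k * N x) := by
              gcongr
              exact hΦB m _
          _ = _ := by ring
    exact abs_eq_zero.1 (le_antisymm hle (abs_nonneg _))
  have hindm : AEStronglyMeasurable (fun x ↦ if v x = 0 then (1 : ℝ) else 0) μ := by
    have : Measurable fun s : ℝ ↦ if s = 0 then (1 : ℝ) else 0 :=
      Measurable.ite (measurableSet_singleton 0) measurable_const measurable_const
    exact (this.comp_aemeasurable hvm.aemeasurable).aestronglyMeasurable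
  have hind : ∀ x, |if v x = 0 then (1 : ℝ) else 0| ≤ 1 := fun x ↦ by split_ifs <;> simp
  have hzero' : ∫ x, (if v x = 0 then 1 else 0) * h x ∂μ = 0 := by
    have hl : Tendsto (fun k ↦ ∫ x, χ k x * (if v x = 0 then 1 else 0) * h x ∂μ) atTop
        (𝓝 (∫ x, (if v x = 0 then 1 else 0) * h x ∂μ)) := by
      refine tendsto_integral_of_dominated_convergence (fun x ↦ ‖h x‖)
        (fun k ↦ ((hχm k).mul hindm).mul hh.1) hh.norm (fun k ↦ ae_of_all _ fun x ↦ ?_)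
        (ae_of_all _ fun x ↦ ?_)
      · rw [norm_mul, norm_mul]
        refine mul_le_of_le_one_left (norm_nonneg _) ?_
        exact mul_le_one₀ (hχ1 k x) (norm_nonneg _) (hind x)
      · refine tendsto_const_nhds.congr' ?_
        filter_upwards [hχ x] with k hk
        rw [hk, one_mul]
    simp only [hzero] at hl
    exact tendsto_nhds_unique hl tendsto_const_nhds |>.symm ▸ rfl
  -- the contribution of the set where `v ≠ 0`
  set Φ : ℕ → ℝ → ℝ := fun m s ↦ s * β ((m + 1 : ℝ)⁻¹ * s) * (1 - β ((m + 1) * s)) with hΦ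
  have hΦs : ∀ m, ContDiff ℝ ∞ (Φ m) := fun m ↦ by
    have := hβ
    rw [hΦ]
    fun_prop
  have hΦd : ∀ m s, deriv (Φ m) s =
      (β ((m + 1 : ℝ)⁻¹ * s) + (m + 1 : ℝ)⁻¹ * s * deriv β ((m + 1 : ℝ)⁻¹ * s)) *
        (1 - β ((m + 1) * s)) -
        β ((m + 1 : ℝ)⁻¹ * s) * ((m + 1) * s * deriv β ((m + 1) * s)) := fun m s ↦
    (hasDerivAt_mul_cutoff₂ hβ _ s).deriv
  have hΦB' : ∀ m s, |deriv (Φ m) s| ≤ 1 + 2 * C := fun m s ↦ by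
    rw [hΦd]
    refine (abs_sub _ _).trans ?_
    rw [abs_mul, abs_mul (β _)]
    have h1 : |β ((m + 1 : ℝ)⁻¹ * s) + (m + 1 : ℝ)⁻¹ * s * deriv β ((m + 1 : ℝ)⁻¹ * s)| ≤ 1 + C :=
      (abs_add_le _ _).trans (add_le_add (hβa _) (hC _))
    have h2 := mul_le_mul h1 (hβa' ((m + 1) * s)) (abs_nonneg _) (by positivity)
    have h3 := mul_le_mul (hβa ((m + 1 : ℝ)⁻¹ * s)) (hC ((m + 1) * s)) (abs_nonneg _) zero_le_one
    linarith
  have hΦle : ∀ m s, |Φ m s| ≤ |s| := fun m s ↦ by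
    rw [hΦ, abs_mul, abs_mul]
    have h2 := mul_le_one₀ (hβa ((m + 1 : ℝ)⁻¹ * s)) (abs_nonneg _) (hβa' ((m + 1) * s))
    rw [mul_assoc]
    exact mul_le_of_le_one_right (abs_nonneg _) h2
  have hΦB : ∀ m s, |Φ m s| ≤ 2 * (m + 1) := fun m s ↦ by
    rcases le_or_gt 2 |(m + 1 : ℝ)⁻¹ * s| with h2 | h2
    · simp only [hΦ, hβzero _ h2, mul_zero, zero_mul, abs_zero]
      positivity
    · rw [abs_mul, abs_of_pos (inv_pos.2 (hc0 m)), inv_mul_lt_iff₀ (hc0 m)] at h2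
      exact (hΦle m s).trans (by linarith)
  have hΦ0 : ∀ (m : ℕ) (s : ℝ), |s| < (m + 1 : ℝ)⁻¹ → Φ m s = 0 := fun m s hs ↦ by
    have h1 : |(m + 1) * s| ≤ 1 := by
      rw [abs_mul, abs_of_pos (hc0 m)]
      rw [← one_div, lt_div_iff₀ (hc0 m)] at hs
      linarith
    simp only [hΦ, hβone _ h1, sub_self, mul_zero]
  have hΦm : ∀ m, AEStronglyMeasurable (fun x ↦ Φ m (v x)) μ := fun m ↦
    (hΦs m).continuous.comp_aestronglyMeasurable hvm
  have hΦm' : ∀ m, AEStronglyMeasurable (fun x ↦ deriv (Φ m) (v x)) μ := fun m ↦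
    ((hΦs m).continuous_deriv (by simp)).comp_aestronglyMeasurable hvm
  -- Only v ∈ L^r is known, not v ∈ L^P. But Φ m is bounded and vanishes near 0, so Φ m (v) is
  -- bounded with support in a set of finite measure, hence lies in L^P. This makes the cutoff error
  -- a constant multiple of κ k.
  have hΦN : ∀ m, Integrable (fun x ↦ |Φ m (v x)| * N x) μ := by
    intro m
    have h1 : MemLp (fun x ↦ Φ m (v x)) ⊤ μ :=
      memLp_top_of_bound (hΦm m) _ (ae_of_all _ fun x ↦ hΦB m (v x))
    have h2 : MemLp (fun x ↦ Φ m (v x)) P μ := by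
      refine h1.mono_exponent_of_measure_support_ne_top
        (s := {x | (m + 1 : ℝ)⁻¹ ≤ ‖v x‖}) (fun x hx ↦ hΦ0 m _ (not_le.1 hx)) ?_ le_top
      have h3 := hv.meas_ge_lt_top (ε := (m + 1 : ℝ).toNNReal⁻¹) hr0 hrt (by positivity)
      refine ne_top_of_le_ne_top h3.ne (measure_mono fun x hx ↦ ?_)
      have hx' : (m + 1 : ℝ)⁻¹ ≤ ‖v x‖ := hx
      change _ ≤ ‖v x‖₊
      rw [← NNReal.coe_le_coe, NNReal.coe_inv, Real.coe_toNNReal _ (hc0 m).le]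
      exact hx'
    exact (h2.norm.integrable_mul hN).congr (ae_of_all _ fun x ↦ rfl)
  -- The order of the limits matters: k → ∞ with m fixed removes the cutoff error, whose constant
  -- depends on m; only then m → ∞.
  have heq : ∀ m, (∫ x, f x * Φ m (v x) ∂μ) + ∫ x, deriv (Φ m) (v x) * h x ∂μ = 0 := by
    intro m
    have l1 : Tendsto (fun k ↦ ∫ x, f x * (Φ m (v x) * χ k x) ∂μ) atTop
        (𝓝 (∫ x, f x * Φ m (v x) ∂μ)) := by
      refine tendsto_integral_of_dominated_convergence (fun x ↦ ‖f x * v x‖) (fun k ↦ ?_)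
        hfv.norm (fun k ↦ ae_of_all _ fun x ↦ ?_) (ae_of_all _ fun x ↦ ?_)
      · refine ((hfχ k).1.mul (hΦm m)).congr (ae_of_all _ fun x ↦ ?_)
        simp only [Pi.mul_apply]
        ring
      · rw [norm_mul (f x), norm_mul (f x)]
        refine mul_le_mul_of_nonneg_left ?_ (norm_nonneg (f x))
        rw [norm_mul]
        calc ‖Φ m (v x)‖ * ‖χ k x‖ ≤ ‖v x‖ * 1 :=
              mul_le_mul (hΦle m _) (hχ1 k x) (norm_nonneg _) (norm_nonneg _)
          _ = ‖v x‖ := mul_one _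
      · refine tendsto_const_nhds.congr' ?_
        filter_upwards [hχ x] with k hk
        rw [hk, mul_one]
    have l2 : Tendsto (fun k ↦ ∫ x, χ k x * deriv (Φ m) (v x) * h x ∂μ) atTop
        (𝓝 (∫ x, deriv (Φ m) (v x) * h x ∂μ)) := by
      refine tendsto_integral_of_dominated_convergence (fun x ↦ (1 + 2 * C) * ‖h x‖)
        (fun k ↦ ((hχm k).mul (hΦm' m)).mul hh.1)
        (hh.norm.const_mul _) (fun k ↦ ae_of_all _ fun x ↦ ?_) (ae_of_all _ fun x ↦ ?_)
      · rw [norm_mul, norm_mul]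
        gcongr
        calc ‖χ k x‖ * ‖deriv (Φ m) (v x)‖ ≤ 1 * (1 + 2 * C) :=
              mul_le_mul (hχ1 k x) (hΦB' m _) (norm_nonneg _) zero_le_one
          _ = 1 + 2 * C := one_mul _
      · refine tendsto_const_nhds.congr' ?_
        filter_upwards [hχ x] with k hk
        rw [hk, one_mul]
    have l3 : Tendsto (fun k : ℕ ↦ κ k * (2 * ∫ x, |Φ m (v x)| * N x ∂μ)) atTop (𝓝 0) := by
      simpa using hκ.mul_const (2 * ∫ x, |Φ m (v x)| * N x ∂μ)
    have hle := le_of_tendsto_of_tendsto' (l1.add l2).abs l3 fun k ↦ by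
      refine (htest k (Φ m) (hΦs m) (max (2 * (m + 1)) (1 + 2 * C))
        (fun s ↦ (hΦB m s).trans (le_max_left _ _))
        (fun s ↦ (hΦB' m s).trans (le_max_right _ _))).trans ?_
      rw [← integral_const_mul, ← integral_const_mul]
      refine integral_mono_of_nonneg (ae_of_all _ fun x ↦ ?_)
        (((hΦN m).const_mul _).const_mul _) (ae_of_all _ fun x ↦ ?_)
      · have := hρ0 k x
        have := hN0 x
        have := hκ0 k
        simp only [Pi.zero_apply]
        positivity
      · have h1 := hρ0 k x
        have h2 := hN0 x
        have h3 := hκ0 k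
        calc ρ k x * |Φ m (v x)| * (2 * κ k * N x) ≤
            1 * |Φ m (v x)| * (2 * κ k * N x) := by
              gcongr
              exact hρ1 k x
          _ = _ := by ring
    exact abs_eq_zero.1 (le_antisymm hle (abs_nonneg _))
  have l1 : Tendsto (fun m ↦ ∫ x, f x * Φ m (v x) ∂μ) atTop (𝓝 (∫ x, f x * v x ∂μ)) := by
    have hfm : ∀ m, AEStronglyMeasurable (fun x ↦ f x * Φ m (v x)) μ := fun m ↦ by
      -- Measurability is inherited from f v by writing f Φ(v) = (f v) (Φ(v) / v); both sides are
      -- zero where v = 0.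
      have hg : Measurable fun s : ℝ ↦ Φ m s / s :=
        (hΦs m).continuous.measurable.div measurable_id
      refine (hfv.1.mul (hg.comp_aemeasurable hvm.aemeasurable).aestronglyMeasurable).congr
        (ae_of_all _ fun x ↦ ?_)
      simp only [Pi.mul_apply, Function.comp_apply]
      rcases eq_or_ne (v x) 0 with h0 | h0
      · simp [hΦ, h0]
      · field_simp
    refine tendsto_integral_of_dominated_convergence (fun x ↦ ‖f x * v x‖) hfm hfv.norm
      (fun m ↦ ae_of_all _ fun x ↦ ?_) (ae_of_all _ fun x ↦ ?_)
    · rw [norm_mul (f x), norm_mul (f x)]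
      exact mul_le_mul_of_nonneg_left (hΦle m _) (norm_nonneg (f x))
    · rcases eq_or_ne (v x) 0 with h0 | h0
      · simp [hΦ, h0]
      · refine tendsto_const_nhds.congr' ?_
        filter_upwards [eventually_cutoff_large h0 2, eventually_cutoff_small (v x)] with m h2 h1
        simp only [hΦ, hβzero _ h2.le, hβone _ h1.le, sub_zero, mul_one]
  have l2 : Tendsto (fun m ↦ ∫ x, deriv (Φ m) (v x) * h x ∂μ) atTop
      (𝓝 (∫ x, (1 - if v x = 0 then 1 else 0) * h x ∂μ)) := by
    refine tendsto_integral_of_dominated_convergence (fun x ↦ (1 + 2 * C) * ‖h x‖)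
      (fun m ↦ (hΦm' m).mul hh.1) (hh.norm.const_mul _) (fun m ↦ ae_of_all _ fun x ↦ ?_)
      (ae_of_all _ fun x ↦ ?_)
    · rw [norm_mul]
      gcongr
      exact hΦB' m _
    · refine Tendsto.mul_const _ ?_
      rcases eq_or_ne (v x) 0 with h0 | h0
      · simp [hΦd, h0, hβone 0 (by simp)]
      · rw [if_neg h0, sub_zero]
        refine tendsto_const_nhds.congr' ?_
        filter_upwards [eventually_cutoff_large h0 2, eventually_cutoff_small (v x)] with m h2 h1
        rw [hΦd, hβzero _ h2.le, hβone _ h1.le, hγ1 _ h1, hγ2 _ h2]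
        ring
  have hlim := l1.add l2
  simp only [heq] at hlim
  have h0 := tendsto_nhds_unique hlim tendsto_const_nhds
  -- The truncations recover h only where v ≠ 0; the rest contributes nothing by `hzero'`.
  have hsub : ∫ x, (1 - if v x = 0 then 1 else 0) * h x ∂μ = ∫ x, h x ∂μ := by
    have h1 : Integrable (fun x ↦ (if v x = 0 then 1 else 0) * h x) μ :=
      hh.bdd_mul hindm (ae_of_all _ hind)
    simp only [sub_mul, one_mul]
    rw [integral_sub hh h1, hzero', sub_zero]
  rw [hsub] at h0
  linarith

end Truncation

/-! ### Solutions of the equation and positivity of their energy. -/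

section Solution

variable {n : ℕ} {M : Type*} [EMetricSpace M] [ChartedSpace (EuclideanSpace ℝ (Fin n)) M]
  [IsManifold (𝓡 n) ∞ M] [RiemannianBundle (fun x : M ↦ TangentSpace (𝓡 n) x)]
  [IsContMDiffRiemannianBundle (𝓡 n) ∞ (EuclideanSpace ℝ (Fin n))
      (fun x : M ↦ TangentSpace (𝓡 n) x)]
  [MeasurableSpace M]

lemma WeakGradMemLp.hasWeakGradient {φ v : M → ℝ} {r : ℝ} (h : WeakGradMemLp n φ r v) :
    HasWeakGradient v (weakGrad n v) := by
  rw [weakGrad, dif_pos h.1]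
  exact h.1.choose_spec

variable [BorelSpace M]

lemma MemW₀.memLp {φ v : M → ℝ} {r : ℝ} (h : MemW₀ n φ r v) :
    MemLp v (ENNReal.ofReal r) (weightedVolume n φ) := h.1.1

/-- The weight e^(-φ) is positive, so the weighted and the Riemannian volume have the same null
sets. -/
lemma energyI_pos_iff {φ f : M → ℝ} (hφ : Continuous φ) {q : ℝ} (hq : 0 < q)
    (hf : MemLp f (ENNReal.ofReal (q + 1)) (weightedVolume n φ)) :
    0 < energyI n φ q f ↔ ¬ f =ᵐ[riemannianVolume n M] 0 := by
  have h0 : 0 ≤ energyI n φ q f := integral_nonneg fun x ↦ Real.rpow_nonneg (abs_nonneg _) _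
  have h1 : energyI n φ q f = 0 ↔ f =ᵐ[riemannianVolume n M] 0 := by
    rw [energyI, integral_eq_zero_iff_of_nonneg
      (fun x ↦ Real.rpow_nonneg (abs_nonneg _) _) (integrable_abs_rpow hq hf), EventuallyEq,
      EventuallyEq, ae_weightedVolume_iff hφ]
    refine eventually_congr (Eventually.of_forall fun x ↦ ?_)
    simp only [Pi.zero_apply]
    rw [Real.rpow_eq_zero (abs_nonneg _) (by linarith), abs_eq_zero]
  rw [← h1, lt_iff_le_and_ne]
  exact ⟨fun h h2 ↦ h.2 h2.symm, fun h ↦ ⟨h0, fun h2 ↦ h h2.symm⟩⟩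

variable [SecondCountableTopology M] [IsRiemannianManifold (𝓡 n) M] [CompleteSpace M]

/-- On a complete manifold, `f = e^φ div (e^{-φ} A)` can be tested with every `v` for which the
integrals make sense. -/
lemma integral_mul_eq_neg_integral_inner {φ : M → ℝ} (hφ : Continuous φ) {P P' r R : ℝ≥0∞}
    [P.HolderTriple P' 1] [r.HolderTriple R 1] (hP : 1 ≤ P) (hPt : P ≠ ⊤) (hP' : 1 ≤ P')
    (hR : 1 ≤ R) (hr : 1 ≤ r) (hrt : r ≠ ⊤)
    {f v : M → ℝ} (hf : MemLp f R (weightedVolume n φ)) (hv : MemLp v r (weightedVolume n φ))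
    {A G : ∀ x : M, TangentSpace (𝓡 n) x} (hA : MeasurableField A)
    (hAP : MemLp (fun x ↦ ‖A x‖) P' (weightedVolume n φ)) (hG : HasWeakGradient v G)
    (hGP : MemLp (fun x ↦ ‖G x‖) P (weightedVolume n φ))
    (hfA : ∀ ψ : M → ℝ, IsTestFunction n ψ → ∫ x, f x * ψ x ∂(weightedVolume n φ) =
      -∫ x, differential n ψ x (A x) ∂(weightedVolume n φ)) :
    ∫ x, f x * v x ∂(weightedVolume n φ) =
      -∫ x, inner ℝ (G x) (A x) ∂(weightedVolume n φ) := by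
  have hfinm := isLocallyFiniteMeasure_weightedVolume (n := n) hφ
  obtain ⟨χ, hχL, hχ0, hχ1, hχc, hχ⟩ := exists_cutoff_manifold n (M := M)
  have hχa : ∀ k x, |χ k x| ≤ 1 := fun k x ↦ abs_le.2 ⟨by linarith [hχ0 k x], hχ1 k x⟩
  choose ρ hρc hρs hρ0 hρ1 htest using fun k ↦
    exists_abs_integral_test_le hφ hP hPt hP' hR hf hv.1 hA hAP hG hGP hfA (hχL k) (hχc k) (hχa k)
  have hGA : Integrable (fun x ↦ (inner ℝ (G x) (A x) : ℝ)) (weightedVolume n φ) := by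
    refine (hGP.integrable_mul hAP).mono'
      (hG.measurableField.aestronglyMeasurable_inner hφ hA) (ae_of_all _ fun x ↦ ?_)
    exact norm_inner_le_norm _ _
  have hfv : Integrable (fun x ↦ f x * v x) (weightedVolume n φ) :=
    (hv.integrable_mul hf).congr (ae_of_all _ fun x ↦ mul_comm _ _)
  refine integral_mul_eq_neg_of_test hfv hGA (P := P) (P' := P') (one_pos.trans_le hr).ne' hrt hv
    hAP (fun x ↦ norm_nonneg _) (χ := χ) (ρ := ρ)
    (κ := fun k : ℕ ↦ ((((k : NNReal) + 1)⁻¹ : NNReal) : ℝ)) (fun k ↦ NNReal.coe_nonneg _) ?_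
    hρ0 hρ1 (fun k ↦ ?_) (fun k ↦ (hχL k).continuous.aestronglyMeasurable) hχa (fun k ↦ ?_) hχ htest
  · have := tendsto_one_div_add_atTop_nhds_zero_nat (𝕜 := ℝ)
    simpa using this
  · refine ((hAP.locallyIntegrable hP').integrable_smul_left_of_hasCompactSupport
      (hρc k) (hρs k)).congr (ae_of_all _ fun x ↦ rfl)
  · exact (hf.locallyIntegrable hR).integrable_smul_right_of_hasCompactSupport
      (hχL k).continuous (hχc k)

/-- On a complete manifold, `f = L_{p,φ} v₀` can be tested with every `v` for which the
integrals make sense. -/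
lemma IsWeightedPLaplacian.integral_mul_eq {φ : M → ℝ} (hφ : Continuous φ) {p : ℝ} (hp : 1 < p)
    {r R : ℝ≥0∞} [r.HolderTriple R 1] (hR : 1 ≤ R) (hr : 1 ≤ r) (hrt : r ≠ ⊤) {f v v₀ : M → ℝ}
    (h : IsWeightedPLaplacian n φ p v₀ f) (hf : MemLp f R (weightedVolume n φ))
    (hv : MemLp v r (weightedVolume n φ)) (hv₀ : WeakGradMemLp n φ p v₀)
    (hvG : WeakGradMemLp n φ p v) :
    ∫ x, f x * v x ∂(weightedVolume n φ) =
      -∫ x, ‖weakGrad n v₀ x‖ ^ (p - 2) * inner ℝ (weakGrad n v x) (weakGrad n v₀ x)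
        ∂(weightedVolume n φ) := by
  have hp0 : 0 < p - 1 := by linarith
  have hp1 : p - 1 + 1 = p := sub_add_cancel p 1
  -- The facts about the exponents q + 1 and (q + 1)/q are reused with p - 1 in place of q, where
  -- they concern p and p/(p - 1).
  have hHT : (ENNReal.ofReal p).HolderTriple (ENNReal.ofReal (p / (p - 1))) 1 := by
    have := (holderConjugate_signedPow hp0).symm.ennrealOfReal
    rwa [hp1] at this
  have hP' : 1 ≤ ENNReal.ofReal (p / (p - 1)) := by
    have := one_le_ofReal_conj hp0
    rwa [hp1] at this
  have hG₀ := hv₀.2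
  have hA : MemLp (fun x ↦ ‖‖weakGrad n v₀ x‖ ^ (p - 2) • weakGrad n v₀ x‖)
      (ENNReal.ofReal (p / (p - 1))) (weightedVolume n φ) := by
    have h1 := memLp_signedPow hp0 (f := fun x ↦ ‖weakGrad n v₀ x‖) (by rw [hp1]; exact hG₀)
    rw [hp1] at h1
    refine h1.ae_eq (ae_of_all _ fun x ↦ ?_)
    simp only [signedPow]
    rw [norm_smul, abs_norm, Real.norm_of_nonneg (Real.rpow_nonneg (norm_nonneg _) _)]
    congr 2
    ring
  have hc : AEStronglyMeasurable (fun x ↦ ‖weakGrad n v₀ x‖ ^ (p - 2)) (weightedVolume n φ) :=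
    (hG₀.1.aemeasurable.pow_const _).aestronglyMeasurable
  have key := integral_mul_eq_neg_integral_inner hφ (P := ENNReal.ofReal p)
    (P' := ENNReal.ofReal (p / (p - 1))) (by simpa using hp.le) ENNReal.ofReal_ne_top hP' hR hr
    hrt hf hv (hv₀.hasWeakGradient.measurableField.smul hφ hc) hA hvG.hasWeakGradient hvG.2
    fun ψ hψ ↦ by
      rw [h ψ hψ]
      congr 1
      refine integral_congr_ae (ae_of_all _ fun x ↦ ?_)
      exact (map_smul (differential n ψ x) _ _).symm
  rw [key]
  congr 1
  refine integral_congr_ae (ae_of_all _ fun x ↦ ?_)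
  exact real_inner_smul_right _ _ _

/-- Hölder's inequality for the pairing of gradients. -/
lemma integral_norm_rpow_mul_inner_le {φ : M → ℝ} (hφ : Continuous φ) {p : ℝ} (hp : 1 < p)
    {v v₀ : M → ℝ} (hv₀ : WeakGradMemLp n φ p v₀) (hv : WeakGradMemLp n φ p v) :
    ∫ x, ‖weakGrad n v₀ x‖ ^ (p - 2) * inner ℝ (weakGrad n v x) (weakGrad n v₀ x)
        ∂(weightedVolume n φ) ≤
      (∫ x, ‖weakGrad n v₀ x‖ ^ p ∂(weightedVolume n φ)) ^ (1 - 1 / p) *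
        (∫ x, ‖weakGrad n v x‖ ^ p ∂(weightedVolume n φ)) ^ (1 / p) := by
  have hp0 : 0 < p - 1 := by linarith
  have hp1 : p - 1 + 1 = p := sub_add_cancel p 1
  have hh := integral_mul_signedPow_le (μ := weightedVolume n φ) hp0
    (f := fun x ↦ ‖weakGrad n v x‖) (h := fun x ↦ ‖weakGrad n v₀ x‖)
    (by rw [hp1]; exact hv.2) (by rw [hp1]; exact hv₀.2)
  rw [hp1] at hh
  simp only [abs_norm] at hh
  rw [mul_comm, show (p - 1) / p = 1 - 1 / p by field_simp] at hh
  refine le_trans ?_ hh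
  have hm := memLp_signedPow (μ := weightedVolume n φ) hp0 (f := fun x ↦ ‖weakGrad n v₀ x‖)
    (by rw [hp1]; exact hv₀.2)
  have hHT := holderTriple_conj hp0
  have hint : Integrable (fun x ↦ signedPow (p - 1) ‖weakGrad n v₀ x‖ * ‖weakGrad n v x‖)
      (weightedVolume n φ) := by
    have hv' : MemLp (fun x ↦ ‖weakGrad n v x‖) (ENNReal.ofReal (p - 1 + 1))
        (weightedVolume n φ) := by rw [hp1]; exact hv.2
    exact hm.integrable_mul hv'
  have hle : ∀ x, ‖‖weakGrad n v₀ x‖ ^ (p - 2) * inner ℝ (weakGrad n v x) (weakGrad n v₀ x)‖ ≤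
      signedPow (p - 1) ‖weakGrad n v₀ x‖ * ‖weakGrad n v x‖ := fun x ↦ by
    rw [norm_mul, Real.norm_of_nonneg (Real.rpow_nonneg (norm_nonneg _) _), signedPow, abs_norm,
      show p - 1 - 1 = p - 2 by ring, mul_assoc]
    refine mul_le_mul_of_nonneg_left ?_ (Real.rpow_nonneg (norm_nonneg _) _)
    exact (norm_inner_le_norm _ _).trans_eq (mul_comm _ _)
  refine integral_mono (hint.mono' ?_ (ae_of_all _ hle)) hint fun x ↦ (le_abs_self _).trans (hle x)
  exact (hv₀.2.1.aemeasurable.pow_const _).aestronglyMeasurable.mul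
    (hv.hasWeakGradient.measurableField.aestronglyMeasurable_inner hφ
      hv₀.hasWeakGradient.measurableField)

variable {φ : M → ℝ} {p q : ℝ} {u : ℝ → M → ℝ} {J : Set ℝ}

/-- The energy stays positive, forever if `δ ≥ 0` and up to the extinction bound if `δ < 0`. -/
lemma IsSolution.energyI_pos (hφ : Continuous φ) (hp : 1 < p) (hq : 0 < q)
    (hu : IsSolution n φ p q J u) {a T : ℝ} (haT : a ≤ T) (hJ : Set.Icc a T ⊆ J)
    (ha : 0 < energyI n φ q (u a))
    (hδ : q * (p - 1) - 1 < 0 →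
      0 < 1 - (q * (p - 1) - 1) * frequency n φ p q (u a) * (T - a)) :
    0 < energyI n φ q (u T) := by
  obtain ⟨ut, hut⟩ := hu
  have hHT := holderTriple_conj hq
  have hm : ∀ t ∈ Set.Icc a T, MemLp (u t) (ENNReal.ofReal (q + 1)) (weightedVolume n φ) :=
    fun t ht ↦ (hut t (hJ ht)).1.memLp
  have hmt : ∀ t ∈ Set.Icc a T, MemLp (ut t) (ENNReal.ofReal (q + 1)) (weightedVolume n φ) :=
    fun t ht ↦ (hut t (hJ ht)).2.1.memLp
  have hcd : ∀ t ∈ Set.Icc a T,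
      CurveDeriv (weightedVolume n φ) (q + 1) (Set.Icc a T) u t (ut t) := fun t ht ↦
    (hut t (hJ ht)).2.2.2.1.mono_left (nhdsWithin_mono _ (Set.sdiff_subset_sdiff_left hJ))
  -- The equation at time t is tested with u(s)^q from another time s. This function lies in the
  -- space dual to that of u_t and has gradient in L^p, which is all that testing on a complete
  -- manifold requires.
  have hpair : ∀ s ∈ Set.Icc a T, ∀ t ∈ Set.Icc a T,
      ∫ x, signedPow q (u s x) * ut t x ∂(weightedVolume n φ) =
        -∫ x, ‖weakGrad n (fun x ↦ signedPow q (u t x)) x‖ ^ (p - 2) *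
          inner ℝ (weakGrad n (fun x ↦ signedPow q (u s x)) x)
            (weakGrad n (fun x ↦ signedPow q (u t x)) x) ∂(weightedVolume n φ) := by
    intro s hs t ht
    rw [← (hut t (hJ ht)).2.2.2.2.integral_mul_eq hφ hp (one_le_ofReal_add_one hq)
      (one_le_ofReal_conj hq) ENNReal.ofReal_ne_top (hmt t ht) (memLp_signedPow hq (hm s hs))
      (hut t (hJ ht)).2.2.1 (hut s (hJ hs)).2.2.1]
    exact integral_congr_ae (ae_of_all _ fun x ↦ mul_comm _ _)
  have hself : ∀ t ∈ Set.Icc a T, ∫ x, signedPow q (u t x) * ut t x ∂(weightedVolume n φ) =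
      energyD n φ p q (u t) := by
    intro t ht
    rw [hpair t ht t ht, energyD]
    congr 1
    refine integral_congr_ae (ae_of_all _ fun x ↦ ?_)
    simp only
    rw [real_inner_self_eq_norm_sq]
    -- Where the gradient vanishes both sides are zero, whatever value the power p - 2 of zero has
    -- by convention.
    rcases (norm_nonneg (weakGrad n (fun x ↦ signedPow q (u t x)) x)).eq_or_lt with h0 | h0
    · rw [← h0, Real.zero_rpow (by linarith : p ≠ 0)]
      simp
    · rw [← Real.rpow_natCast, ← Real.rpow_add h0]
      norm_num
  refine energy_pos (E := fun t ↦ -energyD n φ p q (u t)) (I := fun t ↦ energyI n φ q (u t))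
    (g := fun s t ↦ ∫ x, signedPow q (u s x) * u t x ∂(weightedVolume n φ))
    (g' := fun s t ↦ ∫ x, signedPow q (u s x) * ut t x ∂(weightedVolume n φ)) hp hq haT
    (fun t _ ↦ integral_nonneg fun x ↦ Real.rpow_nonneg (abs_nonneg _) _) ha
    (fun t _ ↦ ?_) (fun t ht ↦ ?_) (fun s hs t ht ↦ ?_) (fun s hs ↦ ?_) (fun s hs t ht ↦ ?_)
    (fun s hs t ht ↦ ?_) fun h ↦ ?_
  · rw [energyD, neg_neg]
    exact integral_nonneg fun x ↦ Real.rpow_nonneg (norm_nonneg _) _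
  · have h1 := (hcd t ht).hasDerivWithinAt_energy hq hm ht (hmt t ht)
    rw [hself t ht] at h1
    simp only [mul_neg, neg_neg]
    exact h1
  · exact (hcd t ht).hasDerivWithinAt_integral hq hm ht (hmt t ht) (memLp_signedPow hq (hm s hs))
  · exact integral_congr_ae (ae_of_all _ fun x ↦ signedPow_mul_self hq _)
  · exact integral_mul_signedPow_le hq (hm t ht) (hm s hs)
  · rw [hpair s hs t ht, neg_neg, energyD, energyD, neg_neg, neg_neg]
    exact integral_norm_rpow_mul_inner_le hφ hp (hut t (hJ ht)).2.2.1 (hut s (hJ hs)).2.2.1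
  · refine (hδ h).trans_eq ?_
    rw [frequency]
    ring

/-- For N δ ≤ 0 there is nothing to exclude; otherwise the bound in the extended reals says t - a <
1/(N δ). -/
lemma one_sub_pos_of_lt_extinctionBound {a t N δ : ℝ} {b : EReal} (hat : a ≤ t)
    (ht : (t : EReal) < extinctionBound a b N δ) : 0 < 1 - δ * N * (t - a) := by
  rcases le_or_gt (N * δ) 0 with h | h
  · have := mul_nonpos_of_nonpos_of_nonneg h (sub_nonneg.2 hat)
    linarith
  · have h1 := ht.trans_le (min_le_left _ _)
    rw [← ENNReal.ofReal_inv_of_pos h, EReal.coe_ennreal_ofReal, max_eq_left (inv_pos.2 h).le,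
      ← EReal.coe_add, EReal.coe_lt_coe_iff] at h1
    have h2 : t - a < (N * δ)⁻¹ := by linarith
    rw [← one_div, lt_div_iff₀ h] at h2
    linarith

end Solution

end DoublyNonlinear

end

/-! ### Forward nonvanishing and backward uniqueness. -/

theorem corollary2 {n : ℕ} {M : Type*} [EMetricSpace M]
    [ChartedSpace (EuclideanSpace ℝ (Fin n)) M] [IsManifold (𝓡 n) ∞ M]
    [RiemannianBundle (fun x : M ↦ TangentSpace (𝓡 n) x)]
    [IsContMDiffRiemannianBundle (𝓡 n) ∞ (EuclideanSpace ℝ (Fin n))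
      (fun x : M ↦ TangentSpace (𝓡 n) x)]
    [IsRiemannianManifold (𝓡 n) M] [CompleteSpace M] [SecondCountableTopology M]
    [MeasurableSpace M] [BorelSpace M]
    (φ : M → ℝ) (hφ : ContMDiff (𝓡 n) 𝓘(ℝ, ℝ) ∞ φ)
    (p q : ℝ) (hp : 1 < p) (hq : 0 < q)
    (a : ℝ) (b : EReal) (hab : (a : EReal) < b) (u : ℝ → M → ℝ)
    (hu : DoublyNonlinear.IsSolution n φ p q (DoublyNonlinear.timeInterval a b) u) :
    (¬ u a =ᵐ[DoublyNonlinear.riemannianVolume n M] 0 →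
      (0 ≤ q * (p - 1) - 1 → ∀ t ∈ DoublyNonlinear.timeInterval a b,
        ¬ u t =ᵐ[DoublyNonlinear.riemannianVolume n M] 0) ∧
      (q * (p - 1) - 1 < 0 → ∀ t : ℝ, a ≤ t →
        (t : EReal) < DoublyNonlinear.extinctionBound a b
          (DoublyNonlinear.frequency n φ p q (u a)) (q * (p - 1) - 1) →
        ¬ u t =ᵐ[DoublyNonlinear.riemannianVolume n M] 0)) ∧
    (0 ≤ q * (p - 1) - 1 → ∀ c : ℝ, (c : EReal) = b →
      u c =ᵐ[DoublyNonlinear.riemannianVolume n M] 0 →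
      ∀ t ∈ DoublyNonlinear.timeInterval a b,
        u t =ᵐ[DoublyNonlinear.riemannianVolume n M] 0) := by
  have hφc := hφ.continuous
  have hm : ∀ t ∈ DoublyNonlinear.timeInterval a b,
      MemLp (u t) (ENNReal.ofReal (q + 1)) (DoublyNonlinear.weightedVolume n φ) := fun t ht ↦ by
    obtain ⟨ut, hut⟩ := hu
    exact (hut t ht).1.memLp
  -- The initial time s is arbitrary: s = a gives the forward statements, and s = t with final time
  -- b gives backward uniqueness by contraposition.
  have hmain : ∀ s ∈ DoublyNonlinear.timeInterval a b, ∀ t ∈ DoublyNonlinear.timeInterval a b,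
      s ≤ t → ¬ u s =ᵐ[DoublyNonlinear.riemannianVolume n M] 0 →
      (q * (p - 1) - 1 < 0 →
        0 < 1 - (q * (p - 1) - 1) * DoublyNonlinear.frequency n φ p q (u s) * (t - s)) →
      ¬ u t =ᵐ[DoublyNonlinear.riemannianVolume n M] 0 := by
    intro s hs t ht hst h0 hδ
    rw [← DoublyNonlinear.energyI_pos_iff hφc hq (hm t ht)]
    refine hu.energyI_pos hφc hp hq hst (fun τ hτ ↦ ⟨hs.1.trans hτ.1, ?_⟩)
      ((DoublyNonlinear.energyI_pos_iff hφc hq (hm s hs)).2 h0) hδ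
    exact (EReal.coe_le_coe_iff.2 hτ.2).trans ht.2
  have haJ : a ∈ DoublyNonlinear.timeInterval a b := ⟨le_rfl, hab.le⟩
  refine ⟨fun h0 ↦ ⟨fun hδ t ht ↦ hmain a haJ t ht ht.1 h0 fun h ↦ absurd hδ (not_le.2 h),
    fun _ t hat ht ↦ hmain a haJ t ⟨hat, (ht.trans_le (min_le_right _ _)).le⟩ hat h0 fun _ ↦
      DoublyNonlinear.one_sub_pos_of_lt_extinctionBound hat ht⟩, fun hδ c hc h0 t ht ↦ ?_⟩
  have htc : t ≤ c := EReal.coe_le_coe_iff.1 (ht.2.trans_eq hc.symm)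
  by_contra h
  exact hmain t ht c ⟨ht.1.trans htc, hc.le⟩ htc h (fun h ↦ absurd hδ (not_le.2 h)) h0
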